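/- For an integer $k\ge 0$ let $\|f\|_{\Sigma^k}=\|f\|_{H^k(\mathbb R)}+\||x|^kf\|_{L^2(\mathbb R)}$, where $\|f\|_{H^k}=\|(1-\partial_x^2)^{k/2}f\|_{L^2}$, let $\Sigma^k=\{f\in L^2(\mathbb R;\mathbb C):\|f\|_{\Sigma^k}<\infty\}$, and for pairs put $\|(f,g)\|_{\Sigma^k}=\|f\|_{\Sigma^k}+\|g\|_{\Sigma^k}$. Consider the coupled system $$\partial_t u=i\partial_x^2u+2u^2\bar v,\qquad \partial_t v=i\partial_x^2v-2v^2\bar u,\qquad x\in\mathbb R, \tag{1}$$ and, for $\tau>0$, its Strang splitting step $\tilde\Phi_\tau$, defined by $$u_*=e^{i\frac\tau2\partial_x^2}u_0,\quad v_*=e^{i\frac\tau2\partial_x^2}v_0,\qquad \tilde\Phi_\tau(u_0,v_0)=\Bigl(e^{i\frac\tau2\partial_x^2}\bigl(e^{2\tau u_*\bar v_*}u_*\bigr),\;e^{i\frac\tau2\partial_x^2}\bigl(e^{-2\tau\bar u_*v_*}v_*\bigr)\Bigr).$$ **Proposition.** Let $k>1/2$ be an integer, $T>0$ and $M\ge 0$.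 There is a constant $C>0$, depending only on $k$, $T$ and $M$, such that the following holds for every $0<\tau\le T$. Let $(u,v):[0,\tau]\to L^2(\mathbb R)^2$ be a solution of (1) on $[0,\tau]$ (differentiable in time with values in $L^2$, with $\partial_x^2u(t),\partial_x^2v(t)\in L^2$ in the sense of distributions) such that $\sup_{t\in[0,\tau]}\|(u(t),v(t))\|_{\Sigma^{k+4}}\le M$, and put $(u_0,v_0)=(u(0),v(0))$. Then the functions $e^{2\tau u_*\bar v_*}u_*$ and $e^{-2\tau\bar u_*v_*}v_*$ belong to $L^2(\mathbb R)$, so that $\tilde\Phi_\tau(u_0,v_0)$ is defined, and $$\bigl\|\tilde\Phi_\tau(u_0,v_0)-(u(\tau),v(\tau))\bigr\|_{\Sigma^k}\le C\tau^3 .$$ -/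

import Mathlib

namespace CoupledNLS

noncomputable section

open MeasureTheory Set
open scoped FourierTransform SchwartzMap ENNReal NNReal ComplexConjugate Laplacian

/-- The complex Hilbert space `L²(ℝ)`. -/
abbrev L2 : Type := Lp ℂ 2 (volume : Measure ℝ)

/-- The Sobolev norm `‖f‖_{H^k} = ‖(1 - ∂_x²)^{k/2} f‖_{L²}`, with value `∞` if `f ∉ H^k(ℝ)`.
With the normalisation `𝓕 f ξ = ∫ e^{-2πixξ} f x dx`, the symbol of `1 - ∂_x²` is
`1 + (2πξ)²`. -/
def sobolevNorm (k : ℕ) (f : L2) : ℝ≥0∞ :=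
  eLpNorm (fun ξ : ℝ => (((1 + (2 * Real.pi * ξ) ^ 2) ^ ((k : ℝ) / 2) : ℝ) : ℂ) * (𝓕 f : L2) ξ)
    2 volume

/-- The norm `‖f‖_{Σ^k} = ‖f‖_{H^k} + ‖|x|^k f‖_{L²}`, with value `∞` if `f ∉ Σ^k`. -/
def sigmaNorm (k : ℕ) (f : L2) : ℝ≥0∞ :=
  sobolevNorm k f + eLpNorm (fun x : ℝ => ((|x| ^ k : ℝ) : ℂ) * f x) 2 volume

/-- The norm `‖(f, g)‖_{Σ^k} = ‖f‖_{Σ^k} + ‖g‖_{Σ^k}` of a pair. -/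
def sigmaNormPair (k : ℕ) (w : L2 × L2) : ℝ≥0∞ :=
  sigmaNorm k w.1 + sigmaNorm k w.2

/-- The symbol `e^{-it(2πξ)²}` of the free Schrödinger group `e^{it∂_x²}`. -/
def freeSymbol (t ξ : ℝ) : ℂ :=
  Complex.exp (((-(t * (2 * Real.pi * ξ) ^ 2) : ℝ) : ℂ) * Complex.I)

theorem memLp_freeSymbol_mul (t : ℝ) (g : L2) :
    MemLp (fun ξ => freeSymbol t ξ * g ξ) 2 (volume : Measure ℝ) := by
  refine MemLp.of_le (Lp.memLp g) ?_ (Filter.Eventually.of_forall fun ξ => ?_)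
  · refine AEStronglyMeasurable.mul (Continuous.aestronglyMeasurable ?_)
      (Lp.memLp g).aestronglyMeasurable
    unfold freeSymbol
    fun_prop
  · rw [norm_mul, freeSymbol, Complex.norm_exp_ofReal_mul_I, one_mul]

/-- The free Schrödinger group `e^{it∂_x²}` on `L²(ℝ)`. -/
def freeFlow (t : ℝ) (f : L2) : L2 :=
  𝓕⁻ ((memLp_freeSymbol_mul t (𝓕 f)).toLp _ : L2)

/-- First component `e^{2t f ḡ} f` of the flow of `∂_t u = 2u²v̄`, `∂_t v = -2v²ū`
with initial value `(f, g)`. -/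
def nonlinFst (t : ℝ) (f g : L2) : ℝ → ℂ :=
  fun x => Complex.exp (2 * (t : ℂ) * f x * conj (g x)) * f x

/-- Second component `e^{-2t f̄ g} g` of the flow of `∂_t u = 2u²v̄`, `∂_t v = -2v²ū`
with initial value `(f, g)`. -/
def nonlinSnd (t : ℝ) (f g : L2) : ℝ → ℂ :=
  fun x => Complex.exp (-(2 * (t : ℂ) * conj (f x) * g x)) * g x

open Classical in
/-- The class in `L²(ℝ)` of a square integrable function (`0` for any other function). -/
def toL2 (h : ℝ → ℂ) : L2 :=
  if hh : MemLp h 2 (volume : Measure ℝ) then hh.toLp h else 0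

/-- The linear half step `(e^{i(τ/2)∂_x²} f, e^{i(τ/2)∂_x²} g)`. -/
def halfStep (τ : ℝ) (w : L2 × L2) : L2 × L2 :=
  (freeFlow (τ / 2) w.1, freeFlow (τ / 2) w.2)

/-- The full nonlinear step applied to `w` stays in `L²(ℝ) × L²(ℝ)`. -/
def NonlinStepInL2 (τ : ℝ) (w : L2 × L2) : Prop :=
  MemLp (nonlinFst τ w.1 w.2) 2 volume ∧ MemLp (nonlinSnd τ w.1 w.2) 2 volume

/-- The full nonlinear step, meaningful for those `w` with `NonlinStepInL2 τ w`. -/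
def nonlinStep (τ : ℝ) (w : L2 × L2) : L2 × L2 :=
  (toL2 (nonlinFst τ w.1 w.2), toL2 (nonlinSnd τ w.1 w.2))

/-- The Strang splitting step `Φ̃_τ`: linear half step, nonlinear step, linear half step. -/
def strang (τ : ℝ) (w : L2 × L2) : L2 × L2 :=
  halfStep τ (nonlinStep τ (halfStep τ w))

/-- `(u, v)` solves `∂_t u = i∂_x²u + 2u²v̄`, `∂_t v = i∂_x²v - 2v²ū` on `[0, τ]`: the time
derivatives are taken in `L²(ℝ)` (one-sided at the end points), and `∂_x²` is the distributional
derivative, required to be in `L²(ℝ)`. -/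
def IsSolutionOn (τ : ℝ) (u v : ℝ → L2) : Prop :=
  ∀ t ∈ Icc (0 : ℝ) τ, ∃ du dv uxx vxx : L2,
    HasDerivWithinAt u du (Icc 0 τ) t ∧ HasDerivWithinAt v dv (Icc 0 τ) t ∧
    (uxx : 𝓢'(ℝ, ℂ)) = Δ (u t : 𝓢'(ℝ, ℂ)) ∧ (vxx : 𝓢'(ℝ, ℂ)) = Δ (v t : 𝓢'(ℝ, ℂ)) ∧
    (∀ᵐ x : ℝ, du x = Complex.I * uxx x + 2 * (u t x) ^ 2 * conj (v t x)) ∧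
    (∀ᵐ x : ℝ, dv x = Complex.I * vxx x - 2 * (v t x) ^ 2 * conj (u t x))

end

end CoupledNLS

/-!
The local error of the Strang splitting is of third order in `Σ^k` for three reasons.

*The norm.* `Σ^k` is the phase space norm `phaseNorm k f = ‖(1 + |x|)^k f‖ + ‖(1 + |ξ|)^k 𝓕 f‖`, up
to constants (`phaseNorm_le_sigmaNorm`, `sigmaNorm_le_phaseNorm`). For `k ≥ 1` it is an algebra norm
(`exists_phaseNorm_mulL2_le`, by Young's inequality for the convolution of Fourier transforms), the
free flow is bounded on it, uniformly for bounded times (`exists_phaseNorm_freeFlow_le`), and `∂_x²`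
maps the norm of order `k + 2` to the norm of order `k` (`exists_phaseNorm_lap_le`). The last two facts
mix position and frequency. Both are read off the short-time Fourier transform, whose `L²` norm over
phase space with weight `(1 + |x| + |ξ|)^k` is dominated by the phase space norm
(`lintegral_stft_le`) and dominates the position part of it (`le_lintegral_stft`): the free flow shears
phase space and chirps the window (`enorm_stft_free`), and a second derivative falls on the window or
becomes a factor `ξ` (`stft_lap`).

*The solution.* In the interaction picture `U(t) = e^{i(τ/2 - t)∂_x²} u(t)` the equation reads
`U' = e^{i(τ/2 - t)∂_x²} N` with `N = 2u²v̄`. Each further time derivative of `N` costs two orders of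
the phase space norm, so a bound in `Σ^(k+4)` gives `U'''` in `Σ^k` (`reg_two_of_isDer`,
`Reg.exists_isDer_freeFlow`). The derivatives are taken in `L²` only; estimates in `phaseNorm` are
obtained by applying the bounded operators `testCLM`, which detect this norm. The midpoint rule gives
`U(τ) = U(0) + τ N(τ/2) + O(τ³)`, where `U(0) = e^{i(τ/2)∂_x²} u(0)`, `U(τ) = e^{-i(τ/2)∂_x²} u(τ)` and,
because `U(τ/2) = u(τ/2)`, `N(τ/2)` is the nonlinearity at `(u(τ/2), v(τ/2))`; Taylor's formula gives
`u(τ/2) = U(0) + (τ/2) N(τ/2) + O(τ²)` (`interaction_expansion`).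

*The splitting.* The nonlinear step applied to `f = U(0)` and `g`, its analogue for `v`, has the
expansion `e^{2τfḡ} f = f + 2τ f²ḡ + 2τ² f³ḡ² + O(τ³)` (`BigO.exp_remainder`). Inserting the expansions
of `u(τ/2)` and `v(τ/2)` into `τ N(τ/2)` yields the same polynomial up to `O(τ³)`: in
`2u²v̄` the correction of `u²` contributes `4τ f³ḡ²` and that of `v̄`, which has the opposite sign,
contributes `-2τ f³ḡ²` (`BigO.strang_algebra`). The second component follows from the first, as `(v, -u)` solves the same
system (`IsRegularSolution.swap`).
-/

namespace CoupledNLS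

noncomputable section

open MeasureTheory Set Filter Topology
open scoped FourierTransform SchwartzMap ENNReal NNReal ComplexConjugate Laplacian

/-! ### The Fourier transform of integrable square integrable functions -/

theorem integral_fourier_mul_flip {f g : ℝ → ℂ} (hf : Integrable f) (hg : Integrable g) :
    ∫ ξ, 𝓕 f ξ * g ξ = ∫ x, f x * 𝓕 g x := by
  have := VectorFourier.integral_fourierIntegral_smul_eq_flip (μ := (volume : Measure ℝ))
    (ν := (volume : Measure ℝ)) (L := innerₗ ℝ) Real.continuous_fourierChar continuous_inner hf hg
  rwa [flip_innerₗ] at this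

theorem fourier_integral_continuous {f : ℝ → ℂ} (hf : Integrable f) : Continuous (𝓕 f) :=
  VectorFourier.fourierIntegral_continuous Real.continuous_fourierChar continuous_inner hf

theorem fourierInv_integral_continuous {f : ℝ → ℂ} (hf : Integrable f) : Continuous (𝓕⁻ f) := by
  have : (𝓕⁻ f) = fun x => 𝓕 f (-x) := by
    ext x; exact Real.fourierInv_eq_fourier_neg f x
  rw [this]
  exact (fourier_integral_continuous hf).comp continuous_neg

theorem integral_fourierInv_mul_flip {f g : ℝ → ℂ} (hf : Integrable f) (hg : Integrable g) :
    ∫ ξ, 𝓕⁻ f ξ * g ξ = ∫ x, f x * 𝓕⁻ g x := by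
  simp_rw [Real.fourierInv_eq_fourier_comp_neg f, Real.fourierInv_eq_fourier_neg g]
  rw [integral_fourier_mul_flip hf.comp_neg hg]
  rw [← integral_neg_eq_self (fun x => f (-x) * 𝓕 g x)]
  simp

/-- On `L¹ ∩ L²` the Fourier transform of `L²` is given by the Fourier integral. -/
theorem coeFn_fourier_ae {f : L2} (hf : Integrable f) : ⇑(𝓕 f : L2) =ᵐ[volume] 𝓕 (f : ℝ → ℂ) := by
  refine ae_eq_of_integral_contDiff_smul_eq
    ((Lp.memLp (𝓕 f : L2)).locallyIntegrable (by norm_num))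
    (fourier_integral_continuous hf).locallyIntegrable fun g hg hgc => ?_
  have hgs : HasCompactSupport (fun x => (g x : ℂ)) :=
    hgc.comp_left (g := fun y : ℝ => (y : ℂ)) Complex.ofReal_zero
  have hgd : ContDiff ℝ ((⊤ : ℕ∞) : WithTop ℕ∞) (fun x => (g x : ℂ)) := Complex.ofRealCLM.contDiff.comp hg
  set φ : 𝓢(ℝ, ℂ) := hgs.toSchwartzMap hgd with hφ
  have h1 := congrArg (fun T : 𝓢'(ℝ, ℂ) => T φ) (Lp.fourier_toTemperedDistribution_eq f)
  simp only [TemperedDistribution.fourier_apply, Lp.toTemperedDistribution_apply] at h1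
  have h2 := integral_fourier_mul_flip φ.integrable hf
  rw [SchwartzMap.fourier_coe] at h1
  calc ∫ x, g x • (𝓕 f : L2) x = ∫ x, φ x • (𝓕 f : L2) x := rfl
    _ = _ := h1.symm
    _ = _ := h2
    _ = ∫ x, g x • 𝓕 (f : ℝ → ℂ) x := rfl

theorem coeFn_fourierInv_ae {f : L2} (hf : Integrable f) :
    ⇑(𝓕⁻ f : L2) =ᵐ[volume] 𝓕⁻ (f : ℝ → ℂ) := by
  refine ae_eq_of_integral_contDiff_smul_eq
    ((Lp.memLp (𝓕⁻ f : L2)).locallyIntegrable (by norm_num))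
    (fourierInv_integral_continuous hf).locallyIntegrable fun g hg hgc => ?_
  have hgs : HasCompactSupport (fun x => (g x : ℂ)) :=
    hgc.comp_left (g := fun y : ℝ => (y : ℂ)) Complex.ofReal_zero
  have hgd : ContDiff ℝ ((⊤ : ℕ∞) : WithTop ℕ∞) (fun x => (g x : ℂ)) := Complex.ofRealCLM.contDiff.comp hg
  set φ : 𝓢(ℝ, ℂ) := hgs.toSchwartzMap hgd with hφ
  have h1 := congrArg (fun T : 𝓢'(ℝ, ℂ) => T φ) (Lp.fourierInv_toTemperedDistribution_eq f)
  simp only [TemperedDistribution.fourierInv_apply, Lp.toTemperedDistribution_apply] at h1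
  have h2 := integral_fourierInv_mul_flip φ.integrable hf
  rw [SchwartzMap.fourierInv_coe] at h1
  calc ∫ x, g x • (𝓕⁻ f : L2) x = ∫ x, φ x • (𝓕⁻ f : L2) x := rfl
    _ = _ := h1.symm
    _ = _ := h2
    _ = ∫ x, g x • 𝓕⁻ (f : ℝ → ℂ) x := rfl

theorem fourierIntegral_congr_ae {f g : ℝ → ℂ} (h : f =ᵐ[volume] g) : 𝓕 f = 𝓕 g := by
  ext ξ
  simp only [Real.fourier_eq]
  exact integral_congr_ae (h.mono fun x hx => by simp only [hx])

theorem fourierInvIntegral_congr_ae {f g : ℝ → ℂ} (h : f =ᵐ[volume] g) : 𝓕⁻ f = 𝓕⁻ g := by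
  ext ξ
  simp only [Real.fourierInv_eq]
  exact integral_congr_ae (h.mono fun x hx => by simp only [hx])

theorem fourier_toLp_ae {f : ℝ → ℂ} (hf : Integrable f) (hf2 : MemLp f 2) :
    ⇑(𝓕 (hf2.toLp f) : L2) =ᵐ[volume] 𝓕 f := by
  have h := hf2.coeFn_toLp
  rw [← fourierIntegral_congr_ae h]
  exact coeFn_fourier_ae (hf.congr h.symm)

theorem fourierInv_toLp_ae {f : ℝ → ℂ} (hf : Integrable f) (hf2 : MemLp f 2) :
    ⇑(𝓕⁻ (hf2.toLp f) : L2) =ᵐ[volume] 𝓕⁻ f := by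
  have h := hf2.coeFn_toLp
  rw [← fourierInvIntegral_congr_ae h]
  exact coeFn_fourierInv_ae (hf.congr h.symm)

theorem eLpNorm_two_sq (f : ℝ → ℂ) : eLpNorm f 2 volume ^ 2 = ∫⁻ x, ‖f x‖ₑ ^ 2 := by
  have := eLpNorm_nnreal_pow_eq_lintegral (f := f) (μ := (volume : Measure ℝ)) (p := 2) (by simp)
  simpa using this

/-- Plancherel's identity for the Fourier integral. -/
theorem lintegral_fourier_sq {f : ℝ → ℂ} (hf : Integrable f) (hf2 : MemLp f 2) :
    ∫⁻ ξ, ‖𝓕 f ξ‖ₑ ^ 2 = ∫⁻ x, ‖f x‖ₑ ^ 2 := by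
  rw [← eLpNorm_two_sq, ← eLpNorm_two_sq, ← eLpNorm_congr_ae (fourier_toLp_ae hf hf2),
    ← Lp.enorm_def, ← eLpNorm_congr_ae hf2.coeFn_toLp, ← Lp.enorm_def]
  congr 1
  rw [enorm_eq_iff_norm_eq, Lp.norm_fourier_eq]

theorem lintegral_fourierInv_sq {f : ℝ → ℂ} (hf : Integrable f) (hf2 : MemLp f 2) :
    ∫⁻ ξ, ‖𝓕⁻ f ξ‖ₑ ^ 2 = ∫⁻ x, ‖f x‖ₑ ^ 2 := by
  simp_rw [Real.fourierInv_eq_fourier_neg]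
  rw [← lintegral_fourier_sq hf hf2]
  exact lintegral_neg_eq_self (fun x => ‖𝓕 f x‖ₑ ^ 2)

/-! ### Polynomially weighted `L²` norms -/

/-- The weight `(1 + |x|)^m`. -/
def wt (m : ℕ) (x : ℝ) : ℝ := (1 + |x|) ^ m

/-- The weighted norm `‖(1 + |x|)^m g‖_{L²}`. -/
def weightNorm (m : ℕ) (g : ℝ → ℂ) : ℝ≥0∞ := eLpNorm (fun x => (wt m x : ℂ) * g x) 2 volume

theorem one_le_wt (m : ℕ) (x : ℝ) : 1 ≤ wt m x := one_le_pow₀ (by simp)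

theorem wt_pos (m : ℕ) (x : ℝ) : 0 < wt m x := zero_lt_one.trans_le (one_le_wt m x)

@[fun_prop]
theorem continuous_wt (m : ℕ) : Continuous (wt m) := by unfold wt; fun_prop

@[fun_prop]
theorem measurable_wt (m : ℕ) : Measurable (wt m) := (continuous_wt m).measurable

theorem wt_mono {m n : ℕ} (h : m ≤ n) (x : ℝ) : wt m x ≤ wt n x :=
  pow_le_pow_right₀ (by simp) h

theorem wt_add (m n : ℕ) (x : ℝ) : wt (m + n) x = wt m x * wt n x := pow_add _ _ _

/-- Peetre's inequality for the weight. -/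
theorem wt_add_le (m : ℕ) (x y : ℝ) : wt m (x + y) ≤ wt m x * wt m y := by
  unfold wt
  rw [← mul_pow]
  refine pow_le_pow_left₀ (by positivity) ?_ _
  nlinarith [abs_add_le x y, abs_nonneg x, abs_nonneg y, mul_nonneg (abs_nonneg x) (abs_nonneg y)]

/-- Subadditivity of the weight up to a constant. -/
theorem wt_add_le_add (m : ℕ) (x y : ℝ) : wt m (x + y) ≤ 2 ^ m * (wt m x + wt m y) := by
  unfold wt
  calc (1 + |x + y|) ^ m ≤ ((1 + |x|) + (1 + |y|)) ^ m :=
        pow_le_pow_left₀ (by positivity) (by linarith [abs_add_le x y]) _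
    _ ≤ 2 ^ (m - 1) * ((1 + |x|) ^ m + (1 + |y|) ^ m) := add_pow_le (by positivity) (by positivity) m
    _ ≤ _ := by gcongr <;> norm_num

theorem enorm_wt (m : ℕ) (x : ℝ) : ‖(wt m x : ℂ)‖ₑ = ENNReal.ofReal (wt m x) := by
  rw [← ofReal_norm, Complex.norm_real, Real.norm_of_nonneg (wt_pos m x).le]

theorem weightNorm_sq (m : ℕ) (g : ℝ → ℂ) :
    weightNorm m g ^ 2 = ∫⁻ x, ENNReal.ofReal (wt m x) ^ 2 * ‖g x‖ₑ ^ 2 := by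
  rw [weightNorm, eLpNorm_two_sq]
  simp_rw [enorm_mul, enorm_wt, mul_pow]

theorem weightNorm_congr {m : ℕ} {f g : ℝ → ℂ} (h : f =ᵐ[volume] g) :
    weightNorm m f = weightNorm m g :=
  eLpNorm_congr_ae (h.mono fun x hx => by simp only [hx])

theorem weightNorm_mono {m n : ℕ} (h : m ≤ n) (g : ℝ → ℂ) : weightNorm m g ≤ weightNorm n g := by
  refine eLpNorm_mono fun x => ?_
  simp only [norm_mul, Complex.norm_real, Real.norm_of_nonneg (wt_pos _ x).le]
  exact mul_le_mul_of_nonneg_right (wt_mono h x) (norm_nonneg _)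

theorem aesm_wt_mul (m : ℕ) {g : ℝ → ℂ} (hg : AEStronglyMeasurable g) :
    AEStronglyMeasurable (fun x => (wt m x : ℂ) * g x) :=
  (Complex.continuous_ofReal.comp (continuous_wt m)).aestronglyMeasurable.mul hg

theorem weightNorm_add_le (m : ℕ) {f g : ℝ → ℂ} (hf : AEStronglyMeasurable f)
    (hg : AEStronglyMeasurable g) :
    weightNorm m (fun x => f x + g x) ≤ weightNorm m f + weightNorm m g := by
  unfold weightNorm
  simp_rw [mul_add]
  exact eLpNorm_add_le (aesm_wt_mul m hf) (aesm_wt_mul m hg) (by norm_num)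

theorem weightNorm_const_mul (m : ℕ) (c : ℂ) (f : ℝ → ℂ) :
    weightNorm m (fun x => c * f x) = ‖c‖ₑ * weightNorm m f := by
  unfold weightNorm
  rw [← eLpNorm_const_smul]
  congr 1; ext x; simp only [Pi.smul_apply, smul_eq_mul]; ring

/-- Comparison of weighted norms under a pointwise bound. -/
theorem weightNorm_le_mul {m n : ℕ} {f g : ℝ → ℂ} {c : ℝ}
    (h : ∀ᵐ x, wt m x * ‖f x‖ ≤ c * (wt n x * ‖g x‖)) :
    weightNorm m f ≤ ENNReal.ofReal c * weightNorm n g := by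
  unfold weightNorm
  refine eLpNorm_le_mul_eLpNorm_of_ae_le_mul ?_ 2
  filter_upwards [h] with x hx
  simpa only [norm_mul, Complex.norm_real, Real.norm_of_nonneg (wt_pos _ x).le] using hx

theorem weightNorm_zero_eq (f : L2) : weightNorm 0 f = ‖f‖ₑ := by
  rw [Lp.enorm_def, weightNorm]; simp [wt]

/-- The symmetric phase space norm `‖(1 + |x|)^m f‖_{L²} + ‖(1 + |ξ|)^m 𝓕 f‖_{L²}`, equivalent to
`sigmaNorm m`. -/
def phaseNorm (m : ℕ) (f : L2) : ℝ≥0∞ := weightNorm m f + weightNorm m (𝓕 f : L2)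

theorem weightNorm_le_phaseNorm (m : ℕ) (f : L2) : weightNorm m f ≤ phaseNorm m f := le_self_add

theorem weightNorm_fourier_le_phaseNorm (m : ℕ) (f : L2) :
    weightNorm m (𝓕 f : L2) ≤ phaseNorm m f := le_add_self

theorem phaseNorm_mono {m n : ℕ} (h : m ≤ n) (f : L2) : phaseNorm m f ≤ phaseNorm n f :=
  add_le_add (weightNorm_mono h _) (weightNorm_mono h _)

theorem enorm_le_phaseNorm (m : ℕ) (f : L2) : ‖f‖ₑ ≤ phaseNorm m f := by
  rw [← weightNorm_zero_eq]
  exact (weightNorm_mono (Nat.zero_le m) _).trans (weightNorm_le_phaseNorm m f)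

theorem weightNorm_add_le' (m : ℕ) (f g : L2) :
    weightNorm m (f + g : L2) ≤ weightNorm m f + weightNorm m g := by
  rw [weightNorm_congr (Lp.coeFn_add f g)]
  exact weightNorm_add_le m (Lp.aestronglyMeasurable f) (Lp.aestronglyMeasurable g)

theorem weightNorm_smul (m : ℕ) (c : ℂ) (f : L2) :
    weightNorm m (c • f : L2) = ‖c‖ₑ * weightNorm m f := by
  rw [weightNorm_congr (Lp.coeFn_smul c f)]
  exact weightNorm_const_mul m c f

theorem phaseNorm_add_le (m : ℕ) (f g : L2) :
    phaseNorm m (f + g) ≤ phaseNorm m f + phaseNorm m g := by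
  unfold phaseNorm
  rw [FourierTransform.fourier_add]
  calc _ ≤ (weightNorm m f + weightNorm m g) +
      (weightNorm m (𝓕 f : L2) + weightNorm m (𝓕 g : L2)) :=
        add_le_add (weightNorm_add_le' _ _ _) (weightNorm_add_le' _ _ _)
    _ = _ := by ring

theorem phaseNorm_smul (m : ℕ) (c : ℂ) (f : L2) : phaseNorm m (c • f) = ‖c‖ₑ * phaseNorm m f := by
  unfold phaseNorm
  rw [FourierTransform.fourier_smul, weightNorm_smul, weightNorm_smul, mul_add]

theorem phaseNorm_neg (m : ℕ) (f : L2) : phaseNorm m (-f) = phaseNorm m f := by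
  have := phaseNorm_smul m (-1) f
  simpa using this

theorem phaseNorm_sub_le (m : ℕ) (f g : L2) :
    phaseNorm m (f - g) ≤ phaseNorm m f + phaseNorm m g := by
  rw [sub_eq_add_neg, ← phaseNorm_neg m g]
  exact phaseNorm_add_le m f (-g)

/-- `(1 + |x|)⁻¹` is square integrable; by Cauchy–Schwarz, `L²` with the weight `1 + |x|` then embeds
into `L¹`. -/
theorem lintegral_inv_wt_lt_top : ∫⁻ x : ℝ, (ENNReal.ofReal (wt 1 x))⁻¹ ^ 2 < ∞ := by
  have h := integrable_one_add_norm (E := ℝ) (μ := volume) (r := 2) (by simp)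
  refine lt_of_eq_of_lt (lintegral_congr fun x => ?_) h.lintegral_lt_top
  rw [← ENNReal.ofReal_inv_of_pos (wt_pos 1 x), ← ENNReal.ofReal_pow (inv_nonneg.2 (wt_pos 1 x).le)]
  congr 1
  rw [Real.rpow_neg (by positivity), inv_pow, wt, pow_one, Real.norm_eq_abs]
  norm_num

/-- The `L²` norm of `(1 + |x|)⁻¹`. -/
def embConst : ℝ≥0∞ := (∫⁻ x : ℝ, (ENNReal.ofReal (wt 1 x))⁻¹ ^ 2) ^ (1 / 2 : ℝ)

theorem embConst_lt_top : embConst < ∞ :=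
  ENNReal.rpow_lt_top_of_nonneg (by norm_num) lintegral_inv_wt_lt_top.ne

/-- Cauchy–Schwarz: a weight of order at least one makes square integrable functions integrable. -/
theorem lintegral_enorm_le (g : ℝ → ℂ) (hg : AEStronglyMeasurable g) {m : ℕ} (hm : 1 ≤ m) :
    ∫⁻ x, ‖g x‖ₑ ≤ embConst * weightNorm m g := by
  refine le_trans ?_ (mul_le_mul_right (weightNorm_mono hm g) _)
  have h := ENNReal.lintegral_mul_le_Lp_mul_Lq (volume : Measure ℝ) Real.HolderConjugate.two_two
    (f := fun x => (ENNReal.ofReal (wt 1 x))⁻¹) (g := fun x => ‖(wt 1 x : ℂ) * g x‖ₑ)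
    (by have := continuous_wt 1; fun_prop) (aesm_wt_mul 1 hg).enorm
  have e : (∫⁻ x, ‖(wt 1 x : ℂ) * g x‖ₑ ^ (2 : ℝ)) ^ (1 / 2 : ℝ) = weightNorm 1 g := by
    rw [weightNorm, eLpNorm_eq_lintegral_rpow_enorm_toReal (by norm_num) (by norm_num)]
    simp
  rw [e] at h
  calc ∫⁻ x, ‖g x‖ₑ = ∫⁻ x, ((fun x => (ENNReal.ofReal (wt 1 x))⁻¹) *
        (fun x => ‖(wt 1 x : ℂ) * g x‖ₑ)) x := by
        refine lintegral_congr fun x => ?_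
        rw [Pi.mul_apply, enorm_mul, enorm_wt, ← mul_assoc, ENNReal.inv_mul_cancel, one_mul]
        · simpa using wt_pos 1 x
        · exact ENNReal.ofReal_ne_top
    _ ≤ _ := h
    _ = _ := by simp [embConst]

theorem integrable_of_weightNorm {g : ℝ → ℂ} (hg : AEStronglyMeasurable g) {m : ℕ} (hm : 1 ≤ m)
    (h : weightNorm m g < ∞) : Integrable g :=
  ⟨hg, (lintegral_enorm_le g hg hm).trans_lt (ENNReal.mul_lt_top embConst_lt_top h)⟩

theorem memLp_of_weightNorm {g : ℝ → ℂ} (hg : AEStronglyMeasurable g) {m : ℕ}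
    (h : weightNorm m g < ∞) : MemLp g 2 := by
  refine ⟨hg, ?_⟩
  have : weightNorm 0 g = eLpNorm g 2 volume := by simp [weightNorm, wt]
  rw [← this]
  exact (weightNorm_mono (Nat.zero_le m) g).trans_lt h

/-! ### The short-time Fourier transform -/

/-- The short-time Fourier transform in its frequency side form, as a function of the frequency
side `F`, the frequency side window `γ`, the position `x` and the frequency `ξ`. -/
@[irreducible]
def stft (γ F : ℝ → ℂ) (x ξ : ℝ) : ℂ := 𝓕⁻ (fun η => F η * γ (η - ξ)) x

theorem fourier_norm_le (w : ℝ → ℂ) (ξ : ℝ) : ‖𝓕 w ξ‖ ≤ ∫ x, ‖w x‖ :=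
  VectorFourier.norm_fourierIntegral_le_integral_norm _ _ _ _ _

theorem wt_neg (m : ℕ) (x : ℝ) : wt m (-x) = wt m x := by simp [wt]

/-- The position side form of the short-time Fourier transform. -/
theorem stft_eq_fourier {F w : ℝ → ℂ} (hF : Integrable F) (hw : Integrable w) (x ξ : ℝ) :
    stft (𝓕 w) F x ξ =
      Real.fourierChar (x * ξ) * 𝓕 (fun y => 𝓕⁻ F y * w (x - y)) ξ := by
  set q : ℝ → ℂ := fun y => Real.fourierChar (-(y * ξ)) * w (x - y) with hq
  have hqi : Integrable q := by
    refine (hw.comp_sub_left x).bdd_mul (c := 1) ?_ (Eventually.of_forall fun y => (Circle.norm_coe _).le)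
    exact (by fun_prop : Continuous fun y : ℝ =>
      ((Real.fourierChar (-(y * ξ)) : Circle) : ℂ)).aestronglyMeasurable
  have h1 : 𝓕 (fun y => 𝓕⁻ F y * w (x - y)) ξ = ∫ y, 𝓕⁻ F y * q y := by
    rw [Real.fourier_real_eq]
    refine integral_congr_ae (Eventually.of_forall fun y => ?_)
    simp only [hq, Circle.smul_def, smul_eq_mul]
    ring
  have h2 : ∀ η, 𝓕⁻ q η = Real.fourierChar (x * (η - ξ)) * 𝓕 w (η - ξ) := by
    intro η
    rw [Real.fourierInv_eq', Real.fourier_real_eq, ← integral_const_mul,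
      ← integral_sub_left_eq_self _ (volume : Measure ℝ) x]
    refine integral_congr_ae (Eventually.of_forall fun y => ?_)
    simp only [hq, Circle.smul_def, smul_eq_mul, Real.fourierChar_apply, sub_sub_cancel]
    simp only [← mul_assoc, ← Complex.exp_add]
    congr 2
    simp
    ring
  rw [h1, integral_fourierInv_mul_flip hF hqi, ← integral_const_mul, stft, Real.fourierInv_eq']
  refine integral_congr_ae (Eventually.of_forall fun η => ?_)
  simp only [h2, smul_eq_mul, Real.fourierChar_apply]
  have : Complex.exp (↑(2 * Real.pi * inner ℝ η x) * Complex.I) =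
      Complex.exp (↑(2 * Real.pi * (x * ξ)) * Complex.I) *
      Complex.exp (↑(2 * Real.pi * (x * (η - ξ))) * Complex.I) := by
    rw [← Complex.exp_add]; congr 1; simp; ring
  rw [this]; ring

theorem enorm_stft {F w : ℝ → ℂ} (hF : Integrable F) (hw : Integrable w) (x ξ : ℝ) :
    ‖stft (𝓕 w) F x ξ‖ₑ = ‖𝓕 (fun y => 𝓕⁻ F y * w (x - y)) ξ‖ₑ := by
  rw [stft_eq_fourier hF hw, enorm_mul, ← ofReal_norm, Circle.norm_coe, ENNReal.ofReal_one, one_mul]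

theorem memLp_fourierInv {F : ℝ → ℂ} (hF : Integrable F) (hF2 : MemLp F 2) : MemLp (𝓕⁻ F) 2 :=
  (memLp_congr_ae (fourierInv_toLp_ae hF hF2)).1 (Lp.memLp _)

/-- For fixed position, Plancherel's identity in the frequency variable. -/
theorem lintegral_stft_freq {F w : ℝ → ℂ} (hF : Integrable F) (hF2 : MemLp F 2)
    (hw : Integrable w) (hwc : Continuous w) {B : ℝ} (hB : ∀ x, ‖w x‖ ≤ B) (x : ℝ) :
    ∫⁻ ξ, ‖stft (𝓕 w) F x ξ‖ₑ ^ 2 = ∫⁻ y, ‖𝓕⁻ F y‖ₑ ^ 2 * ‖w (x - y)‖ₑ ^ 2 := by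
  simp_rw [enorm_stft hF hw]
  have hb : ∀ y, ‖𝓕⁻ F y‖ ≤ ∫ x, ‖F x‖ := fun y => by
    rw [Real.fourierInv_eq_fourier_neg]; exact fourier_norm_le F _
  have hm := (fourierInv_integral_continuous hF).aestronglyMeasurable (μ := volume)
  rw [lintegral_fourier_sq]
  · simp_rw [enorm_mul, mul_pow]
  · exact (hw.comp_sub_left x).bdd_mul (c := ∫ x, ‖F x‖) hm (Eventually.of_forall hb)
  · refine MemLp.mul (p := 2) (q := ∞) (r := 2) ?_ (memLp_fourierInv hF hF2)
    exact memLp_top_of_bound (by fun_prop) B (Eventually.of_forall fun y => hB _)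

/-- For fixed frequency, Plancherel's identity in the position variable. -/
theorem lintegral_stft_pos {F γ : ℝ → ℂ} (hF : Integrable F) (hF2 : MemLp F 2)
    (hγ : Continuous γ) {B : ℝ} (hB : ∀ x, ‖γ x‖ ≤ B) (ξ : ℝ) :
    ∫⁻ x, ‖stft γ F x ξ‖ₑ ^ 2 = ∫⁻ η, ‖F η‖ₑ ^ 2 * ‖γ (η - ξ)‖ₑ ^ 2 := by
  have hm : AEStronglyMeasurable (fun η => γ (η - ξ)) volume :=
    (by fun_prop : Continuous fun η => γ (η - ξ)).aestronglyMeasurable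
  unfold stft
  rw [lintegral_fourierInv_sq]
  · simp_rw [enorm_mul, mul_pow]
  · exact hF.mul_bdd (c := B) hm (Eventually.of_forall fun y => hB _)
  · refine MemLp.mul (p := 2) (q := ∞) (r := 2) ?_ hF2
    exact memLp_top_of_bound hm B (Eventually.of_forall fun y => hB _)

theorem measurable_stft {F γ : ℝ → ℂ} (hF : StronglyMeasurable F) (hγ : Continuous γ) :
    Measurable (fun z : ℝ × ℝ => stft γ F z.1 z.2) := by
  unfold stft
  simp_rw [Real.fourierInv_eq', smul_eq_mul]
  refine StronglyMeasurable.measurable ?_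
  refine StronglyMeasurable.integral_prod_right (f := fun (z : ℝ × ℝ) (η : ℝ) =>
    Complex.exp (↑(2 * Real.pi * inner ℝ η z.1) * Complex.I) * (F η * γ (η - z.2))) ?_
  refine StronglyMeasurable.mul (β := ℂ) ?_ (StronglyMeasurable.mul (β := ℂ) ?_ ?_)
  · exact Continuous.stronglyMeasurable (by fun_prop)
  · exact hF.comp_measurable measurable_snd
  · exact Continuous.stronglyMeasurable (by fun_prop)

/-- Convolution with `|w|²` is bounded in weighted `L¹`, by Peetre's inequality. With `p = 𝓕⁻ F`, or with
`p = F` and the roles of position and frequency exchanged, the left-hand side is the weighted energy of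
the short-time Fourier transform. -/
theorem weight_conv_upper (m : ℕ) {p w : ℝ → ℂ} (hp : AEMeasurable (fun y => ‖p y‖ₑ))
    (hw : Measurable w) :
    ∫⁻ x, ENNReal.ofReal (wt m x) ^ 2 * ∫⁻ y, ‖p y‖ₑ ^ 2 * ‖w (x - y)‖ₑ ^ 2 ≤
      weightNorm m w ^ 2 * weightNorm m p ^ 2 := by
  have hP : AEMeasurable (fun y => ENNReal.ofReal (wt m y) ^ 2 * ‖p y‖ₑ ^ 2) :=
    (by fun_prop : AEMeasurable fun y => ENNReal.ofReal (wt m y) ^ 2).mul (hp.pow_const (2 : ℕ))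
  calc ∫⁻ x, ENNReal.ofReal (wt m x) ^ 2 * ∫⁻ y, ‖p y‖ₑ ^ 2 * ‖w (x - y)‖ₑ ^ 2
      ≤ ∫⁻ x, ∫⁻ y, (ENNReal.ofReal (wt m y) ^ 2 * ‖p y‖ₑ ^ 2) *
          (ENNReal.ofReal (wt m (x - y)) ^ 2 * ‖w (x - y)‖ₑ ^ 2) := by
        refine lintegral_mono fun x => ?_
        rw [← lintegral_const_mul' _ _ (by finiteness)]
        refine lintegral_mono fun y => ?_
        have : ENNReal.ofReal (wt m x) ≤
            ENNReal.ofReal (wt m y) * ENNReal.ofReal (wt m (x - y)) := by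
          rw [← ENNReal.ofReal_mul (wt_pos m y).le]
          refine ENNReal.ofReal_le_ofReal ?_
          have := wt_add_le m y (x - y)
          rwa [add_sub_cancel] at this
        calc _ ≤ (ENNReal.ofReal (wt m y) * ENNReal.ofReal (wt m (x - y))) ^ 2 *
              (‖p y‖ₑ ^ 2 * ‖w (x - y)‖ₑ ^ 2) := by gcongr
          _ = _ := by ring
    _ = ∫⁻ y, ∫⁻ x, (ENNReal.ofReal (wt m y) ^ 2 * ‖p y‖ₑ ^ 2) *
          (ENNReal.ofReal (wt m (x - y)) ^ 2 * ‖w (x - y)‖ₑ ^ 2) := by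
        refine lintegral_lintegral_swap ?_
        have hP' := hP.comp_snd (μ := (volume : Measure ℝ))
        exact hP'.mul (by fun_prop)
    _ = ∫⁻ y, (ENNReal.ofReal (wt m y) ^ 2 * ‖p y‖ₑ ^ 2) * weightNorm m w ^ 2 := by
        refine lintegral_congr fun y => ?_
        rw [lintegral_const_mul _ (by fun_prop), weightNorm_sq]
        congr 1
        exact lintegral_sub_right_eq_self
          (fun x => ENNReal.ofReal (wt m x) ^ 2 * ‖w x‖ₑ ^ 2) y
    _ = _ := by
        rw [lintegral_mul_const'' _ hP,
          ← weightNorm_sq, mul_comm]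

/-- The lower bound matching `weight_conv_upper`, from Peetre's inequality in the other direction. -/
theorem weight_conv_lower (m : ℕ) {p w : ℝ → ℂ} (hp : AEMeasurable (fun y => ‖p y‖ₑ))
    (hw : Measurable w) :
    (∫⁻ z, (ENNReal.ofReal (wt m z))⁻¹ ^ 2 * ‖w z‖ₑ ^ 2) * weightNorm m p ^ 2 ≤
    ∫⁻ x, ENNReal.ofReal (wt m x) ^ 2 * ∫⁻ y, ‖p y‖ₑ ^ 2 * ‖w (x - y)‖ₑ ^ 2 := by
  have hP : AEMeasurable (fun y => ENNReal.ofReal (wt m y) ^ 2 * ‖p y‖ₑ ^ 2) :=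
    (by fun_prop : AEMeasurable fun y => ENNReal.ofReal (wt m y) ^ 2).mul (hp.pow_const (2 : ℕ))
  change (∫⁻ x, ENNReal.ofReal (wt m x) ^ 2 * ∫⁻ y, ‖p y‖ₑ ^ 2 * ‖w (x - y)‖ₑ ^ 2) ≥ _
  calc (∫⁻ x, ENNReal.ofReal (wt m x) ^ 2 * ∫⁻ y, ‖p y‖ₑ ^ 2 * ‖w (x - y)‖ₑ ^ 2)
      ≥ ∫⁻ x, ∫⁻ y, (ENNReal.ofReal (wt m y) ^ 2 * ‖p y‖ₑ ^ 2) *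
          ((ENNReal.ofReal (wt m (x - y)))⁻¹ ^ 2 * ‖w (x - y)‖ₑ ^ 2) := by
        refine lintegral_mono fun x => ?_
        rw [← lintegral_const_mul' _ _ (by finiteness)]
        refine lintegral_mono fun y => ?_
        have : ENNReal.ofReal (wt m y) * (ENNReal.ofReal (wt m (x - y)))⁻¹ ≤
            ENNReal.ofReal (wt m x) := by
          rw [← div_eq_mul_inv]
          refine ENNReal.div_le_of_le_mul ?_
          rw [← ENNReal.ofReal_mul (wt_pos m x).le]
          refine ENNReal.ofReal_le_ofReal ?_
          have := wt_add_le m x (-(x - y))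
          rwa [wt_neg, show x + -(x - y) = y by ring] at this
        calc _ = (ENNReal.ofReal (wt m y) * (ENNReal.ofReal (wt m (x - y)))⁻¹) ^ 2 *
              (‖p y‖ₑ ^ 2 * ‖w (x - y)‖ₑ ^ 2) := by ring
          _ ≤ _ := by gcongr
    _ = ∫⁻ y, ∫⁻ x, (ENNReal.ofReal (wt m y) ^ 2 * ‖p y‖ₑ ^ 2) *
          ((ENNReal.ofReal (wt m (x - y)))⁻¹ ^ 2 * ‖w (x - y)‖ₑ ^ 2) := by
        refine lintegral_lintegral_swap ?_
        have hP' := hP.comp_snd (μ := (volume : Measure ℝ))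
        exact hP'.mul (by fun_prop)
    _ = ∫⁻ y, (ENNReal.ofReal (wt m y) ^ 2 * ‖p y‖ₑ ^ 2) *
          (∫⁻ z, (ENNReal.ofReal (wt m z))⁻¹ ^ 2 * ‖w z‖ₑ ^ 2) := by
        refine lintegral_congr fun y => ?_
        rw [lintegral_const_mul _ (by fun_prop)]
        congr 1
        exact lintegral_sub_right_eq_self
          (fun x => (ENNReal.ofReal (wt m x))⁻¹ ^ 2 * ‖w x‖ₑ ^ 2) y
    _ = _ := by
        rw [lintegral_mul_const'' _ hP,
          ← weightNorm_sq, mul_comm]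

theorem measurable_stft_sq {F γ : ℝ → ℂ} (hF : StronglyMeasurable F) (hγ : Continuous γ) :
    Measurable (fun z : ℝ × ℝ => ‖stft γ F z.1 z.2‖ₑ ^ 2) := by
  have h := measurable_stft hF hγ
  generalize stft γ F = V at *
  exact h.enorm.pow_const 2

theorem measurable_stft_sq_swap {F γ : ℝ → ℂ} (hF : StronglyMeasurable F) (hγ : Continuous γ) :
    Measurable (fun z : ℝ × ℝ => ‖stft γ F z.2 z.1‖ₑ ^ 2) :=
  (measurable_stft_sq hF hγ).comp measurable_swap

theorem measurable_stft_sq_left {F γ : ℝ → ℂ} (hF : StronglyMeasurable F) (hγ : Continuous γ)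
    (ξ : ℝ) : Measurable (fun x : ℝ => ‖stft γ F x ξ‖ₑ ^ 2) :=
  (measurable_stft_sq hF hγ).comp (measurable_id.prodMk measurable_const)

theorem measurable_stft_sq_right {F γ : ℝ → ℂ} (hF : StronglyMeasurable F) (hγ : Continuous γ)
    (x : ℝ) : Measurable (fun ξ : ℝ => ‖stft γ F x ξ‖ₑ ^ 2) :=
  (measurable_stft_sq hF hγ).comp (measurable_const.prodMk measurable_id)

/-- The phase space energy of the short-time Fourier transform with window `w`, weighted by
`(1 + |x| + |ξ|)^m`, is controlled by the phase space norm. -/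
theorem lintegral_stft_le (m : ℕ) {F : ℝ → ℂ} (hFm : StronglyMeasurable F) (hF : Integrable F)
    (hF2 : MemLp F 2) {w : ℝ → ℂ}
    (hw : Integrable w) (hwc : Continuous w) {B : ℝ} (hB : ∀ x, ‖w x‖ ≤ B) :
    ∫⁻ ξ, ∫⁻ x, ENNReal.ofReal (wt m (|x| + |ξ|)) ^ 2 * ‖stft (𝓕 w) F x ξ‖ₑ ^ 2 ≤
      2 * 4 ^ m * (weightNorm m w ^ 2 + weightNorm m (𝓕 w) ^ 2) * (weightNorm m (𝓕⁻ F) + weightNorm m F) ^ 2 := by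
  have hγ : Continuous (𝓕 w) := fourier_integral_continuous hw
  have hV' := measurable_stft_sq_swap hFm hγ
  have hVx := measurable_stft_sq_left hFm hγ
  have hVξ := measurable_stft_sq_right hFm hγ
  have hw2 : ∀ x ξ, ENNReal.ofReal (wt m (|x| + |ξ|)) ^ 2 ≤
      2 * 4 ^ m * (ENNReal.ofReal (wt m x) ^ 2 + ENNReal.ofReal (wt m ξ) ^ 2) := by
    intro x ξ
    rw [← ENNReal.ofReal_pow (wt_pos _ _).le, ← ENNReal.ofReal_pow (wt_pos _ _).le,
      ← ENNReal.ofReal_pow (wt_pos _ _).le, ← ENNReal.ofReal_add (by positivity) (by positivity),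
      show (2 * 4 ^ m : ℝ≥0∞) = ENNReal.ofReal (2 * 4 ^ m) by
        rw [ENNReal.ofReal_mul (by norm_num), ENNReal.ofReal_pow (by norm_num)]; norm_num,
      ← ENNReal.ofReal_mul (by positivity)]
    refine ENNReal.ofReal_le_ofReal ?_
    have h := wt_add_le_add m |x| |ξ|
    have hx : wt m |x| = wt m x := by simp [wt]
    have hξ : wt m |ξ| = wt m ξ := by simp [wt]
    rw [hx, hξ] at h
    calc wt m (|x| + |ξ|) ^ 2 ≤ (2 ^ m * (wt m x + wt m ξ)) ^ 2 :=
          pow_le_pow_left₀ (wt_pos _ _).le h 2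
      _ = 4 ^ m * (wt m x + wt m ξ) ^ 2 := by
          rw [mul_pow, ← pow_mul, mul_comm m 2, pow_mul]; norm_num
      _ ≤ 4 ^ m * (2 * (wt m x ^ 2 + wt m ξ ^ 2)) := by
          gcongr; nlinarith [sq_nonneg (wt m x - wt m ξ)]
      _ = _ := by ring
  have h1 : ∫⁻ ξ, ∫⁻ x, ENNReal.ofReal (wt m x) ^ 2 * ‖stft (𝓕 w) F x ξ‖ₑ ^ 2 ≤
      weightNorm m w ^ 2 * weightNorm m (𝓕⁻ F) ^ 2 := by
    have hm : Measurable (fun z : ℝ × ℝ =>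
        ENNReal.ofReal (wt m z.2) ^ 2 * ‖stft (𝓕 w) F z.2 z.1‖ₑ ^ 2) := by fun_prop
    rw [lintegral_lintegral_swap hm.aemeasurable]
    have := weight_conv_upper m
      (fourierInv_integral_continuous hF).aestronglyMeasurable.enorm hwc.measurable
    refine le_trans (le_of_eq (lintegral_congr fun x => ?_)) this
    rw [lintegral_const_mul _ (hVξ x), lintegral_stft_freq hF hF2 hw hwc hB]
  have h2 : ∫⁻ ξ, ∫⁻ x, ENNReal.ofReal (wt m ξ) ^ 2 * ‖stft (𝓕 w) F x ξ‖ₑ ^ 2 ≤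
      weightNorm m (𝓕 w) ^ 2 * weightNorm m F ^ 2 := by
    have := weight_conv_upper m (p := F) (w := fun z => 𝓕 w (-z))
      hFm.measurable.enorm.aemeasurable (hγ.comp continuous_neg).measurable
    have e : weightNorm m (fun z => 𝓕 w (-z)) ^ 2 = weightNorm m (𝓕 w) ^ 2 := by
      rw [weightNorm_sq, weightNorm_sq]
      rw [← lintegral_neg_eq_self]
      simp [wt_neg]
    rw [e] at this
    refine le_trans (le_of_eq (lintegral_congr fun ξ => ?_)) this
    rw [lintegral_const_mul _ (hVx ξ),
      lintegral_stft_pos hF hF2 hγ (fourier_norm_le w)]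
    simp
  calc _ ≤ ∫⁻ ξ, ∫⁻ x, (2 * 4 ^ m) *
        (ENNReal.ofReal (wt m x) ^ 2 * ‖stft (𝓕 w) F x ξ‖ₑ ^ 2 +
        ENNReal.ofReal (wt m ξ) ^ 2 * ‖stft (𝓕 w) F x ξ‖ₑ ^ 2) := by
        refine lintegral_mono fun ξ => lintegral_mono fun x => ?_
        refine (mul_le_mul_left (hw2 x ξ) _).trans (le_of_eq ?_)
        ring
    _ = (2 * 4 ^ m) * ((∫⁻ ξ, ∫⁻ x, ENNReal.ofReal (wt m x) ^ 2 *
          ‖stft (𝓕 w) F x ξ‖ₑ ^ 2) +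
        ∫⁻ ξ, ∫⁻ x, ENNReal.ofReal (wt m ξ) ^ 2 * ‖stft (𝓕 w) F x ξ‖ₑ ^ 2) := by
        have hm1 : Measurable fun z : ℝ × ℝ => ENNReal.ofReal (wt m z.2) ^ 2 *
          ‖stft (𝓕 w) F z.2 z.1‖ₑ ^ 2 := Measurable.mul (by fun_prop) hV'
        rw [← lintegral_add_left (hm1.lintegral_prod_right'),
          ← lintegral_const_mul' _ _ (by finiteness)]
        refine lintegral_congr fun ξ => ?_
        rw [lintegral_const_mul' _ _ (by finiteness), lintegral_add_left]
        exact Measurable.mul (by fun_prop) (hVx ξ)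
    _ ≤ (2 * 4 ^ m) * (weightNorm m w ^ 2 * weightNorm m (𝓕⁻ F) ^ 2 +
          weightNorm m (𝓕 w) ^ 2 * weightNorm m F ^ 2) := by gcongr
    _ ≤ (2 * 4 ^ m) * (weightNorm m w ^ 2 * (weightNorm m (𝓕⁻ F) + weightNorm m F) ^ 2 +
          weightNorm m (𝓕 w) ^ 2 * (weightNorm m (𝓕⁻ F) + weightNorm m F) ^ 2) := by
        gcongr
        · exact le_self_add
        · exact le_add_self
    _ = _ := by ring

/-- The position weighted energy of the short-time Fourier transform controls the position
weighted norm. -/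
theorem le_lintegral_stft (m : ℕ) {F : ℝ → ℂ} (hFm : StronglyMeasurable F) (hF : Integrable F)
    (hF2 : MemLp F 2) {w : ℝ → ℂ}
    (hw : Integrable w) (hwc : Continuous w) {B : ℝ} (hB : ∀ x, ‖w x‖ ≤ B) :
    (∫⁻ z, (ENNReal.ofReal (wt m z))⁻¹ ^ 2 * ‖w z‖ₑ ^ 2) * weightNorm m (𝓕⁻ F) ^ 2 ≤
    ∫⁻ ξ, ∫⁻ x, ENNReal.ofReal (wt m x) ^ 2 * ‖stft (𝓕 w) F x ξ‖ₑ ^ 2 := by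
  have hγ : Continuous (𝓕 w) := fourier_integral_continuous hw
  have hV' := measurable_stft_sq_swap hFm hγ
  have hVξ := measurable_stft_sq_right hFm hγ
  have hm : Measurable (fun z : ℝ × ℝ =>
      ENNReal.ofReal (wt m z.2) ^ 2 * ‖stft (𝓕 w) F z.2 z.1‖ₑ ^ 2) := by fun_prop
  rw [lintegral_lintegral_swap hm.aemeasurable]
  have := weight_conv_lower m
    (fourierInv_integral_continuous hF).aestronglyMeasurable.enorm hwc.measurable
  refine le_trans this (le_of_eq (lintegral_congr fun x => ?_))
  rw [lintegral_const_mul _ (hVξ x), lintegral_stft_freq hF hF2 hw hwc hB]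

/-! ### Gaussian windows -/

theorem exists_wt_mul_exp_le (n : ℕ) {c : ℝ} (hc : 0 < c) :
    ∃ K : ℝ, 0 ≤ K ∧ ∀ x : ℝ, wt n x * Real.exp (-c * x ^ 2) ≤ K := by
  refine ⟨n.factorial * Real.exp (1 + 1 / (4 * c)), by positivity, fun x => ?_⟩
  have h1 := Real.pow_div_factorial_le_exp (1 + |x|) (by positivity) n
  have h2 : 1 + |x| ≤ (1 + 1 / (4 * c)) + c * x ^ 2 := by
    have h3 : 0 ≤ c * (|x| - 1 / (2 * c)) ^ 2 := by positivity
    have h4 : c * (|x| - 1 / (2 * c)) ^ 2 = c * x ^ 2 - |x| + 1 / (4 * c) := by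
      rw [← sq_abs x]; field_simp; ring
    linarith
  rw [div_le_iff₀ (by positivity)] at h1
  calc wt n x * Real.exp (-c * x ^ 2)
      ≤ (Real.exp ((1 + 1 / (4 * c)) + c * x ^ 2) * n.factorial) * Real.exp (-c * x ^ 2) := by
        gcongr
        exact h1.trans (by gcongr)
    _ = _ := by
        rw [Real.exp_add, mul_right_comm, mul_assoc (Real.exp _), ← Real.exp_add]
        simp [mul_comm]

/-- Functions of Gaussian decay have finite weighted norms of every order. -/
theorem weightNorm_lt_top_of_gaussian_bound (m j : ℕ) {c K : ℝ} (hc : 0 < c) {g : ℝ → ℂ}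
    (hg : ∀ x, ‖g x‖ ≤ K * (wt j x * Real.exp (-c * x ^ 2))) : weightNorm m g < ∞ := by
  obtain ⟨A, hA, hA'⟩ := exists_wt_mul_exp_le (m + (j + 1)) hc
  have hK : 0 ≤ K := by
    have := (norm_nonneg _).trans (hg 0)
    exact nonneg_of_mul_nonneg_left this (mul_pos (wt_pos _ _) (Real.exp_pos _))
  have hbd : ∀ x, wt m x * ‖g x‖ ≤ (K * A) * (wt 1 x)⁻¹ := by
    intro x
    rw [← div_eq_mul_inv, le_div_iff₀ (wt_pos 1 x)]
    calc wt m x * ‖g x‖ * wt 1 x ≤ wt m x * (K * (wt j x * Real.exp (-c * x ^ 2))) * wt 1 x := by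
          have := hg x; have := wt_pos m x; have := wt_pos 1 x; gcongr
      _ = K * (wt (m + (j + 1)) x * Real.exp (-c * x ^ 2)) := by rw [wt_add, wt_add]; ring
      _ ≤ _ := by gcongr; exact hA' x
  have h2 : weightNorm m g ^ 2 ≤
      ENNReal.ofReal (K * A) ^ 2 * ∫⁻ x : ℝ, (ENNReal.ofReal (wt 1 x))⁻¹ ^ 2 := by
    rw [weightNorm_sq, ← lintegral_const_mul' _ _ (by finiteness)]
    refine lintegral_mono fun x => ?_
    rw [← mul_pow, ← mul_pow, ← ofReal_norm, ← ENNReal.ofReal_mul (wt_pos m x).le,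
      ← ENNReal.ofReal_inv_of_pos (wt_pos 1 x), ← ENNReal.ofReal_mul (by positivity)]
    exact pow_le_pow_left₀ zero_le (ENNReal.ofReal_le_ofReal (hbd x)) 2
  have h3 : weightNorm m g ^ 2 < ∞ :=
    h2.trans_lt (ENNReal.mul_lt_top (by finiteness) lintegral_inv_wt_lt_top)
  simpa using h3

/-! ### The free flow and the second derivative as Fourier multipliers -/

theorem toL2_of_memLp {f : ℝ → ℂ} (h : MemLp f 2) : toL2 f = h.toLp f := dif_pos h

theorem coeFn_toL2 {f : ℝ → ℂ} (h : MemLp f 2) : toL2 f =ᵐ[volume] f := by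
  rw [toL2_of_memLp h]; exact h.coeFn_toLp

theorem fourier_freeFlow_ae (t : ℝ) (f : L2) :
    (𝓕 (freeFlow t f) : L2) =ᵐ[volume] fun ξ => freeSymbol t ξ * (𝓕 f : L2) ξ := by
  rw [freeFlow, FourierTransform.fourier_fourierInv_eq]
  exact (memLp_freeSymbol_mul t _).coeFn_toLp

theorem norm_freeSymbol (t ξ : ℝ) : ‖freeSymbol t ξ‖ = 1 := by
  rw [freeSymbol, Complex.norm_exp_ofReal_mul_I]

@[fun_prop]
theorem continuous_freeSymbol (t : ℝ) : Continuous (freeSymbol t) := by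
  unfold freeSymbol; fun_prop

/-- The second derivative `∂_x²` on `L²`, as a Fourier multiplier; it is the distributional
derivative on those `f` for which `ξ² 𝓕 f` is square integrable. -/
def lap (f : L2) : L2 := 𝓕⁻ (toL2 fun ξ => -(2 * Real.pi * ξ : ℂ) ^ 2 * (𝓕 f : L2) ξ)

theorem memLp_lap {f : L2} (hf : weightNorm 2 (𝓕 f : L2) < ∞) :
    MemLp (fun ξ : ℝ => -(2 * Real.pi * ξ : ℂ) ^ 2 * (𝓕 f : L2) ξ) 2 := by
  have hm : MemLp (fun ξ => (wt 2 ξ : ℂ) * (𝓕 f : L2) ξ) 2 :=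
    ⟨aesm_wt_mul 2 (Lp.aestronglyMeasurable _), hf⟩
  refine MemLp.of_le_mul (c := (2 * Real.pi) ^ 2) hm ?_ (Eventually.of_forall fun ξ => ?_)
  · exact (by fun_prop : Continuous fun ξ : ℝ => -(2 * Real.pi * ξ : ℂ) ^ 2).aestronglyMeasurable.mul
      (Lp.aestronglyMeasurable _)
  · rw [norm_mul, norm_mul, ← mul_assoc]
    gcongr
    rw [Complex.norm_real, Real.norm_of_nonneg (wt_pos 2 ξ).le]
    simp only [norm_neg, norm_pow, norm_mul, Complex.norm_real, Complex.norm_ofNat, Real.norm_eq_abs,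
      abs_of_pos Real.pi_pos, wt, mul_pow]
    gcongr
    linarith

theorem fourier_lap_ae {f : L2} (hf : weightNorm 2 (𝓕 f : L2) < ∞) :
    (𝓕 (lap f) : L2) =ᵐ[volume] fun ξ => -(2 * Real.pi * ξ : ℂ) ^ 2 * (𝓕 f : L2) ξ := by
  rw [lap, FourierTransform.fourier_fourierInv_eq]
  exact coeFn_toL2 (memLp_lap hf)

theorem weightNorm_fourier_lap_le (m : ℕ) (f : L2) :
    weightNorm m (𝓕 (lap f) : L2) ≤
      ENNReal.ofReal ((2 * Real.pi) ^ 2) * weightNorm (m + 2) (𝓕 f : L2) := by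
  by_cases hf : weightNorm 2 (𝓕 f : L2) < ∞
  · rw [weightNorm_congr (fourier_lap_ae hf)]
    refine weightNorm_le_mul (Eventually.of_forall fun ξ => ?_)
    rw [wt_add, norm_mul]
    have : ‖-(2 * Real.pi * ξ : ℂ) ^ 2‖ ≤ (2 * Real.pi) ^ 2 * wt 2 ξ := by
      simp only [norm_neg, norm_pow, norm_mul, Complex.norm_real, Complex.norm_ofNat,
        Real.norm_eq_abs, abs_of_pos Real.pi_pos, wt, mul_pow]
      gcongr
      linarith
    have := wt_pos m ξ
    calc wt m ξ * (‖-(2 * Real.pi * ξ : ℂ) ^ 2‖ * ‖(𝓕 f : L2) ξ‖)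
        ≤ wt m ξ * (((2 * Real.pi) ^ 2 * wt 2 ξ) * ‖(𝓕 f : L2) ξ‖) := by gcongr
      _ = _ := by ring
  · have h1 : weightNorm (m + 2) (𝓕 f : L2) = ∞ := by
      rw [← top_le_iff]
      exact (not_lt_top_iff.1 hf).symm.le.trans (weightNorm_mono (by omega) _)
    rw [h1, ENNReal.mul_top]
    · exact le_top
    · simp [Real.pi_ne_zero]

theorem weightNorm_fourier_freeFlow (m : ℕ) (t : ℝ) (f : L2) :
    weightNorm m (𝓕 (freeFlow t f) : L2) = weightNorm m (𝓕 f : L2) := by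
  rw [weightNorm_congr (fourier_freeFlow_ae t f)]
  unfold weightNorm
  refine eLpNorm_congr_norm_ae (Eventually.of_forall fun ξ => ?_)
  simp [norm_freeSymbol]

/-! ### Phase space bounds for the free flow and the second derivative -/

/-- The Gaussian `e^{-πbx²}`. -/
def gauss (b : ℂ) (x : ℝ) : ℂ := Complex.exp (-Real.pi * b * x ^ 2)

@[fun_prop]
theorem continuous_gauss (b : ℂ) : Continuous (gauss b) := by unfold gauss; fun_prop

theorem norm_gauss (b : ℂ) (x : ℝ) : ‖gauss b x‖ = Real.exp (-(Real.pi * b.re) * x ^ 2) := by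
  rw [gauss, Complex.norm_exp]
  congr 1
  have : (-Real.pi * b * x ^ 2 : ℂ) = ((-Real.pi * x ^ 2 : ℝ) : ℂ) * b := by push_cast; ring
  rw [this, Complex.re_ofReal_mul]; ring

theorem fourier_gauss {b : ℂ} (hb : 0 < b.re) :
    𝓕 (gauss b) = fun ξ : ℝ => 1 / b ^ (1 / 2 : ℂ) * gauss (1 / b) ξ := by
  have := fourier_gaussian_pi hb
  unfold gauss
  rw [this]
  ext t
  congr 2
  ring

theorem weightNorm_gauss_lt_top (m : ℕ) {b : ℂ} (hb : 0 < b.re) : weightNorm m (gauss b) < ∞ :=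
  weightNorm_lt_top_of_gaussian_bound m 0 (mul_pos Real.pi_pos hb) (K := 1) fun x => by
    rw [norm_gauss]; simp [wt]

theorem integrable_gauss {b : ℂ} (hb : 0 < b.re) : Integrable (gauss b) :=
  integrable_of_weightNorm (by fun_prop) le_rfl (weightNorm_gauss_lt_top 1 hb)

theorem norm_gauss_le_one {b : ℂ} (hb : 0 < b.re) (x : ℝ) : ‖gauss b x‖ ≤ 1 := by
  rw [norm_gauss, Real.exp_le_one_iff]
  have := mul_pos Real.pi_pos hb
  nlinarith [sq_nonneg x]

theorem fourier_gauss_one : 𝓕 (gauss 1) = gauss 1 := by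
  rw [fourier_gauss (by simp)]; simp

/-- Passing from a bound for squares to a bound for the quantities themselves. -/
theorem exists_le_mul_of_sq_le {c A : ℝ≥0∞} (hc : c ≠ 0) (hc' : c ≠ ∞) (hA : A ≠ ∞) :
    ∃ C : ℝ≥0, 0 < C ∧ ∀ X P : ℝ≥0∞, c * X ^ 2 ≤ A * P ^ 2 → X ≤ C * P := by
  refine ⟨(A / c).toNNReal + 1, by positivity, fun X P h => ?_⟩
  have h1 : X ^ 2 ≤ (A / c) * P ^ 2 := by
    rw [ENNReal.div_eq_inv_mul, mul_assoc, ← ENNReal.div_eq_inv_mul,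
      ENNReal.le_div_iff_mul_le (Or.inl hc) (Or.inl hc'), mul_comm]
    exact h
  have hAc : A / c ≠ ∞ := ENNReal.div_ne_top hA hc
  have h2 : X ^ 2 ≤ ((((A / c).toNNReal + 1 : ℝ≥0) : ℝ≥0∞) * P) ^ 2 := by
    refine h1.trans ?_
    rw [mul_pow]
    gcongr
    rw [ENNReal.coe_add, ENNReal.coe_toNNReal hAc, ENNReal.coe_one, sq]
    calc A / c ≤ (A / c + 1) * 1 := by rw [mul_one]; exact le_self_add
      _ ≤ _ := by gcongr; exact le_add_self
  exact (ENNReal.pow_le_pow_left_iff two_ne_zero).1 h2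

/-- The constant of `weight_conv_lower` for the Gaussian window is neither `0` nor `∞`. -/
theorem gauss_lower_const (m : ℕ) :
    (∫⁻ z, (ENNReal.ofReal (wt m z))⁻¹ ^ 2 * ‖gauss 1 z‖ₑ ^ 2) ≠ 0 ∧
    (∫⁻ z, (ENNReal.ofReal (wt m z))⁻¹ ^ 2 * ‖gauss 1 z‖ₑ ^ 2) ≠ ∞ := by
  constructor
  · intro h
    rw [lintegral_eq_zero_iff (by fun_prop)] at h
    obtain ⟨x, hx⟩ := h.exists
    simp [gauss] at hx
  · refine ne_top_of_le_ne_top (ENNReal.pow_ne_top (n := 2)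
      (weightNorm_gauss_lt_top 0 (b := 1) (by simp)).ne) ?_
    rw [weightNorm_sq]
    refine lintegral_mono fun x => ?_
    gcongr
    rw [ENNReal.inv_le_iff_inv_le]
    refine (ENNReal.inv_le_one.2 ?_).trans ?_ <;> simp [one_le_wt]

/-- The free flow turns the short-time Fourier transform into one with a chirped window, sheared
along the classical trajectories. -/
theorem enorm_stft_free (t : ℝ) (F : ℝ → ℂ) (x ξ : ℝ) :
    ‖stft (gauss 1) (fun η => freeSymbol t η * F η) x ξ‖ₑ =
      ‖stft (gauss (1 + 4 * Real.pi * t * Complex.I)) F (x - 4 * Real.pi * t * ξ) ξ‖ₑ := by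
  unfold stft
  have : 𝓕⁻ (fun η => freeSymbol t η * F η * gauss 1 (η - ξ)) x =
      Complex.exp (((4 * Real.pi ^ 2 * t * ξ ^ 2 : ℝ) : ℂ) * Complex.I) *
      𝓕⁻ (fun η => F η * gauss (1 + 4 * Real.pi * t * Complex.I) (η - ξ))
        (x - 4 * Real.pi * t * ξ) := by
    rw [Real.fourierInv_eq', Real.fourierInv_eq', ← integral_const_mul]
    refine integral_congr_ae (Eventually.of_forall fun η => ?_)
    simp only [smul_eq_mul, freeSymbol, gauss]
    have : ∀ a b c d e f : ℂ, Complex.exp a * Complex.exp b * Complex.exp c =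
        Complex.exp d * Complex.exp e * Complex.exp f →
        Complex.exp a * (Complex.exp b * F η * Complex.exp c) =
        Complex.exp d * (Complex.exp e * (F η * Complex.exp f)) := by
      intro a b c d e f h
      linear_combination F η * h
    apply this
    simp only [← Complex.exp_add]
    congr 1
    simp
    ring
  rw [this, enorm_mul, ← ofReal_norm, Complex.norm_exp_ofReal_mul_I, ENNReal.ofReal_one, one_mul]

theorem fourier_const_mul (c : ℂ) (f : ℝ → ℂ) (ξ : ℝ) : 𝓕 (fun x => c * f x) ξ = c * 𝓕 f ξ := by
  rw [Real.fourier_real_eq, Real.fourier_real_eq, ← integral_const_mul]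
  refine integral_congr_ae (Eventually.of_forall fun x => ?_)
  simp only [Circle.smul_def, smul_eq_mul]
  ring

/-- The shear `(x, ξ) ↦ (x + 4πtξ, ξ)` is the classical free flow; it changes the phase space weight by a
bounded factor only. -/
theorem shear_bound (m : ℕ) {T t : ℝ} (ht : |t| ≤ T) (x ξ : ℝ) :
    wt m (x + 4 * Real.pi * t * ξ) ≤ (1 + 4 * Real.pi * T) ^ m * wt m (|x| + |ξ|) := by
  have hπ := Real.pi_pos
  have hT : 0 ≤ T := (abs_nonneg t).trans ht
  rw [wt, wt, ← mul_pow]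
  refine pow_le_pow_left₀ (by positivity) ?_ _
  have h1 : |4 * Real.pi * t * ξ| = 4 * Real.pi * |t| * |ξ| := by
    rw [abs_mul, abs_mul, abs_of_pos (by positivity : 0 < 4 * Real.pi)]
  have h2 : 4 * Real.pi * |t| * |ξ| ≤ 4 * Real.pi * T * |ξ| := by gcongr
  rw [abs_of_nonneg (by positivity : 0 ≤ |x| + |ξ|)]
  have h3 := abs_add_le x (4 * Real.pi * t * ξ)
  have h4 : 0 ≤ 4 * Real.pi * T * (1 + |x|) := by positivity
  nlinarith [abs_nonneg ξ]

/-- The window adapted to the free flow: its Fourier transform is a chirped Gaussian, and its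
weighted norm is bounded for bounded times. -/
theorem exists_chirp_window (T : ℝ) : ∃ c : ℝ, 0 < c ∧ ∀ t : ℝ, |t| ≤ T → ∃ w : ℝ → ℂ,
    Continuous w ∧ (∀ x, ‖w x‖ ≤ ‖gauss (c : ℂ) x‖) ∧
    𝓕 w = gauss (1 + 4 * Real.pi * t * Complex.I) := by
  have hπ := Real.pi_pos
  -- With `a = 1 + 4πti`, the window is the inverse transform `a^{-1/2} gauss (1 / a)` of `gauss a`, and
  -- `Re (1 / a) = 1 / (1 + (4πt)²)` is bounded below.
  refine ⟨1 / (1 + (4 * Real.pi * T) ^ 2), by positivity, fun t ht => ?_⟩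
  set a : ℂ := 1 + 4 * Real.pi * t * Complex.I with ha
  have hare : a.re = 1 := by simp [ha]
  have haim : a.im = 4 * Real.pi * t := by simp [ha]
  have hns : Complex.normSq a = 1 + (4 * Real.pi * t) ^ 2 := by
    rw [Complex.normSq_apply, hare, haim]; ring
  have ha0 : a ≠ 0 := fun h => by simp [h] at hare
  have hre : (1 / a).re = 1 / (1 + (4 * Real.pi * t) ^ 2) := by
    rw [one_div, Complex.inv_re, hare, hns]
  have hpos : 0 < (1 / a).re := by rw [hre]; positivity
  have hb0 : (1 / a) ^ (1 / 2 : ℂ) ≠ 0 := by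
    rw [Ne, Complex.cpow_eq_zero_iff]; simp [ha0]
  have hT' : (4 * Real.pi * t) ^ 2 ≤ (4 * Real.pi * T) ^ 2 := by
    rw [mul_pow, mul_pow _ T, ← sq_abs t]; gcongr
  have hre2 : (1 / a).re ≥ ((1 / (1 + (4 * Real.pi * T) ^ 2) : ℝ) : ℂ).re := by
    rw [hre, Complex.ofReal_re]; gcongr
  refine ⟨fun x => (1 / a) ^ (1 / 2 : ℂ) * gauss (1 / a) x, by fun_prop, fun x => ?_, ?_⟩
  · have h1 : ‖(1 / a) ^ (1 / 2 : ℂ)‖ ≤ 1 := by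
      have : (1 / 2 : ℂ) = ((1 / 2 : ℝ) : ℂ) := by simp
      rw [this, Complex.norm_cpow_real]
      refine Real.rpow_le_one (norm_nonneg _) ?_ (by norm_num)
      rw [norm_div, norm_one, div_le_one (norm_pos_iff.2 ha0), ← hare]
      exact Complex.re_le_norm a
    rw [norm_mul]
    calc _ ≤ 1 * ‖gauss (1 / a) x‖ := by gcongr
      _ ≤ _ := by
        rw [one_mul, norm_gauss, norm_gauss, Real.exp_le_exp]
        exact mul_le_mul_of_nonneg_right
          (neg_le_neg (mul_le_mul_of_nonneg_left hre2 hπ.le)) (sq_nonneg x)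
  · have h := fourier_gauss hpos
    ext ξ
    rw [fourier_const_mul, h]
    simp only [one_div_one_div]
    rw [← mul_assoc, mul_one_div_cancel hb0, one_mul]

theorem stronglyMeasurable_freeSymbol_mul (t : ℝ) (f : L2) :
    StronglyMeasurable (fun η => freeSymbol t η * (𝓕 f : L2) η) :=
  (continuous_freeSymbol t).stronglyMeasurable.mul (Lp.stronglyMeasurable _)

theorem integrable_freeSymbol_mul (t : ℝ) {F : ℝ → ℂ} (hF : Integrable F) :
    Integrable (fun η => freeSymbol t η * F η) :=
  hF.bdd_mul (c := 1) (continuous_freeSymbol t).aestronglyMeasurable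
    (Eventually.of_forall fun η => (norm_freeSymbol t η).le)

theorem fourierInv_ae_of_fourier_ae {h : L2} {G : ℝ → ℂ} (hG : Integrable G)
    (hh : (𝓕 h : L2) =ᵐ[volume] G) : 𝓕⁻ G =ᵐ[volume] h := by
  have h1 := coeFn_fourierInv_ae (f := (𝓕 h : L2)) (hG.congr hh.symm)
  rw [FourierTransform.fourierInv_fourier_eq, fourierInvIntegral_congr_ae hh] at h1
  exact h1.symm

theorem integrable_fourier_of_phaseNorm {m : ℕ} (hm : 1 ≤ m) {f : L2} (hf : phaseNorm m f < ∞) :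
    Integrable (𝓕 f : L2) :=
  integrable_of_weightNorm (Lp.aestronglyMeasurable _) hm
    ((weightNorm_fourier_le_phaseNorm m f).trans_lt hf)

/-- The free flow is bounded in the position weighted norm, by the full phase space norm, uniformly
for bounded times. -/
theorem exists_weightNorm_freeFlow_le {m : ℕ} (hm : 1 ≤ m) (T : ℝ) :
    ∃ C : ℝ≥0, 0 < C ∧ ∀ t : ℝ, |t| ≤ T → ∀ f : L2,
      weightNorm m (freeFlow t f) ≤ C * phaseNorm m f := by
  obtain ⟨b, hb, hw⟩ := exists_chirp_window T
  have hbre : 0 < (b : ℂ).re := by simpa using hb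
  obtain ⟨hc0, hc1⟩ := gauss_lower_const m
  -- The window for `freeFlow t f` is fixed; the one for `f` depends on `t` but is dominated by `gauss b`.
  set K : ℝ≥0∞ := ENNReal.ofReal ((1 + 4 * Real.pi * T) ^ m) ^ 2 *
    (2 * 4 ^ m * (weightNorm m (gauss b) ^ 2 + weightNorm m (gauss 1) ^ 2)) with hK
  have hKtop : K ≠ ∞ := by
    have h1 := (weightNorm_gauss_lt_top m hbre).ne
    have h2 := (weightNorm_gauss_lt_top m (b := 1) (by simp)).ne
    rw [hK]; finiteness
  obtain ⟨C, hC, hCle⟩ := exists_le_mul_of_sq_le hc0 hc1 hKtop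
  refine ⟨C, hC, fun t ht f => ?_⟩
  by_cases hf : phaseNorm m f < ∞
  swap
  · rw [not_lt_top_iff.1 hf, ENNReal.mul_top (by simpa using hC.ne')]; exact le_top
  have hF := integrable_fourier_of_phaseNorm hm hf
  have hFs : StronglyMeasurable (𝓕 f : L2) := Lp.stronglyMeasurable _
  have hF2 : MemLp (𝓕 f : L2) 2 := Lp.memLp _
  set F : ℝ → ℂ := ⇑(𝓕 f : L2) with hFdef
  have hG := integrable_freeSymbol_mul t hF
  have hGs := stronglyMeasurable_freeSymbol_mul t f
  have hG2 := memLp_freeSymbol_mul t (𝓕 f)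
  refine hCle _ _ ?_
  have h1 := le_lintegral_stft m hGs hG hG2 (integrable_gauss (b := 1) (by simp)) (by fun_prop)
    (norm_gauss_le_one (by simp))
  rw [weightNorm_congr (fourierInv_ae_of_fourier_ae hG (fourier_freeFlow_ae t f)),
    fourier_gauss_one] at h1
  refine h1.trans ?_
  obtain ⟨w, hwc, hwb, hwF⟩ := hw t ht
  have hwi : Integrable w :=
    (integrable_gauss hbre).mono hwc.aestronglyMeasurable (Eventually.of_forall hwb)
  have h2 := lintegral_stft_le m hFs hF hF2 hwi hwc
    (fun x => (hwb x).trans (norm_gauss_le_one hbre x))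
  rw [hwF, weightNorm_congr (fourierInv_ae_of_fourier_ae hF (EventuallyEq.refl _ _))] at h2
  have hw1 : weightNorm m w ≤ weightNorm m (gauss b) := by
    have := weightNorm_le_mul (m := m) (n := m) (f := w) (g := gauss b) (c := 1)
      (Eventually.of_forall fun x => by
        rw [one_mul]; exact mul_le_mul_of_nonneg_left (hwb x) (wt_pos m x).le)
    simpa using this
  have hw2 : weightNorm m (gauss (1 + 4 * Real.pi * t * Complex.I)) = weightNorm m (gauss 1) := by
    unfold weightNorm
    refine eLpNorm_congr_norm_ae (Eventually.of_forall fun x => ?_)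
    simp [norm_gauss]
  rw [hw2] at h2
  calc ∫⁻ ξ, ∫⁻ x, ENNReal.ofReal (wt m x) ^ 2 *
        ‖stft (gauss 1) (fun η => freeSymbol t η * F η) x ξ‖ₑ ^ 2
      = ∫⁻ ξ, ∫⁻ x, ENNReal.ofReal (wt m (x + 4 * Real.pi * t * ξ)) ^ 2 *
        ‖stft (gauss (1 + 4 * Real.pi * t * Complex.I)) F x ξ‖ₑ ^ 2 := by
        refine lintegral_congr fun ξ => ?_
        rw [← lintegral_add_right_eq_self _ (4 * Real.pi * t * ξ)]
        refine lintegral_congr fun x => ?_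
        rw [enorm_stft_free, add_sub_cancel_right]
    _ ≤ ∫⁻ ξ, ∫⁻ x, ENNReal.ofReal ((1 + 4 * Real.pi * T) ^ m) ^ 2 *
        (ENNReal.ofReal (wt m (|x| + |ξ|)) ^ 2 *
        ‖stft (gauss (1 + 4 * Real.pi * t * Complex.I)) F x ξ‖ₑ ^ 2) := by
        refine lintegral_mono fun ξ => lintegral_mono fun x => ?_
        rw [← mul_assoc]
        refine mul_le_mul_left ?_ _
        have hpos : 0 ≤ (1 + 4 * Real.pi * T) ^ m := by
          have := (abs_nonneg t).trans ht
          have := Real.pi_pos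
          positivity
        rw [← mul_pow, ← ENNReal.ofReal_mul hpos]
        exact pow_le_pow_left₀ zero_le (ENNReal.ofReal_le_ofReal (shear_bound m ht x ξ)) 2
    _ = ENNReal.ofReal ((1 + 4 * Real.pi * T) ^ m) ^ 2 * ∫⁻ ξ, ∫⁻ x,
        (ENNReal.ofReal (wt m (|x| + |ξ|)) ^ 2 *
        ‖stft (gauss (1 + 4 * Real.pi * t * Complex.I)) F x ξ‖ₑ ^ 2) := by
        rw [← lintegral_const_mul' _ _ (by finiteness)]
        refine lintegral_congr fun ξ => ?_
        rw [lintegral_const_mul' _ _ (by finiteness)]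
    _ ≤ ENNReal.ofReal ((1 + 4 * Real.pi * T) ^ m) ^ 2 *
        (2 * 4 ^ m * (weightNorm m w ^ 2 + weightNorm m (gauss 1) ^ 2) *
          (weightNorm m f + weightNorm m F) ^ 2) := by gcongr
    _ ≤ ENNReal.ofReal ((1 + 4 * Real.pi * T) ^ m) ^ 2 *
        (2 * 4 ^ m * (weightNorm m (gauss b) ^ 2 + weightNorm m (gauss 1) ^ 2) *
          (weightNorm m f + weightNorm m F) ^ 2) := by gcongr
    _ = K * phaseNorm m f ^ 2 := by rw [hK, phaseNorm]; ring

/-- Properties of a rapidly decreasing window: it and its Fourier transform have finite weighted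
norms. -/
structure IsWindow (w : ℝ → ℂ) : Prop where
  continuous : Continuous w
  bounded : ∃ B, ∀ x, ‖w x‖ ≤ B
  weightNorm_lt_top : ∀ m, weightNorm m w < ∞
  weightNorm_fourier_lt_top : ∀ m, weightNorm m (𝓕 w) < ∞

theorem IsWindow.integrable {w : ℝ → ℂ} (h : IsWindow w) : Integrable w :=
  integrable_of_weightNorm h.continuous.aestronglyMeasurable le_rfl (h.weightNorm_lt_top 1)

theorem isWindow_of_bound {w : ℝ → ℂ} (hw : Continuous w) (j : ℕ) {K : ℝ}
    (h : ∀ x, ‖w x‖ ≤ K * (wt j x * Real.exp (-Real.pi * x ^ 2)))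
    (h' : ∀ x, ‖𝓕 w x‖ ≤ K * (wt j x * Real.exp (-Real.pi * x ^ 2))) : IsWindow w where
  continuous := hw
  bounded := by
    obtain ⟨A, hA, hA'⟩ := exists_wt_mul_exp_le j Real.pi_pos
    have hK : 0 ≤ K := by
      have := (norm_nonneg _).trans (h 0)
      exact nonneg_of_mul_nonneg_left this (mul_pos (wt_pos _ _) (Real.exp_pos _))
    exact ⟨K * A, fun x => (h x).trans (mul_le_mul_of_nonneg_left (hA' x) hK)⟩
  weightNorm_lt_top m := weightNorm_lt_top_of_gaussian_bound m j Real.pi_pos h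
  weightNorm_fourier_lt_top m := weightNorm_lt_top_of_gaussian_bound m j Real.pi_pos h'

theorem norm_gauss_one (x : ℝ) : ‖gauss 1 x‖ = Real.exp (-Real.pi * x ^ 2) := by
  rw [norm_gauss]; simp

theorem isWindow_gauss : IsWindow (gauss 1) := by
  refine isWindow_of_bound (by fun_prop) 0 (K := 1) (fun x => ?_) (fun x => ?_)
  · rw [norm_gauss_one]; simp [wt]
  · rw [fourier_gauss_one, norm_gauss_one]; simp [wt]

/-- The first two derivatives of the Gaussian are windows, whose Fourier transforms are the Gaussian
multiplied by powers of the frequency. -/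
theorem exists_gauss_deriv_windows : ∃ g₁ g₂ : ℝ → ℂ, IsWindow g₁ ∧ IsWindow g₂ ∧
    (𝓕 g₁ = fun ξ : ℝ => (2 * Real.pi * Complex.I * ξ) * gauss 1 ξ) ∧
    (𝓕 g₂ = fun ξ : ℝ => (2 * Real.pi * Complex.I * ξ) ^ 2 * gauss 1 ξ) := by
  have hπ := Real.pi_pos
  set g₁ : ℝ → ℂ := fun x => -(2 * Real.pi) * x * gauss 1 x with hg₁
  set g₂ : ℝ → ℂ := fun x => (4 * Real.pi ^ 2 * x ^ 2 - 2 * Real.pi) * gauss 1 x with hg₂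
  have hc1 : Continuous g₁ := by rw [hg₁]; fun_prop
  have hc2 : Continuous g₂ := by rw [hg₂]; fun_prop
  have hd0 : ∀ x, HasDerivAt (gauss 1) (g₁ x) x := by
    intro x
    have h : HasDerivAt (fun y : ℝ => (-Real.pi * 1 * (y : ℂ) ^ 2 : ℂ))
        (-Real.pi * 1 * (2 * (x : ℂ))) x := by
      have := ((hasDerivAt_id (x : ℂ)).pow 2).comp_ofReal.const_mul (-Real.pi * 1 : ℂ)
      simpa using this
    have := h.cexp
    refine this.congr_deriv ?_
    simp only [hg₁, gauss]; ring
  have hd1 : ∀ x, HasDerivAt g₁ (g₂ x) x := by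
    intro x
    have h : HasDerivAt (fun y : ℝ => (-(2 * Real.pi) * (y : ℂ) : ℂ)) (-(2 * Real.pi)) x := by
      have := (hasDerivAt_id (x : ℂ)).comp_ofReal.const_mul (-(2 * Real.pi) : ℂ)
      simpa using this
    refine (h.mul (hd0 x)).congr_deriv ?_
    simp only [hg₁, hg₂]; ring
  have hb1 : ∀ x : ℝ, ‖g₁ x‖ ≤ 2 * Real.pi * (wt 1 x * Real.exp (-Real.pi * x ^ 2)) := by
    intro x
    simp only [hg₁, norm_mul, norm_gauss_one, norm_neg, Complex.norm_real, Complex.norm_ofNat,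
      Real.norm_eq_abs, abs_of_pos hπ, wt, pow_one]
    rw [mul_assoc (2 * Real.pi)]
    gcongr
    linarith
  have hb2 : ∀ x : ℝ, ‖g₂ x‖ ≤
      (4 * Real.pi ^ 2 + 2 * Real.pi) * (wt 2 x * Real.exp (-Real.pi * x ^ 2)) := by
    intro x
    rw [hg₂, norm_mul, norm_gauss_one, ← mul_assoc]
    gcongr
    refine (norm_sub_le _ _).trans ?_
    simp only [norm_mul, norm_pow, Complex.norm_real, Complex.norm_ofNat, Real.norm_eq_abs,
      abs_of_pos hπ, wt]
    have h1 : |x| ^ 2 ≤ (1 + |x|) ^ 2 := by gcongr; linarith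
    have h2 : 1 ≤ (1 + |x|) ^ 2 := one_le_pow₀ (by simp)
    calc 4 * Real.pi ^ 2 * |x| ^ 2 + 2 * Real.pi ≤
          4 * Real.pi ^ 2 * (1 + |x|) ^ 2 + 2 * Real.pi * (1 + |x|) ^ 2 := by
          exact add_le_add (by gcongr) (le_mul_of_one_le_right (by positivity) h2)
      _ = _ := by ring
  have hi1 : Integrable g₁ := integrable_of_weightNorm hc1.aestronglyMeasurable le_rfl
    (weightNorm_lt_top_of_gaussian_bound 1 1 hπ hb1)
  have hi2 : Integrable g₂ := integrable_of_weightNorm hc2.aestronglyMeasurable le_rfl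
    (weightNorm_lt_top_of_gaussian_bound 1 2 hπ hb2)
  have hder0 : deriv (gauss 1) = g₁ := funext fun x => (hd0 x).deriv
  have hder1 : deriv g₁ = g₂ := funext fun x => (hd1 x).deriv
  have hF1 : 𝓕 g₁ = fun ξ : ℝ => (2 * Real.pi * Complex.I * ξ) * gauss 1 ξ := by
    have := Real.fourier_deriv isWindow_gauss.integrable
      (fun x => (hd0 x).differentiableAt) (by rwa [hder0])
    rw [hder0, fourier_gauss_one] at this
    simpa only [smul_eq_mul] using this
  have hF2 : 𝓕 g₂ = fun ξ : ℝ => (2 * Real.pi * Complex.I * ξ) ^ 2 * gauss 1 ξ := by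
    have := Real.fourier_deriv hi1 (fun x => (hd1 x).differentiableAt) (by rwa [hder1])
    rw [hder1, hF1] at this
    rw [this]; ext ξ
    rw [smul_eq_mul]; ring
  have hn : ∀ x : ℝ, ‖(2 * Real.pi * Complex.I * x : ℂ)‖ ≤ 2 * Real.pi * wt 1 x := by
    intro x
    simp only [norm_mul, Complex.norm_real, Complex.norm_ofNat, Real.norm_eq_abs, abs_of_pos hπ, wt,
      pow_one, Complex.norm_I, mul_one]
    gcongr
    linarith
  refine ⟨g₁, g₂, isWindow_of_bound hc1 1 hb1 fun x => ?_,
    isWindow_of_bound hc2 2 hb2 fun x => ?_, hF1, hF2⟩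
  · rw [hF1, norm_mul, norm_gauss_one, ← mul_assoc]
    gcongr
    exact hn x
  · rw [hF2, norm_mul, norm_gauss_one, ← mul_assoc, norm_pow]
    gcongr
    calc _ ≤ (2 * Real.pi * wt 1 x) ^ 2 := by gcongr; exact hn x
      _ = 4 * Real.pi ^ 2 * wt 2 x := by simp only [wt]; ring
      _ ≤ _ := by
        gcongr
        · exact (wt_pos 2 x).le
        · linarith

/-- The short-time Fourier transform of a second derivative, expressed through those with
differentiated windows. -/
theorem stft_lap {F g₁ g₂ : ℝ → ℂ} (hF : Integrable F) (h1 : IsWindow g₁) (h2 : IsWindow g₂)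
    (hF1 : 𝓕 g₁ = fun ξ : ℝ => (2 * Real.pi * Complex.I * ξ) * gauss 1 ξ)
    (hF2 : 𝓕 g₂ = fun ξ : ℝ => (2 * Real.pi * Complex.I * ξ) ^ 2 * gauss 1 ξ) (x ξ : ℝ) :
    stft (𝓕 (gauss 1)) (fun η => -(2 * Real.pi * η : ℂ) ^ 2 * F η) x ξ =
      stft (𝓕 g₂) F x ξ + 2 * (2 * Real.pi * Complex.I * ξ) * stft (𝓕 g₁) F x ξ +
      (2 * Real.pi * Complex.I * ξ) ^ 2 * stft (𝓕 (gauss 1)) F x ξ := by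
  have hint : ∀ w : ℝ → ℂ, IsWindow w → Integrable (fun η =>
      Complex.exp (↑(2 * Real.pi * inner ℝ η x) * Complex.I) * (F η * 𝓕 w (η - ξ))) := by
    intro w hw
    have hc := fourier_integral_continuous hw.integrable
    refine Integrable.bdd_mul (c := 1) ?_ (by fun_prop)
      (Eventually.of_forall fun η => (Complex.norm_exp_ofReal_mul_I _).le)
    exact hF.mul_bdd (c := ∫ x, ‖w x‖) (by fun_prop)
      (Eventually.of_forall fun y => fourier_norm_le w _)
  unfold stft
  simp only [Real.fourierInv_eq', smul_eq_mul]
  have h3 := (hint _ h1).const_mul (2 * (2 * Real.pi * Complex.I * ξ))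
  have h4 := (hint _ isWindow_gauss).const_mul ((2 * Real.pi * Complex.I * ξ) ^ 2)
  rw [← integral_const_mul, ← integral_const_mul, ← integral_add (hint _ h2) h3,
    ← integral_add (by simpa only [Pi.add_def] using (hint _ h2).add h3) h4]
  refine integral_congr_ae (Eventually.of_forall fun η => ?_)
  simp only [hF1, hF2, fourier_gauss_one]
  push_cast
  linear_combination (F η * gauss 1 (η - ξ) * (2 * Real.pi * η : ℂ) ^ 2 *
    Complex.exp (2 * Real.pi * inner ℝ η x * Complex.I)) * (-Complex.I_sq)

/-- The pointwise estimate behind `exists_weightNorm_lap_le`: two powers of `ξ` are absorbed by raising the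
order of the phase space weight by two. -/
theorem stft_lap_weighted_le {a b c : ℂ} (m : ℕ) (x ξ : ℝ) :
    ENNReal.ofReal (wt m x) ^ 2 * ‖a + 2 * (2 * Real.pi * Complex.I * ξ) * b +
      (2 * Real.pi * Complex.I * ξ) ^ 2 * c‖ₑ ^ 2 ≤
    ENNReal.ofReal (3 * (4 * Real.pi ^ 2 + 4 * Real.pi + 1) ^ 2) *
      (ENNReal.ofReal (wt (m + 2) (|x| + |ξ|)) ^ 2 * ‖a‖ₑ ^ 2 +
      ENNReal.ofReal (wt (m + 2) (|x| + |ξ|)) ^ 2 * ‖b‖ₑ ^ 2 +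
      ENNReal.ofReal (wt (m + 2) (|x| + |ξ|)) ^ 2 * ‖c‖ₑ ^ 2) := by
  have hπ := Real.pi_pos
  set Ω := wt (m + 2) (|x| + |ξ|) with hΩ
  have hΩ0 : 0 ≤ Ω := (wt_pos _ _).le
  have hW0 := (wt_pos m x).le
  simp only [← ofReal_norm]
  simp only [← ENNReal.ofReal_pow (norm_nonneg _), ← ENNReal.ofReal_pow hΩ0,
    ← ENNReal.ofReal_pow hW0, ← ENNReal.ofReal_mul (sq_nonneg (wt m x)),
    ← ENNReal.ofReal_mul (sq_nonneg Ω)]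
  rw [← ENNReal.ofReal_add (by positivity) (by positivity),
    ← ENNReal.ofReal_add (by positivity) (by positivity), ← ENNReal.ofReal_mul (by positivity)]
  refine ENNReal.ofReal_le_ofReal ?_
  set K : ℝ := 4 * Real.pi ^ 2 + 4 * Real.pi + 1 with hK
  have hK0 : 0 ≤ K := by positivity
  set s : ℝ := wt 2 (|x| + |ξ|) with hs
  have hs1 : 1 ≤ s := one_le_wt _ _
  have habs : |(|x| + |ξ|)| = |x| + |ξ| := abs_of_nonneg (by positivity)
  have hx := abs_nonneg x
  have hξ := abs_nonneg ξ
  have hs2 : |ξ| ≤ s := by rw [hs, wt, habs]; nlinarith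
  have hs3 : |ξ| ^ 2 ≤ s := by rw [hs, wt, habs]; nlinarith
  have hW : wt m x * s ≤ Ω := by
    rw [hΩ, wt_add, ← hs]
    refine mul_le_mul_of_nonneg_right ?_ (zero_le_one.trans hs1)
    unfold wt
    rw [habs]
    gcongr
    linarith
  have h1 : ‖a + 2 * (2 * Real.pi * Complex.I * ξ) * b +
      (2 * Real.pi * Complex.I * ξ) ^ 2 * c‖ ≤ s * (K * (‖a‖ + ‖b‖ + ‖c‖)) := by
    refine (norm_add₃_le).trans ?_
    simp only [norm_mul, norm_pow, Complex.norm_real, Complex.norm_ofNat, Real.norm_eq_abs,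
      abs_of_pos hπ, Complex.norm_I, mul_one]
    have e1 : ‖a‖ ≤ s * (K * ‖a‖) := by
      rw [← mul_assoc s]
      refine le_mul_of_one_le_left (norm_nonneg a) ?_
      nlinarith [sq_nonneg Real.pi]
    have e2 : 2 * (2 * Real.pi * |ξ|) * ‖b‖ ≤ s * (K * ‖b‖) := by
      rw [← mul_assoc s]
      refine mul_le_mul_of_nonneg_right ?_ (norm_nonneg b)
      calc 2 * (2 * Real.pi * |ξ|) = |ξ| * (4 * Real.pi) := by ring
        _ ≤ s * K := by gcongr; rw [hK]; nlinarith [sq_nonneg Real.pi]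
    have e3 : (2 * Real.pi * |ξ|) ^ 2 * ‖c‖ ≤ s * (K * ‖c‖) := by
      rw [← mul_assoc s]
      refine mul_le_mul_of_nonneg_right ?_ (norm_nonneg c)
      calc (2 * Real.pi * |ξ|) ^ 2 = |ξ| ^ 2 * (4 * Real.pi ^ 2) := by ring
        _ ≤ s * K := by gcongr; rw [hK]; linarith
    linarith
  have hN : 0 ≤ K * (‖a‖ + ‖b‖ + ‖c‖) := by positivity
  calc wt m x ^ 2 * ‖a + 2 * (2 * Real.pi * Complex.I * ξ) * b +
      (2 * Real.pi * Complex.I * ξ) ^ 2 * c‖ ^ 2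
      = (wt m x * ‖a + 2 * (2 * Real.pi * Complex.I * ξ) * b +
      (2 * Real.pi * Complex.I * ξ) ^ 2 * c‖) ^ 2 := by ring
    _ ≤ (Ω * (K * (‖a‖ + ‖b‖ + ‖c‖))) ^ 2 := by
        refine pow_le_pow_left₀ (by positivity) ?_ 2
        calc _ ≤ wt m x * (s * (K * (‖a‖ + ‖b‖ + ‖c‖))) := by gcongr
          _ = (wt m x * s) * (K * (‖a‖ + ‖b‖ + ‖c‖)) := by ring
          _ ≤ _ := by gcongr
    _ = K ^ 2 * Ω ^ 2 * (‖a‖ + ‖b‖ + ‖c‖) ^ 2 := by ring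
    _ ≤ K ^ 2 * Ω ^ 2 * (3 * (‖a‖ ^ 2 + ‖b‖ ^ 2 + ‖c‖ ^ 2)) := by
        gcongr
        nlinarith [sq_nonneg (‖a‖ - ‖b‖), sq_nonneg (‖a‖ - ‖c‖), sq_nonneg (‖b‖ - ‖c‖)]
    _ = _ := by ring

theorem lintegral_lintegral_add₃ {a b c : ℝ × ℝ → ℝ≥0∞} (ha : Measurable a)
    (hc : Measurable c) {k : ℝ≥0∞} (hk : k ≠ ∞) :
    ∫⁻ ξ, ∫⁻ x, k * (a (ξ, x) + b (ξ, x) + c (ξ, x)) =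
      k * ((∫⁻ ξ, ∫⁻ x, a (ξ, x)) + (∫⁻ ξ, ∫⁻ x, b (ξ, x)) + ∫⁻ ξ, ∫⁻ x, c (ξ, x)) := by
  rw [← lintegral_add_left ha.lintegral_prod_right', ← lintegral_add_right _
    hc.lintegral_prod_right', ← lintegral_const_mul' _ _ hk]
  refine lintegral_congr fun ξ => ?_
  have ha' : Measurable fun x => a (ξ, x) := by fun_prop
  have hc' : Measurable fun x => c (ξ, x) := by fun_prop
  rw [lintegral_const_mul' _ _ hk, lintegral_add_right _ hc', lintegral_add_left ha']

/-- The mixed estimate `‖|x|^m ∂_x² f‖ ≲ ‖|x|^(m+2) f‖ + ‖f‖_{H^(m+2)}`. -/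
theorem exists_weightNorm_lap_le {m : ℕ} (hm : 1 ≤ m) :
    ∃ C : ℝ≥0, 0 < C ∧ ∀ f : L2, weightNorm m (lap f) ≤ C * phaseNorm (m + 2) f := by
  obtain ⟨g₁, g₂, hg1, hg2, hF1, hF2⟩ := exists_gauss_deriv_windows
  obtain ⟨hc0, hc1⟩ := gauss_lower_const m
  set N : (ℝ → ℂ) → ℝ≥0∞ := fun w =>
    2 * 4 ^ (m + 2) * (weightNorm (m + 2) w ^ 2 + weightNorm (m + 2) (𝓕 w) ^ 2) with hN
  have hNfin : ∀ w, IsWindow w → N w ≠ ∞ := fun w hw => by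
    have h1 := (hw.weightNorm_lt_top (m + 2)).ne
    have h2 := (hw.weightNorm_fourier_lt_top (m + 2)).ne
    simp only [hN]; finiteness
  set c₀ : ℝ≥0∞ := ENNReal.ofReal (3 * (4 * Real.pi ^ 2 + 4 * Real.pi + 1) ^ 2) with hc₀
  set A : ℝ≥0∞ := c₀ * (N g₂ + N g₁ + N (gauss 1)) with hA
  have hAtop : A ≠ ∞ := by
    have h1 := hNfin _ hg1
    have h2 := hNfin _ hg2
    have h3 := hNfin _ isWindow_gauss
    rw [hA]; finiteness
  obtain ⟨C, hC, hCle⟩ := exists_le_mul_of_sq_le hc0 hc1 hAtop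
  refine ⟨C, hC, fun f => ?_⟩
  by_cases hf : phaseNorm (m + 2) f < ∞
  swap
  · rw [not_lt_top_iff.1 hf, ENNReal.mul_top (by simpa using hC.ne')]; exact le_top
  have hF := integrable_fourier_of_phaseNorm (by omega) hf
  have hFs : StronglyMeasurable (𝓕 f : L2) := Lp.stronglyMeasurable _
  have hFL2 : MemLp (𝓕 f : L2) 2 := Lp.memLp _
  have hfin : weightNorm (m + 2) (𝓕 f : L2) < ∞ :=
    (weightNorm_fourier_le_phaseNorm (m + 2) f).trans_lt hf
  have hfin2 : weightNorm 2 (𝓕 f : L2) < ∞ :=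
    (weightNorm_mono (by omega) _).trans_lt hfin
  have hlapae := fourier_lap_ae hfin2
  have hG : Integrable (fun ξ : ℝ => -(2 * Real.pi * ξ : ℂ) ^ 2 * (𝓕 f : L2) ξ) := by
    refine (integrable_of_weightNorm (Lp.aestronglyMeasurable _) hm ?_).congr hlapae
    exact (weightNorm_fourier_lap_le m f).trans_lt (ENNReal.mul_lt_top (by finiteness) hfin)
  have hG2 := memLp_lap hfin2
  have hinv := fourierInv_ae_of_fourier_ae hF (EventuallyEq.refl _ _)
  set F : ℝ → ℂ := ⇑(𝓕 f : L2) with hFdef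
  have hGs : StronglyMeasurable (fun ξ : ℝ => -(2 * Real.pi * ξ : ℂ) ^ 2 * F ξ) :=
    (by fun_prop : Continuous fun ξ : ℝ => -(2 * Real.pi * ξ : ℂ) ^ 2).stronglyMeasurable.mul hFs
  refine hCle _ _ ?_
  have h1 := le_lintegral_stft m hGs hG hG2 isWindow_gauss.integrable isWindow_gauss.continuous
    (norm_gauss_le_one (by simp))
  rw [weightNorm_congr (fourierInv_ae_of_fourier_ae hG hlapae)] at h1
  refine h1.trans ?_
  have hDm : ∀ w, IsWindow w → Measurable (fun z : ℝ × ℝ =>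
      ENNReal.ofReal (wt (m + 2) (|z.2| + |z.1|)) ^ 2 * ‖stft (𝓕 w) F z.2 z.1‖ₑ ^ 2) :=
    fun w hw => by
      have := measurable_stft_sq_swap hFs (fourier_integral_continuous hw.integrable)
      fun_prop
  have hup : ∀ w, IsWindow w → ∫⁻ ξ, ∫⁻ x, ENNReal.ofReal (wt (m + 2) (|x| + |ξ|)) ^ 2 *
      ‖stft (𝓕 w) F x ξ‖ₑ ^ 2 ≤ N w * phaseNorm (m + 2) f ^ 2 := by
    intro w hw
    obtain ⟨B, hB⟩ := hw.bounded
    have := lintegral_stft_le (m + 2) hFs hF hFL2 hw.integrable hw.continuous hB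
    rwa [weightNorm_congr hinv] at this
  simp_rw [stft_lap hF hg1 hg2 hF1 hF2]
  refine (lintegral_mono fun ξ => lintegral_mono fun x => stft_lap_weighted_le m x ξ).trans ?_
  refine (lintegral_lintegral_add₃ (b := fun z : ℝ × ℝ =>
    ENNReal.ofReal (wt (m + 2) (|z.2| + |z.1|)) ^ 2 * ‖stft (𝓕 g₁) F z.2 z.1‖ₑ ^ 2)
    (hDm _ hg2) (hDm _ isWindow_gauss) ENNReal.ofReal_ne_top).le.trans ?_
  calc _ ≤ c₀ * (N g₂ * phaseNorm (m + 2) f ^ 2 + N g₁ * phaseNorm (m + 2) f ^ 2 +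
          N (gauss 1) * phaseNorm (m + 2) f ^ 2) := by
        gcongr
        · exact hup _ hg2
        · exact hup _ hg1
        · exact hup _ isWindow_gauss
    _ = A * phaseNorm (m + 2) f ^ 2 := by rw [hA]; ring

theorem exists_phaseNorm_lap_le {m : ℕ} (hm : 1 ≤ m) :
    ∃ C : ℝ≥0, ∀ f : L2, phaseNorm m (lap f) ≤ C * phaseNorm (m + 2) f := by
  obtain ⟨C, -, h⟩ := exists_weightNorm_lap_le hm
  refine ⟨C + ((2 * Real.pi) ^ 2).toNNReal, fun f => ?_⟩
  rw [ENNReal.coe_add, add_mul, phaseNorm]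
  refine add_le_add (h f) ((weightNorm_fourier_lap_le m f).trans ?_)
  exact mul_le_mul_right (weightNorm_fourier_le_phaseNorm _ f) _

theorem exists_phaseNorm_freeFlow_le {m : ℕ} (hm : 1 ≤ m) (T : ℝ) :
    ∃ C : ℝ≥0, ∀ t : ℝ, |t| ≤ T → ∀ f : L2, phaseNorm m (freeFlow t f) ≤ C * phaseNorm m f := by
  obtain ⟨C, -, h⟩ := exists_weightNorm_freeFlow_le hm T
  refine ⟨C + 1, fun t ht f => ?_⟩
  rw [ENNReal.coe_add, add_mul, phaseNorm, ENNReal.coe_one, one_mul, weightNorm_fourier_freeFlow]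
  exact add_le_add (h t ht f) (weightNorm_fourier_le_phaseNorm m f)

/-! ### Products and complex conjugation -/

theorem ennreal_add_sq_le (a b : ℝ≥0∞) : (a + b) ^ 2 ≤ 4 * (a ^ 2 + b ^ 2) := by
  rcases le_total a b with h | h
  · calc (a + b) ^ 2 ≤ (b + b) ^ 2 := by gcongr
      _ = 4 * b ^ 2 := by ring
      _ ≤ _ := by gcongr; exact le_add_self
  · calc (a + b) ^ 2 ≤ (a + a) ^ 2 := by gcongr
      _ = 4 * a ^ 2 := by ring
      _ ≤ _ := by gcongr; exact le_self_add

/-- Young's inequality `L² * L¹ ⊆ L²`. -/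
theorem lintegral_conv_sq_le {a b : ℝ → ℝ≥0∞} (ha : Measurable a) (hb : Measurable b) :
    ∫⁻ ξ, (∫⁻ η, a η * b (ξ - η)) ^ 2 ≤ (∫⁻ η, a η ^ 2) * (∫⁻ η, b η) ^ 2 := by
  have hs : Measurable fun x => b x ^ (1 / 2 : ℝ) := hb.pow_const _
  have hsq : ∀ x, (b x ^ (1 / 2 : ℝ)) ^ 2 = b x := fun x => by
    rw [← ENNReal.rpow_natCast, ← ENNReal.rpow_mul]; norm_num
  have h1 : ∀ ξ, (∫⁻ η, a η * b (ξ - η)) ^ 2 ≤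
      (∫⁻ η, a η ^ 2 * b (ξ - η)) * ∫⁻ η, b η := by
    intro ξ
    have h := ENNReal.lintegral_mul_le_Lp_mul_Lq (volume : Measure ℝ) Real.HolderConjugate.two_two
      (f := fun η => a η * b (ξ - η) ^ (1 / 2 : ℝ)) (g := fun η => b (ξ - η) ^ (1 / 2 : ℝ))
      (by fun_prop) (by fun_prop)
    have e0 : ∀ η, ((fun η => a η * b (ξ - η) ^ (1 / 2 : ℝ)) *
        (fun η => b (ξ - η) ^ (1 / 2 : ℝ))) η = a η * b (ξ - η) := fun η => by
      rw [Pi.mul_apply, mul_assoc, ← sq, hsq]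
    simp only [e0, ENNReal.rpow_two, mul_pow, hsq] at h
    have h2 := pow_le_pow_left₀ zero_le h 2
    rw [mul_pow] at h2
    have e1 : ∀ X : ℝ≥0∞, (X ^ (1 / 2 : ℝ)) ^ 2 = X := fun X => by
      rw [← ENNReal.rpow_natCast, ← ENNReal.rpow_mul]; norm_num
    rw [e1, e1, lintegral_sub_left_eq_self b ξ] at h2
    exact h2
  calc ∫⁻ ξ, (∫⁻ η, a η * b (ξ - η)) ^ 2
      ≤ ∫⁻ ξ, (∫⁻ η, a η ^ 2 * b (ξ - η)) * ∫⁻ η, b η := lintegral_mono h1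
    _ = (∫⁻ ξ, ∫⁻ η, a η ^ 2 * b (ξ - η)) * ∫⁻ η, b η := by
        rw [lintegral_mul_const]
        exact Measurable.lintegral_prod_right' (f := fun z : ℝ × ℝ => a z.2 ^ 2 * b (z.1 - z.2))
          (by fun_prop)
    _ = (∫⁻ η, ∫⁻ ξ, a η ^ 2 * b (ξ - η)) * ∫⁻ η, b η := by
        rw [lintegral_lintegral_swap]
        fun_prop
    _ = (∫⁻ η, a η ^ 2 * ∫⁻ ξ, b ξ) * ∫⁻ η, b η := by
        congr 1
        refine lintegral_congr fun η => ?_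
        rw [lintegral_const_mul _ (by fun_prop), lintegral_sub_right_eq_self]
    _ = _ := by rw [lintegral_mul_const _ (by fun_prop), sq, mul_assoc]

theorem lintegral_conv_comm (a b : ℝ → ℝ≥0∞) (ξ : ℝ) :
    ∫⁻ η, a η * b (ξ - η) = ∫⁻ η, b η * a (ξ - η) := by
  rw [← lintegral_sub_left_eq_self _ ξ]
  simp [mul_comm]

open scoped Convolution in
/-- Weighted Young inequality for the convolution. -/
theorem weightNorm_convolution_sq_le (m : ℕ) {F G : ℝ → ℂ} (hF : StronglyMeasurable F)
    (hG : StronglyMeasurable G) :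
    weightNorm m (F ⋆[ContinuousLinearMap.mul ℂ ℂ] G) ^ 2 ≤ 4 ^ (m + 1) *
      (weightNorm m F ^ 2 * (∫⁻ η, ‖G η‖ₑ) ^ 2 + (∫⁻ η, ‖F η‖ₑ) ^ 2 * weightNorm m G ^ 2) := by
  have hFm := hF.measurable
  have hGm := hG.measurable
  set a : ℝ → ℝ≥0∞ := fun η => ENNReal.ofReal (wt m η) * ‖F η‖ₑ with ha
  set b : ℝ → ℝ≥0∞ := fun η => ENNReal.ofReal (wt m η) * ‖G η‖ₑ with hb
  have ham : Measurable a := by fun_prop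
  have hbm : Measurable b := by fun_prop
  have hpt : ∀ ξ, ENNReal.ofReal (wt m ξ) * ‖(F ⋆[ContinuousLinearMap.mul ℂ ℂ] G) ξ‖ₑ ≤
      2 ^ m * ((∫⁻ η, a η * ‖G (ξ - η)‖ₑ) + ∫⁻ η, b η * ‖F (ξ - η)‖ₑ) := by
    intro ξ
    rw [lintegral_conv_comm b (fun η => ‖F η‖ₑ), ← lintegral_add_left (by fun_prop),
      ← lintegral_const_mul' _ _ (by finiteness)]
    calc _ ≤ ENNReal.ofReal (wt m ξ) * ∫⁻ η, ‖F η‖ₑ * ‖G (ξ - η)‖ₑ := by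
          gcongr
          rw [convolution_def]
          refine (enorm_integral_le_lintegral_enorm _).trans (le_of_eq ?_)
          simp
      _ = ∫⁻ η, ENNReal.ofReal (wt m ξ) * (‖F η‖ₑ * ‖G (ξ - η)‖ₑ) := by
          rw [lintegral_const_mul' _ _ (by finiteness)]
      _ ≤ _ := by
          refine lintegral_mono fun η => ?_
          have h := wt_add_le_add m η (ξ - η)
          rw [add_sub_cancel] at h
          have h' : ENNReal.ofReal (wt m ξ) ≤
              2 ^ m * (ENNReal.ofReal (wt m η) + ENNReal.ofReal (wt m (ξ - η))) := by
            refine (ENNReal.ofReal_le_ofReal h).trans (le_of_eq ?_)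
            rw [ENNReal.ofReal_mul (by positivity), ENNReal.ofReal_add (wt_pos _ _).le
              (wt_pos _ _).le, ENNReal.ofReal_pow (by norm_num)]
            norm_num
          calc _ ≤ (2 ^ m * (ENNReal.ofReal (wt m η) + ENNReal.ofReal (wt m (ξ - η)))) *
                (‖F η‖ₑ * ‖G (ξ - η)‖ₑ) := by gcongr
            _ = _ := by simp only [ha, hb]; ring
  have hY1 := lintegral_conv_sq_le ham hGm.enorm
  have hY2 := lintegral_conv_sq_le hbm hFm.enorm
  have e1 : ∫⁻ η, a η ^ 2 = weightNorm m F ^ 2 := by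
    rw [weightNorm_sq]; simp only [ha, mul_pow]
  have e2 : ∫⁻ η, b η ^ 2 = weightNorm m G ^ 2 := by
    rw [weightNorm_sq]; simp only [hb, mul_pow]
  rw [e1] at hY1
  rw [e2] at hY2
  calc weightNorm m (F ⋆[ContinuousLinearMap.mul ℂ ℂ] G) ^ 2
      ≤ ∫⁻ ξ, 4 ^ (m + 1) * ((∫⁻ η, a η * ‖G (ξ - η)‖ₑ) ^ 2 +
          (∫⁻ η, b η * ‖F (ξ - η)‖ₑ) ^ 2) := by
        rw [weightNorm_sq]
        refine lintegral_mono fun ξ => ?_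
        rw [← mul_pow]
        calc _ ≤ (2 ^ m * ((∫⁻ η, a η * ‖G (ξ - η)‖ₑ) + ∫⁻ η, b η * ‖F (ξ - η)‖ₑ)) ^ 2 :=
              pow_le_pow_left₀ zero_le (hpt ξ) 2
          _ = 4 ^ m * ((∫⁻ η, a η * ‖G (ξ - η)‖ₑ) + ∫⁻ η, b η * ‖F (ξ - η)‖ₑ) ^ 2 := by
              rw [mul_pow, ← pow_mul, mul_comm m 2, pow_mul]; norm_num
          _ ≤ 4 ^ m * (4 * ((∫⁻ η, a η * ‖G (ξ - η)‖ₑ) ^ 2 +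
                (∫⁻ η, b η * ‖F (ξ - η)‖ₑ) ^ 2)) := by gcongr; exact ennreal_add_sq_le _ _
          _ = _ := by ring
    _ = 4 ^ (m + 1) * ((∫⁻ ξ, (∫⁻ η, a η * ‖G (ξ - η)‖ₑ) ^ 2) +
          ∫⁻ ξ, (∫⁻ η, b η * ‖F (ξ - η)‖ₑ) ^ 2) := by
        rw [lintegral_const_mul' _ _ (by finiteness), lintegral_add_left]
        refine Measurable.pow_const ?_ _
        exact Measurable.lintegral_prod_right' (f := fun z : ℝ × ℝ => a z.2 * ‖G (z.1 - z.2)‖ₑ)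
          (by fun_prop)
    _ ≤ 4 ^ (m + 1) * (weightNorm m F ^ 2 * (∫⁻ η, ‖G η‖ₑ) ^ 2 +
          weightNorm m G ^ 2 * (∫⁻ η, ‖F η‖ₑ) ^ 2) := by gcongr
    _ = _ := by ring

/-- The Sobolev embedding into bounded functions. -/
theorem ae_enorm_le {m : ℕ} (hm : 1 ≤ m) {f : L2} (hf : phaseNorm m f < ∞) :
    ∀ᵐ x, ‖f x‖ₑ ≤ embConst * phaseNorm m f := by
  have hF := integrable_fourier_of_phaseNorm hm hf
  filter_upwards [fourierInv_ae_of_fourier_ae hF (EventuallyEq.refl _ _)] with x hx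
  rw [← hx, Real.fourierInv_eq]
  refine (enorm_integral_le_lintegral_enorm _).trans ?_
  simp only [Circle.smul_def, smul_eq_mul, enorm_mul]
  have : ∀ v : ℝ, ‖((Real.fourierChar (inner ℝ v x) : Circle) : ℂ)‖ₑ = 1 := fun v => by
    rw [← ofReal_norm, Circle.norm_coe, ENNReal.ofReal_one]
  simp only [this, one_mul]
  refine (lintegral_enorm_le _ (Lp.aestronglyMeasurable _) hm).trans ?_
  gcongr
  exact weightNorm_fourier_le_phaseNorm m f

theorem ae_norm_le {m : ℕ} (hm : 1 ≤ m) {f : L2} (hf : phaseNorm m f < ∞) :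
    ∀ᵐ x, ‖f x‖ ≤ (embConst * phaseNorm m f).toReal := by
  have hfin : embConst * phaseNorm m f ≠ ∞ := ENNReal.mul_ne_top embConst_lt_top.ne hf.ne
  filter_upwards [ae_enorm_le hm hf] with x hx
  rw [← toReal_enorm]
  exact ENNReal.toReal_mono hfin hx

/-- The pointwise product on `L²`, meaningful when it is square integrable, in particular when one
factor is bounded. -/
def mulL2 (f g : L2) : L2 := toL2 fun x => f x * g x

theorem mulL2_comm (f g : L2) : mulL2 f g = mulL2 g f := by
  unfold mulL2; congr 1; ext x; ring

theorem memLp_mul {m : ℕ} (hm : 1 ≤ m) {f : L2} (hf : phaseNorm m f < ∞) (g : L2) :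
    MemLp (fun x => f x * g x) 2 := by
  refine MemLp.mul (p := ∞) (q := 2) (r := 2) (Lp.memLp g) ?_
  exact memLp_top_of_bound (Lp.aestronglyMeasurable f) _ (ae_norm_le hm hf)

theorem coeFn_mulL2 {m : ℕ} (hm : 1 ≤ m) {f : L2} (hf : phaseNorm m f < ∞) (g : L2) :
    mulL2 f g =ᵐ[volume] fun x => f x * g x := coeFn_toL2 (memLp_mul hm hf g)

theorem weightNorm_mulL2_le {m : ℕ} (hm : 1 ≤ m) {f : L2} (hf : phaseNorm m f < ∞) (n : ℕ)
    (g : L2) : weightNorm n (mulL2 f g) ≤ embConst * phaseNorm m f * weightNorm n g := by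
  have hfin : embConst * phaseNorm m f ≠ ∞ := ENNReal.mul_ne_top embConst_lt_top.ne hf.ne
  rw [weightNorm_congr (coeFn_mulL2 hm hf g), ← ENNReal.ofReal_toReal hfin]
  refine weightNorm_le_mul ?_
  filter_upwards [ae_norm_le hm hf] with x hx
  rw [norm_mul]
  have := wt_pos n x
  calc wt n x * (‖f x‖ * ‖g x‖) = ‖f x‖ * (wt n x * ‖g x‖) := by ring
    _ ≤ _ := by gcongr

open scoped Convolution in
/-- The Fourier transform turns products into convolutions. -/
theorem fourier_mulL2_ae {m : ℕ} (hm : 1 ≤ m) {f g : L2} (hf : phaseNorm m f < ∞)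
    (hg : phaseNorm m g < ∞) : (𝓕 (mulL2 f g) : L2) =ᵐ[volume]
      (𝓕 f : L2) ⋆[ContinuousLinearMap.mul ℂ ℂ] (𝓕 g : L2) := by
  have hF := integrable_fourier_of_phaseNorm hm hf
  have hG := integrable_fourier_of_phaseNorm hm hg
  have hfi := fourierInv_ae_of_fourier_ae hF (EventuallyEq.refl _ _)
  have hgi := fourierInv_ae_of_fourier_ae hG (EventuallyEq.refl _ _)
  have hFw := (weightNorm_fourier_le_phaseNorm m f).trans_lt hf
  have hGw := (weightNorm_fourier_le_phaseNorm m g).trans_lt hg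
  have hF1 := (lintegral_enorm_le _ (Lp.aestronglyMeasurable (𝓕 f : L2)) hm).trans_lt
    (ENNReal.mul_lt_top embConst_lt_top hFw)
  have hG1 := (lintegral_enorm_le _ (Lp.aestronglyMeasurable (𝓕 g : L2)) hm).trans_lt
    (ENNReal.mul_lt_top embConst_lt_top hGw)
  have hy := weightNorm_convolution_sq_le m (Lp.stronglyMeasurable (𝓕 f : L2))
    (Lp.stronglyMeasurable (𝓕 g : L2))
  have hmul := coeFn_mulL2 hm hf g
  generalize (⇑(𝓕 f : L2) : ℝ → ℂ) = F at *
  generalize (⇑(𝓕 g : L2) : ℝ → ℂ) = G at *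
  set H := F ⋆[ContinuousLinearMap.mul ℂ ℂ] G with hH
  have hHi : Integrable H := hF.integrable_convolution _ hG
  have hHw : weightNorm m H < ∞ := by
    have : weightNorm m H ^ 2 < ∞ := by
      refine hy.trans_lt ?_
      have := hFw.ne; have := hGw.ne; have := hF1.ne; have := hG1.ne
      exact lt_top_iff_ne_top.2 (by finiteness)
    simpa using this
  have hH2 : MemLp H 2 := memLp_of_weightNorm hHi.aestronglyMeasurable hHw
  have key : (𝓕⁻ (hH2.toLp H) : L2) = mulL2 f g := by
    refine Lp.ext ?_
    filter_upwards [fourierInv_toLp_ae hHi hH2, hfi, hgi, hmul] with x h1 h2 h3 h4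
    rw [h1, h4, ← h2, ← h3]
    simp only [Real.fourierInv_eq_fourier_neg]
    exact Real.fourier_mul_convolution_eq hF hG (-x)
  rw [← key, FourierTransform.fourier_fourierInv_eq]
  exact hH2.coeFn_toLp

/-- The phase space norm of order at least one is submultiplicative up to a constant. -/
theorem exists_phaseNorm_mulL2_le {m : ℕ} (hm : 1 ≤ m) :
    ∃ C : ℝ≥0, ∀ f g : L2, phaseNorm m f < ∞ → phaseNorm m g < ∞ →
      phaseNorm m (mulL2 f g) ≤ C * (phaseNorm m f * phaseNorm m g) := by
  have hE := embConst_lt_top.ne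
  obtain ⟨C, hC, hCle⟩ := exists_le_mul_of_sq_le (c := 1)
    (A := 4 ^ (m + 1) * (2 * embConst ^ 2)) (by norm_num) (by norm_num) (by finiteness)
  refine ⟨embConst.toNNReal + C, fun f g hf hg => ?_⟩
  rw [ENNReal.coe_add, ENNReal.coe_toNNReal hE, add_mul]
  refine add_le_add ?_ (hCle _ _ ?_)
  · refine (weightNorm_mulL2_le hm hf m g).trans ?_
    rw [mul_assoc]
    gcongr
    exact weightNorm_le_phaseNorm m g
  · rw [one_mul, weightNorm_congr (fourier_mulL2_ae hm hf hg)]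
    refine (weightNorm_convolution_sq_le m (Lp.stronglyMeasurable _)
      (Lp.stronglyMeasurable _)).trans ?_
    have h1 := weightNorm_fourier_le_phaseNorm m f
    have h2 := weightNorm_fourier_le_phaseNorm m g
    have h3 := lintegral_enorm_le _ (Lp.aestronglyMeasurable (𝓕 f : L2)) hm
    have h4 := lintegral_enorm_le _ (Lp.aestronglyMeasurable (𝓕 g : L2)) hm
    calc _ ≤ 4 ^ (m + 1) * (phaseNorm m f ^ 2 * (embConst * phaseNorm m g) ^ 2 +
          (embConst * phaseNorm m f) ^ 2 * phaseNorm m g ^ 2) := by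
          gcongr
          · exact h4.trans (by gcongr)
          · exact h3.trans (by gcongr)
      _ = _ := by ring

theorem fourier_star {f : ℝ → ℂ} (ξ : ℝ) : 𝓕 (fun x => conj (f x)) ξ = conj (𝓕 f (-ξ)) := by
  rw [Real.fourier_real_eq, Real.fourier_real_eq, ← integral_conj]
  refine integral_congr_ae (Eventually.of_forall fun x => ?_)
  simp only [Circle.smul_def, smul_eq_mul, map_mul, Real.fourierChar_apply, ← Complex.exp_conj]
  congr 2
  simp only [Complex.conj_ofReal, Complex.conj_I]
  push_cast
  ring

theorem coeFn_star_ae (f : L2) : (star f : L2) =ᵐ[volume] fun x => conj (f x) := Lp.coeFn_star f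

/-- Complex conjugation preserves the phase space norm. -/
theorem phaseNorm_star {m : ℕ} (hm : 1 ≤ m) {f : L2} (hf : phaseNorm m f < ∞) :
    phaseNorm m (star f) = phaseNorm m f := by
  have h1 : weightNorm m (star f : L2) = weightNorm m f := by
    rw [weightNorm_congr (coeFn_star_ae f)]
    exact eLpNorm_congr_norm_ae (Eventually.of_forall fun x => by simp)
  have hfi : Integrable f := integrable_of_weightNorm (Lp.aestronglyMeasurable f) hm
    ((weightNorm_le_phaseNorm m f).trans_lt hf)
  have hsi : Integrable (star f : L2) := integrable_of_weightNorm (Lp.aestronglyMeasurable _) hm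
    (by rw [h1]; exact (weightNorm_le_phaseNorm m f).trans_lt hf)
  have h2 : weightNorm m (𝓕 (star f) : L2) = weightNorm m (𝓕 f : L2) := by
    rw [weightNorm_congr (coeFn_fourier_ae hsi), weightNorm_congr (coeFn_fourier_ae hfi),
      fourierIntegral_congr_ae (coeFn_star_ae f)]
    have : weightNorm m (𝓕 fun x => conj (f x)) ^ 2 = weightNorm m (𝓕 (f : ℝ → ℂ)) ^ 2 := by
      rw [weightNorm_sq, weightNorm_sq, ← lintegral_neg_eq_self]
      refine lintegral_congr fun x => ?_
      rw [fourier_star, neg_neg, wt_neg, ← ofReal_norm, RCLike.norm_conj, ofReal_norm]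
    exact le_antisymm ((ENNReal.pow_le_pow_left_iff two_ne_zero).1 this.le)
      ((ENNReal.pow_le_pow_left_iff two_ne_zero).1 this.ge)
  rw [phaseNorm, h1, h2, phaseNorm]

/-! ### Truncated weights and mean value estimates -/

/-- Multiplication by a bounded continuous function, as a bounded operator on `L²`. -/
def mulCLM (w : ℝ → ℂ) (hw : Continuous w) (B : ℝ) (hB : ∀ x, ‖w x‖ ≤ B) : L2 →L[ℂ] L2 :=
  have hmem : ∀ f : L2, MemLp (fun x => w x * f x) 2 := fun f =>
    MemLp.of_le_mul (c := B) (Lp.memLp f) (hw.aestronglyMeasurable.mul (Lp.aestronglyMeasurable f))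
      (Eventually.of_forall fun x => by
        rw [norm_mul]; exact mul_le_mul_of_nonneg_right (hB x) (norm_nonneg _))
  LinearMap.mkContinuous
    { toFun := fun f => (hmem f).toLp _
      map_add' := fun f g => by
        refine Lp.ext ?_
        filter_upwards [(hmem (f + g)).coeFn_toLp, (hmem f).coeFn_toLp, (hmem g).coeFn_toLp,
          Lp.coeFn_add f g, Lp.coeFn_add ((hmem f).toLp _) ((hmem g).toLp _)] with x h1 h2 h3 h4 h5
        rw [h1, h5, Pi.add_apply, h2, h3, h4, Pi.add_apply, mul_add]
      map_smul' := fun c f => by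
        refine Lp.ext ?_
        filter_upwards [(hmem (c • f)).coeFn_toLp, (hmem f).coeFn_toLp,
          Lp.coeFn_smul c f, Lp.coeFn_smul c ((hmem f).toLp _)] with x h1 h2 h3 h4
        rw [h1, RingHom.id_apply, h4, Pi.smul_apply, h2, h3, Pi.smul_apply, smul_eq_mul,
          smul_eq_mul]
        ring }
    B fun f => by
      refine Lp.norm_le_mul_norm_of_ae_le_mul ?_
      filter_upwards [(hmem f).coeFn_toLp] with x hx
      simp only [LinearMap.coe_mk, AddHom.coe_mk]
      rw [hx, norm_mul]
      exact mul_le_mul_of_nonneg_right (hB x) (norm_nonneg _)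

theorem coeFn_mulCLM (w : ℝ → ℂ) (hw : Continuous w) (B : ℝ) (hB : ∀ x, ‖w x‖ ≤ B) (f : L2) :
    mulCLM w hw B hB f =ᵐ[volume] fun x => w x * f x := by
  have hmem : MemLp (fun x => w x * f x) 2 :=
    MemLp.of_le_mul (c := B) (Lp.memLp f) (hw.aestronglyMeasurable.mul (Lp.aestronglyMeasurable f))
      (Eventually.of_forall fun x => by
        rw [norm_mul]; exact mul_le_mul_of_nonneg_right (hB x) (norm_nonneg _))
  exact hmem.coeFn_toLp

/-- The weight `(1 + |x|)^m` truncated at height `n`. -/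
def truncWt (m n : ℕ) (x : ℝ) : ℂ := ((min (wt m x) n : ℝ) : ℂ)

theorem continuous_truncWt (m n : ℕ) : Continuous (truncWt m n) := by unfold truncWt; fun_prop

theorem norm_truncWt (m n : ℕ) (x : ℝ) : ‖truncWt m n x‖ = min (wt m x) n := by
  rw [truncWt, Complex.norm_real, Real.norm_of_nonneg (le_min (wt_pos m x).le n.cast_nonneg)]

theorem norm_truncWt_le (m n : ℕ) (x : ℝ) : ‖truncWt m n x‖ ≤ n :=
  (norm_truncWt m n x).le.trans (min_le_right _ _)

/-- Multiplication by the truncated weight. -/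
def truncCLM (m n : ℕ) : L2 →L[ℂ] L2 :=
  mulCLM (truncWt m n) (continuous_truncWt m n) n (norm_truncWt_le m n)

theorem coeFn_truncCLM (m n : ℕ) (f : L2) :
    truncCLM m n f =ᵐ[volume] fun x => truncWt m n x * f x := coeFn_mulCLM _ _ _ _ f

/-- Multiplication by a truncated weight, on the position side or on the frequency side. These
bounded operators detect the phase space norm. -/
def testCLM (m : ℕ) (i : Bool × ℕ) : L2 →L[ℂ] L2 :=
  if i.1 then truncCLM m i.2 else truncCLM m i.2 ∘L FourierTransform.fourierCLM ℂ L2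

theorem enorm_truncCLM_le (m n : ℕ) (f : L2) : ‖truncCLM m n f‖ₑ ≤ weightNorm m f := by
  rw [Lp.enorm_def, eLpNorm_congr_ae (coeFn_truncCLM m n f)]
  refine eLpNorm_mono fun x => ?_
  rw [norm_mul, norm_mul, norm_truncWt, Complex.norm_real, Real.norm_of_nonneg (wt_pos m x).le]
  exact mul_le_mul_of_nonneg_right (min_le_left _ _) (norm_nonneg _)

/-- The truncated weights increase to the weight, so Fatou's lemma recovers the weighted norm. -/
theorem weightNorm_le_of_truncCLM (m : ℕ) (f : L2) {A : ℝ≥0∞} (h : ∀ n, ‖truncCLM m n f‖ₑ ≤ A) :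
    weightNorm m f ≤ A := by
  have h1 : ∀ n, eLpNorm (fun x => truncWt m n x * f x) 2 volume ≤ A := fun n => by
    rw [← eLpNorm_congr_ae (coeFn_truncCLM m n f), ← Lp.enorm_def]
    exact h n
  have h2 := Lp.eLpNorm_lim_le_liminf_eLpNorm (p := 2) (μ := (volume : Measure ℝ))
    (f := fun n x => truncWt m n x * f x)
    (fun n => (continuous_truncWt m n).aestronglyMeasurable.mul (Lp.aestronglyMeasurable f))
    (fun x => (wt m x : ℂ) * f x) (Eventually.of_forall fun x => ?_)
  · refine h2.trans ?_
    exact liminf_le_of_le (by isBoundedDefault) fun b hb => by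
      obtain ⟨n, hn⟩ := hb.exists
      exact hn.trans (h1 n)
  · refine tendsto_const_nhds.congr' ?_
    filter_upwards [eventually_ge_atTop ⌈wt m x⌉₊] with n hn
    have : wt m x ≤ n := (Nat.le_ceil _).trans (by exact_mod_cast hn)
    rw [truncWt, min_eq_left this]

theorem enorm_testCLM_le (m : ℕ) (i : Bool × ℕ) (f : L2) : ‖testCLM m i f‖ₑ ≤ phaseNorm m f := by
  rcases i with ⟨_ | _, n⟩
  · exact (enorm_truncCLM_le m n (𝓕 f)).trans (weightNorm_fourier_le_phaseNorm m f)
  · exact (enorm_truncCLM_le m n f).trans (weightNorm_le_phaseNorm m f)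

/-- Uniform bounds for the test operators bound the phase space norm; the factor two accounts for its two
summands. -/
theorem phaseNorm_le_of_testCLM (m : ℕ) {f : L2} {A : ℝ≥0∞} (h : ∀ i, ‖testCLM m i f‖ₑ ≤ A) :
    phaseNorm m f ≤ 2 * A := by
  rw [two_mul]
  exact add_le_add (weightNorm_le_of_truncCLM m f fun n => h (true, n))
    (weightNorm_le_of_truncCLM m (𝓕 f) fun n => h (false, n))

theorem norm_testCLM_le {m : ℕ} {f : L2} {B : ℝ≥0} (h : phaseNorm m f ≤ B) (i : Bool × ℕ) :
    ‖testCLM m i f‖ ≤ B := by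
  have := (enorm_testCLM_le m i f).trans h
  rwa [enorm_le_coe] at this

theorem phaseNorm_le_of_norm_testCLM {m : ℕ} {f : L2} {A : ℝ} (h : ∀ i, ‖testCLM m i f‖ ≤ A) :
    phaseNorm m f ≤ ENNReal.ofReal (2 * A) := by
  rw [ENNReal.ofReal_mul (by norm_num), ENNReal.ofReal_ofNat]
  refine phaseNorm_le_of_testCLM m fun i => ?_
  rw [← ofReal_norm]
  exact ENNReal.ofReal_le_ofReal (h i)

theorem hasDerivWithinAt_testCLM {F : ℝ → L2} {F' : L2} {s : Set ℝ} {t : ℝ} (m : ℕ) (i : Bool × ℕ)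
    (h : HasDerivWithinAt F F' s t) :
    HasDerivWithinAt (fun t => testCLM m i (F t)) (testCLM m i F') s t :=
  (((testCLM m i).restrictScalars ℝ).hasFDerivAt.comp_hasDerivWithinAt t h :)

section Taylor

variable {E : Type*} [NormedAddCommGroup E] [NormedSpace ℝ E]

/-- First order Taylor estimate. -/
theorem norm_taylor_one_le {τ B : ℝ} {F F' F'' : ℝ → E}
    (h1 : ∀ t ∈ Icc 0 τ, HasDerivWithinAt F (F' t) (Icc 0 τ) t)
    (h2 : ∀ t ∈ Icc 0 τ, HasDerivWithinAt F' (F'' t) (Icc 0 τ) t)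
    (hB : ∀ t ∈ Icc 0 τ, ‖F'' t‖ ≤ B) {m : ℝ} (hm : m ∈ Icc 0 τ) {x : ℝ} (hx : x ∈ Icc 0 τ) :
    ‖F x - F m - (x - m) • F' m‖ ≤ B * τ ^ 2 := by
  have hτ : 0 ≤ τ := hm.1.trans hm.2
  have hB0 : 0 ≤ B := (norm_nonneg _).trans (hB m hm)
  have habs : ∀ y ∈ Icc 0 τ, ‖y - m‖ ≤ τ := fun y hy => by
    rw [Real.norm_eq_abs, abs_le]; constructor <;> linarith [hy.1, hy.2, hm.1, hm.2]
  have hd1 : ∀ y ∈ Icc 0 τ, ‖F' y - F' m‖ ≤ B * τ := fun y hy =>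
    ((convex_Icc 0 τ).norm_image_sub_le_of_norm_hasDerivWithin_le h2 hB hm hy).trans
      (by gcongr; exact habs y hy)
  have hd2 : ∀ y ∈ Icc 0 τ, HasDerivWithinAt (fun y => F y - (y - m) • F' m) (F' y - F' m)
      (Icc 0 τ) y := fun y hy => by
    have := (h1 y hy).sub ((((hasDerivAt_id y).sub_const m).hasDerivWithinAt
      (s := Icc 0 τ)).smul_const (F' m))
    simpa using! this
  have := ((convex_Icc 0 τ).norm_image_sub_le_of_norm_hasDerivWithin_le hd2 hd1 hm hx).trans
    (mul_le_mul_of_nonneg_left (habs x hx) (by positivity))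
  calc _ = ‖(F x - (x - m) • F' m) - (F m - (m - m) • F' m)‖ := by congr 1; simp; abel
    _ ≤ B * τ * τ := this
    _ = _ := by ring

/-- The error of the midpoint rule. -/
theorem norm_midpoint_le {τ B : ℝ} (hτ : 0 ≤ τ) {F F' F'' F''' : ℝ → E}
    (h1 : ∀ t ∈ Icc 0 τ, HasDerivWithinAt F (F' t) (Icc 0 τ) t)
    (h2 : ∀ t ∈ Icc 0 τ, HasDerivWithinAt F' (F'' t) (Icc 0 τ) t)
    (h3 : ∀ t ∈ Icc 0 τ, HasDerivWithinAt F'' (F''' t) (Icc 0 τ) t)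
    (hB : ∀ t ∈ Icc 0 τ, ‖F''' t‖ ≤ B) :
    ‖F τ - F 0 - τ • F' (τ / 2)‖ ≤ B * τ ^ 3 := by
  have hm : τ / 2 ∈ Icc 0 τ := ⟨by linarith, by linarith⟩
  -- The quadratic term about the midpoint takes the same value at both end points, so it drops out.
  have hd : ∀ y ∈ Icc 0 τ, HasDerivWithinAt
      (fun y => F y - (y - τ / 2) • F' (τ / 2) - ((y - τ / 2) ^ 2 / 2) • F'' (τ / 2))
      (F' y - F' (τ / 2) - (y - τ / 2) • F'' (τ / 2)) (Icc 0 τ) y := fun y hy => by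
    have e1 := (((hasDerivAt_id y).sub_const (τ / 2)).hasDerivWithinAt
      (s := Icc 0 τ)).smul_const (F' (τ / 2))
    have e2 := (((((hasDerivAt_id y).sub_const (τ / 2)).pow 2).div_const 2).hasDerivWithinAt
      (s := Icc 0 τ)).smul_const (F'' (τ / 2))
    refine (((h1 y hy).sub e1).sub e2).congr_deriv ?_
    simp
  have := (convex_Icc 0 τ).norm_image_sub_le_of_norm_hasDerivWithin_le hd
    (fun y hy => norm_taylor_one_le h2 h3 hB hm hy) (left_mem_Icc.2 hτ) (right_mem_Icc.2 hτ)
  calc _ = ‖(F τ - (τ - τ / 2) • F' (τ / 2) - ((τ - τ / 2) ^ 2 / 2) • F'' (τ / 2)) -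
        (F 0 - (0 - τ / 2) • F' (τ / 2) - ((0 - τ / 2) ^ 2 / 2) • F'' (τ / 2))‖ := by
        congr 1; module
    _ ≤ B * τ ^ 2 * ‖τ - 0‖ := this
    _ = _ := by rw [sub_zero, Real.norm_of_nonneg hτ]; ring

end Taylor

theorem phaseNorm_sub_le_of_deriv {m : ℕ} {τ : ℝ} {F F' : ℝ → L2} {B : ℝ≥0}
    (h1 : ∀ t ∈ Icc 0 τ, HasDerivWithinAt F (F' t) (Icc 0 τ) t)
    (hB : ∀ t ∈ Icc 0 τ, phaseNorm m (F' t) ≤ B) {x y : ℝ} (hx : x ∈ Icc 0 τ) (hy : y ∈ Icc 0 τ) :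
    phaseNorm m (F x - F y) ≤ ENNReal.ofReal (2 * (B * |x - y|)) := by
  refine phaseNorm_le_of_norm_testCLM fun i => ?_
  rw [map_sub]
  exact (convex_Icc 0 τ).norm_image_sub_le_of_norm_hasDerivWithin_le
    (fun t ht => hasDerivWithinAt_testCLM m i (h1 t ht))
    (fun t ht => norm_testCLM_le (hB t ht) i) hy hx

theorem testCLM_real_smul (m : ℕ) (i : Bool × ℕ) (c : ℝ) (f : L2) :
    testCLM m i (c • f) = c • testCLM m i f :=
  ((testCLM m i).restrictScalars ℝ).map_smul c f

theorem phaseNorm_taylor_one_le {k : ℕ} {τ : ℝ} {F F' F'' : ℝ → L2} {B : ℝ≥0}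
    (h1 : ∀ t ∈ Icc 0 τ, HasDerivWithinAt F (F' t) (Icc 0 τ) t)
    (h2 : ∀ t ∈ Icc 0 τ, HasDerivWithinAt F' (F'' t) (Icc 0 τ) t)
    (hB : ∀ t ∈ Icc 0 τ, phaseNorm k (F'' t) ≤ B) {m : ℝ} (hm : m ∈ Icc 0 τ) {x : ℝ}
    (hx : x ∈ Icc 0 τ) :
    phaseNorm k (F x - F m - (x - m) • F' m) ≤ ENNReal.ofReal (2 * (B * τ ^ 2)) := by
  refine phaseNorm_le_of_norm_testCLM fun i => ?_
  rw [map_sub, map_sub, testCLM_real_smul]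
  exact norm_taylor_one_le
    (fun t ht => hasDerivWithinAt_testCLM k i (h1 t ht))
    (fun t ht => hasDerivWithinAt_testCLM k i (h2 t ht))
    (fun t ht => norm_testCLM_le (hB t ht) i) hm hx

theorem phaseNorm_midpoint_le {k : ℕ} {τ : ℝ} (hτ : 0 ≤ τ) {F F' F'' F''' : ℝ → L2} {B : ℝ≥0}
    (h1 : ∀ t ∈ Icc 0 τ, HasDerivWithinAt F (F' t) (Icc 0 τ) t)
    (h2 : ∀ t ∈ Icc 0 τ, HasDerivWithinAt F' (F'' t) (Icc 0 τ) t)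
    (h3 : ∀ t ∈ Icc 0 τ, HasDerivWithinAt F'' (F''' t) (Icc 0 τ) t)
    (hB : ∀ t ∈ Icc 0 τ, phaseNorm k (F''' t) ≤ B) :
    phaseNorm k (F τ - F 0 - τ • F' (τ / 2)) ≤ ENNReal.ofReal (2 * (B * τ ^ 3)) := by
  refine phaseNorm_le_of_norm_testCLM fun i => ?_
  rw [map_sub, map_sub, testCLM_real_smul]
  exact norm_midpoint_le hτ
    (fun t ht => hasDerivWithinAt_testCLM k i (h1 t ht))
    (fun t ht => hasDerivWithinAt_testCLM k i (h2 t ht))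
    (fun t ht => hasDerivWithinAt_testCLM k i (h3 t ht))
    (fun t ht => norm_testCLM_le (hB t ht) i)

/-! ### Time derivatives in `L²` -/

/-- Differentiability in the form in which the squeeze arguments below use it. -/
theorem hasDerivWithinAt_iff_slope_sub {E : Type*} [NormedAddCommGroup E] [NormedSpace ℝ E]
    {F : ℝ → E} {F' : E} {s : Set ℝ} {t : ℝ} :
    HasDerivWithinAt F F' s t ↔ Tendsto (fun r => ‖slope F t r - F'‖) (𝓝[s \ {t}] t) (𝓝 0) := by
  rw [hasDerivWithinAt_iff_tendsto_slope, tendsto_iff_norm_sub_tendsto_zero]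

theorem enorm_mulL2_le {m : ℕ} (hm : 1 ≤ m) {f : L2} (hf : phaseNorm m f < ∞) (g : L2) :
    ‖mulL2 f g‖ₑ ≤ embConst * phaseNorm m f * ‖g‖ₑ := by
  rw [← weightNorm_zero_eq, ← weightNorm_zero_eq]
  exact weightNorm_mulL2_le hm hf 0 g

theorem norm_mulL2_le {m : ℕ} (hm : 1 ≤ m) {f : L2} {B : ℝ≥0} (hf : phaseNorm m f ≤ B) (g : L2) :
    ‖mulL2 f g‖ ≤ embConst.toReal * B * ‖g‖ := by
  have h := enorm_mulL2_le hm (hf.trans_lt ENNReal.coe_lt_top) g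
  have h2 : ‖mulL2 f g‖ₑ ≤ embConst * B * ‖g‖ₑ := h.trans (by gcongr)
  have h3 := ENNReal.toReal_mono (by have := embConst_lt_top.ne; finiteness) h2
  simpa using h3

theorem mulL2_add {m : ℕ} (hm : 1 ≤ m) {f : L2} (hf : phaseNorm m f < ∞) (g h : L2) :
    mulL2 f (g + h) = mulL2 f g + mulL2 f h := by
  refine Lp.ext ?_
  filter_upwards [coeFn_mulL2 hm hf (g + h), coeFn_mulL2 hm hf g, coeFn_mulL2 hm hf h,
    Lp.coeFn_add g h, Lp.coeFn_add (mulL2 f g) (mulL2 f h)] with x h1 h2 h3 h4 h5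
  rw [h1, h5, Pi.add_apply, h2, h3, h4, Pi.add_apply, mul_add]

theorem mulL2_sub {m : ℕ} (hm : 1 ≤ m) {f : L2} (hf : phaseNorm m f < ∞) (g h : L2) :
    mulL2 f (g - h) = mulL2 f g - mulL2 f h := by
  have := mulL2_add hm hf (g - h) h
  rw [sub_add_cancel] at this
  rw [this, add_sub_cancel_right]

theorem mulL2_smul {m : ℕ} (hm : 1 ≤ m) {f : L2} (hf : phaseNorm m f < ∞) (c : ℝ) (g : L2) :
    mulL2 f (c • g) = c • mulL2 f g := by
  refine Lp.ext ?_
  filter_upwards [coeFn_mulL2 hm hf (c • g), coeFn_mulL2 hm hf g,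
    Lp.coeFn_smul c g, Lp.coeFn_smul c (mulL2 f g)] with x h1 h2 h3 h4
  rw [h1, h4, Pi.smul_apply, h2, h3, Pi.smul_apply, mul_smul_comm]

/-- The product rule in `L²` for curves bounded in the phase space norm. -/
theorem hasDerivWithinAt_mulL2 {m : ℕ} (hm : 1 ≤ m) {a b : ℝ → L2} {a' b' : L2} {s : Set ℝ}
    {t : ℝ} (ht : t ∈ s) (ha : HasDerivWithinAt a a' s t) (hb : HasDerivWithinAt b b' s t) {B : ℝ≥0}
    (hat : phaseNorm m (a t) ≤ B) (hbt : ∀ r ∈ s, phaseNorm m (b r) ≤ B)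
    (ha' : phaseNorm m a' ≤ B) :
    HasDerivWithinAt (fun r => mulL2 (a r) (b r)) (mulL2 a' (b t) + mulL2 (a t) b') s t := by
  have hfin : ∀ {f : L2}, phaseNorm m f ≤ B → phaseNorm m f < ∞ := fun h =>
    h.trans_lt ENNReal.coe_lt_top
  rw [hasDerivWithinAt_iff_slope_sub] at ha hb ⊢
  have hbc : Tendsto (fun r => ‖b r - b t‖) (𝓝[s \ {t}] t) (𝓝 0) := by
    rw [← tendsto_iff_norm_sub_tendsto_zero]
    have := (hasDerivWithinAt_iff_slope_sub.2 hb).continuousWithinAt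
    exact this.mono_left (nhdsWithin_mono _ sdiff_subset)
  set K : ℝ := embConst.toReal * B with hK
  have hlim : Tendsto (fun r => K * ‖slope a t r - a'‖ + K * ‖b r - b t‖ + K * ‖slope b t r - b'‖)
      (𝓝[s \ {t}] t) (𝓝 0) := by
    simpa using ((ha.const_mul K).add (hbc.const_mul K)).add (hb.const_mul K)
  refine squeeze_zero' (Eventually.of_forall fun r => norm_nonneg _) ?_ hlim
  filter_upwards [self_mem_nhdsWithin] with r hr
  have hr0 : r - t ≠ 0 := sub_ne_zero.2 hr.2
  have e : slope (fun r => mulL2 (a r) (b r)) t r - (mulL2 a' (b t) + mulL2 (a t) b') =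
      mulL2 (b r) (slope a t r - a') + mulL2 a' (b r - b t) + mulL2 (a t) (slope b t r - b') := by
    have hbr := hfin (hbt r hr.1)
    have hbt' := hfin (hbt t ht)
    have hat' := hfin hat
    have hap := hfin ha'
    rw [mulL2_sub hm hbr, mulL2_sub hm hap, mulL2_sub hm hat']
    simp only [slope, vsub_eq_sub]
    rw [mulL2_smul hm hbr, mulL2_smul hm hat', mulL2_sub hm hbr, mulL2_sub hm hat',
      mulL2_comm (b r) (a r), mulL2_comm (b r) (a t), mulL2_comm (b r) a']
    module
  rw [e]
  refine (norm_add₃_le).trans ?_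
  gcongr
  · exact norm_mulL2_le hm (hbt r hr.1) _
  · exact norm_mulL2_le hm ha' _
  · exact norm_mulL2_le hm hat _

theorem hasDerivWithinAt_star {a : ℝ → L2} {a' : L2} {s : Set ℝ} {t : ℝ}
    (ha : HasDerivWithinAt a a' s t) : HasDerivWithinAt (fun r => star (a r)) (star a') s t := by
  rw [hasDerivWithinAt_iff_slope_sub] at ha ⊢
  refine ha.congr fun r => ?_
  have : slope (fun r => star (a r)) t r - star a' = star (slope a t r - a') := by
    refine Lp.ext ?_
    simp only [slope, vsub_eq_sub]
    filter_upwards [coeFn_star_ae ((r - t)⁻¹ • (a r - a t) - a'), coeFn_star_ae a',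
      coeFn_star_ae (a r), coeFn_star_ae (a t), Lp.coeFn_sub ((r - t)⁻¹ • (a r - a t)) a',
      Lp.coeFn_smul (r - t)⁻¹ (a r - a t), Lp.coeFn_sub (a r) (a t),
      Lp.coeFn_sub ((r - t)⁻¹ • (star (a r) - star (a t))) (star a'),
      Lp.coeFn_smul (r - t)⁻¹ (star (a r) - star (a t)),
      Lp.coeFn_sub (star (a r)) (star (a t))] with x h1 h2 h3 h4 h5 h6 h7 h8 h9 h10
    simp only [h1, h2, h3, h4, h5, h6, h7, h8, h9, h10, Pi.sub_apply, Pi.smul_apply]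
    simp
  rw [this]
  rw [Lp.norm_def, Lp.norm_def, eLpNorm_congr_ae (coeFn_star_ae _)]
  congr 1
  exact eLpNorm_congr_norm_ae (Eventually.of_forall fun x => by simp)

/-- Interpolation: the second derivative is controlled by the `L²` norm and a higher Sobolev norm. -/
theorem enorm_lap_le {R : ℝ} (hR : 1 ≤ R) (f : L2) :
    ‖lap f‖ₑ ≤ ENNReal.ofReal ((2 * Real.pi) ^ 2) *
      (ENNReal.ofReal (R ^ 2) * ‖f‖ₑ + ENNReal.ofReal R⁻¹ * weightNorm 3 (𝓕 f : L2)) := by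
  have hR0 : 0 < R := zero_lt_one.trans_le hR
  have h1 := weightNorm_fourier_lap_le 0 f
  have e1 : ‖𝓕 (lap f)‖ₑ = ‖lap f‖ₑ := enorm_eq_iff_norm_eq.2 (Lp.norm_fourier_eq _)
  have e2 : ‖(𝓕 f : L2)‖ₑ = ‖f‖ₑ := enorm_eq_iff_norm_eq.2 (Lp.norm_fourier_eq _)
  rw [weightNorm_zero_eq, e1, zero_add] at h1
  refine h1.trans ?_
  gcongr
  rw [← e2, ← weightNorm_zero_eq]
  have hm := (Lp.aestronglyMeasurable (𝓕 f : L2))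
  calc weightNorm 2 (𝓕 f : L2)
      ≤ eLpNorm (fun ξ => ((R ^ 2 : ℝ) : ℂ) * ((wt 0 ξ : ℂ) * (𝓕 f : L2) ξ) +
        ((R⁻¹ * wt 3 ξ * 1 : ℝ) : ℂ) * (𝓕 f : L2) ξ) 2 volume := by
        refine eLpNorm_mono fun ξ => ?_
        have : ((R ^ 2 : ℝ) : ℂ) * ((wt 0 ξ : ℂ) * (𝓕 f : L2) ξ) +
            ((R⁻¹ * wt 3 ξ * 1 : ℝ) : ℂ) * (𝓕 f : L2) ξ =
            ((R ^ 2 + R⁻¹ * wt 3 ξ : ℝ) : ℂ) * (𝓕 f : L2) ξ := by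
          simp [wt]; ring
        rw [this, norm_mul, norm_mul, Complex.norm_real, Complex.norm_real,
          Real.norm_of_nonneg (wt_pos 2 ξ).le, Real.norm_of_nonneg
          (add_nonneg (sq_nonneg R) (mul_nonneg (by positivity) (wt_pos 3 ξ).le))]
        gcongr
        unfold wt
        rcases le_total (1 + |ξ|) R with h | h
        · have : (1 + |ξ|) ^ 2 ≤ R ^ 2 := by gcongr
          have : 0 ≤ R⁻¹ * (1 + |ξ|) ^ 3 := by positivity
          linarith
        · have : (1 + |ξ|) ^ 2 ≤ R⁻¹ * (1 + |ξ|) ^ 3 := by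
            rw [inv_mul_eq_div, le_div_iff₀ hR0, pow_succ (1 + |ξ|) 2]
            gcongr
          nlinarith [sq_nonneg R]
    _ ≤ eLpNorm (fun ξ => ((R ^ 2 : ℝ) : ℂ) * ((wt 0 ξ : ℂ) * (𝓕 f : L2) ξ)) 2 volume +
        eLpNorm (fun ξ => ((R⁻¹ * wt 3 ξ * 1 : ℝ) : ℂ) * (𝓕 f : L2) ξ) 2 volume := by
        refine eLpNorm_add_le ?_ ?_ (by norm_num)
        · exact (aesm_wt_mul 0 hm).const_mul _
        · exact (by fun_prop : Continuous fun ξ =>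
            ((R⁻¹ * wt 3 ξ * 1 : ℝ) : ℂ)).aestronglyMeasurable.mul hm
    _ = _ := by
        congr 1
        · have := eLpNorm_const_smul ((R ^ 2 : ℝ) : ℂ) (fun ξ => (wt 0 ξ : ℂ) * (𝓕 f : L2) ξ) 2
            (volume : Measure ℝ)
          rw [← ofReal_norm, Complex.norm_real, Real.norm_of_nonneg (sq_nonneg R)] at this
          exact this
        · have := eLpNorm_const_smul ((R⁻¹ : ℝ) : ℂ) (fun ξ => (wt 3 ξ : ℂ) * (𝓕 f : L2) ξ) 2
            (volume : Measure ℝ)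
          rw [← ofReal_norm, Complex.norm_real, Real.norm_of_nonneg (by positivity)] at this
          rw [weightNorm, ← this]
          congr 1
          ext ξ
          simp only [Pi.smul_apply, smul_eq_mul]
          push_cast
          ring

theorem weightNorm_fourier_sub_lt_top {m : ℕ} {f g : L2} (hf : weightNorm m (𝓕 f : L2) < ∞)
    (hg : weightNorm m (𝓕 g : L2) < ∞) : weightNorm m (𝓕 (f - g) : L2) < ∞ := by
  rw [sub_eq_add_neg, FourierTransform.fourier_add]
  refine (weightNorm_add_le' m _ _).trans_lt (ENNReal.add_lt_top.2 ⟨hf, ?_⟩)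
  have : (-g : L2) = (-1 : ℂ) • g := by simp
  rw [this, FourierTransform.fourier_smul, weightNorm_smul]
  exact ENNReal.mul_lt_top (by simp) hg

theorem fourier_sub_L2 (f g : L2) : (𝓕 (f - g) : L2) = 𝓕 f - 𝓕 g :=
  (FourierTransform.fourierCLM ℂ L2).map_sub f g

theorem real_smul_L2 (c : ℝ) (f : L2) : c • f = (c : ℂ) • f := (algebraMap_smul ℂ c f).symm

theorem lap_sub {f g : L2} (hf : weightNorm 2 (𝓕 f : L2) < ∞)
    (hg : weightNorm 2 (𝓕 g : L2) < ∞) : lap (f - g) = lap f - lap g := by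
  have e := fourier_sub_L2 f g
  have : (𝓕 (lap (f - g)) : L2) = 𝓕 (lap f - lap g) := by
    rw [fourier_sub_L2]
    refine Lp.ext ?_
    filter_upwards [fourier_lap_ae (weightNorm_fourier_sub_lt_top hf hg), fourier_lap_ae hf,
      fourier_lap_ae hg, Lp.coeFn_sub (𝓕 f : L2) (𝓕 g), Lp.coeFn_sub (𝓕 (lap f) : L2) (𝓕 (lap g))]
      with x h1 h2 h3 h4 h5
    rw [h1]
    refine Eq.trans ?_ h5.symm
    rw [Pi.sub_apply, h2, h3, e, h4, Pi.sub_apply, mul_sub]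
  have h := congrArg (fun h : L2 => (𝓕⁻ h : L2)) this
  simpa only [FourierTransform.fourierInv_fourier_eq] using h

theorem lap_smul {f : L2} (hf : weightNorm 2 (𝓕 f : L2) < ∞) (c : ℝ) :
    lap (c • f) = c • lap f := by
  have hfin : weightNorm 2 (𝓕 ((c : ℂ) • f) : L2) < ∞ := by
    rw [FourierTransform.fourier_smul, weightNorm_smul]
    exact ENNReal.mul_lt_top (by simp) hf
  have : (𝓕 (lap ((c : ℂ) • f)) : L2) = 𝓕 ((c : ℂ) • lap f) := by
    rw [FourierTransform.fourier_smul (c : ℂ) (lap f)]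
    refine Lp.ext ?_
    filter_upwards [fourier_lap_ae hfin, fourier_lap_ae hf,
      Lp.coeFn_smul (c : ℂ) (𝓕 f : L2), Lp.coeFn_smul (c : ℂ) (𝓕 (lap f) : L2)] with x h1 h2 h3 h4
    rw [h1, h4, FourierTransform.fourier_smul, h3, Pi.smul_apply, Pi.smul_apply, h2, smul_eq_mul,
      smul_eq_mul]
    ring
  have h := congrArg (fun h : L2 => (𝓕⁻ h : L2)) this
  rw [real_smul_L2, real_smul_L2]
  simpa only [FourierTransform.fourierInv_fourier_eq] using h

theorem phaseNorm_real_smul (m : ℕ) (c : ℝ) (f : L2) :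
    phaseNorm m (c • f) = ENNReal.ofReal |c| * phaseNorm m f := by
  rw [real_smul_L2, phaseNorm_smul, ← ofReal_norm, Complex.norm_real, Real.norm_eq_abs]

/-- If a curve is differentiable in `L²` with a derivative that is bounded in a higher norm, then its
second space derivative is differentiable in `L²`. -/
theorem hasDerivWithinAt_lap {τ : ℝ} {a a' : ℝ → L2} {B : ℝ≥0}
    (ha : ∀ t ∈ Icc 0 τ, HasDerivWithinAt a (a' t) (Icc 0 τ) t)
    (hB : ∀ t ∈ Icc 0 τ, phaseNorm 3 (a t) ≤ B) (hB' : ∀ t ∈ Icc 0 τ, phaseNorm 3 (a' t) ≤ B)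
    {t : ℝ} (ht : t ∈ Icc 0 τ) :
    HasDerivWithinAt (fun r => lap (a r)) (lap (a' t)) (Icc 0 τ) t := by
  have hder := hasDerivWithinAt_iff_slope_sub.1 (ha t ht)
  have hfin : ∀ {f : L2}, phaseNorm 3 f ≤ B → weightNorm 2 (𝓕 f : L2) < ∞ := fun h =>
    ((weightNorm_mono (by norm_num) _).trans (weightNorm_fourier_le_phaseNorm 3 _)).trans_lt
      (h.trans_lt ENNReal.coe_lt_top)
  rw [hasDerivWithinAt_iff_slope_sub]
  have hslope : ∀ r ∈ Icc 0 τ \ {t}, phaseNorm 3 (slope a t r - a' t) ≤ (3 * B : ℝ≥0) := by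
    intro r hr
    have h1 := phaseNorm_sub_le_of_deriv ha hB' hr.1 ht
    have hr0 : 0 < |r - t| := abs_pos.2 (sub_ne_zero.2 hr.2)
    have h2 : phaseNorm 3 (slope a t r) ≤ (2 * B : ℝ≥0) := by
      simp only [slope, vsub_eq_sub]
      rw [phaseNorm_real_smul]
      calc _ ≤ ENNReal.ofReal |(r - t)⁻¹| * ENNReal.ofReal (2 * (B * |r - t|)) := by gcongr
        _ = ENNReal.ofReal (2 * B) := by
          rw [← ENNReal.ofReal_mul (abs_nonneg _), abs_inv]
          congr 1
          field_simp
        _ = _ := by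
          rw [ENNReal.ofReal_mul (by norm_num), ENNReal.ofReal_coe_nnreal]; simp
    calc phaseNorm 3 (slope a t r - a' t) ≤ phaseNorm 3 (slope a t r) + phaseNorm 3 (a' t) :=
          phaseNorm_sub_le _ _ _
      _ ≤ ((2 * B : ℝ≥0) : ℝ≥0∞) + B := add_le_add h2 (hB' t ht)
      _ = _ := by push_cast; ring
  have hfin' : ∀ r ∈ Icc 0 τ \ {t}, weightNorm 2 (𝓕 (slope a t r - a' t) : L2) < ∞ := fun r hr =>
    ((weightNorm_mono (by norm_num) _).trans (weightNorm_fourier_le_phaseNorm 3 _)).trans_lt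
      ((hslope r hr).trans_lt ENNReal.coe_lt_top)
  have hslope_lap : ∀ r ∈ Icc 0 τ \ {t},
      slope (fun r => lap (a r)) t r - lap (a' t) = lap (slope a t r - a' t) := by
    intro r hr
    have e1 := hfin (hB r hr.1)
    have e2 := hfin (hB t ht)
    have e3 := hfin (hB' t ht)
    have e4 := weightNorm_fourier_sub_lt_top e1 e2
    have e5 : weightNorm 2 (𝓕 (slope a t r) : L2) < ∞ := by
      simp only [slope, vsub_eq_sub]
      rw [real_smul_L2, FourierTransform.fourier_smul, weightNorm_smul]
      exact ENNReal.mul_lt_top (by simp) e4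
    rw [lap_sub e5 e3]
    simp only [slope, vsub_eq_sub]
    rw [lap_smul e4, lap_sub e1 e2]
  rw [Metric.tendsto_nhds]
  intro ε hε
  set P : ℝ := (2 * Real.pi) ^ 2 with hP
  have hP0 : 0 < P := by have := Real.pi_pos; positivity
  -- the frequency cutoff makes the high frequency part small, uniformly in `r`
  obtain ⟨R, hR1, hR⟩ : ∃ R : ℝ, 1 ≤ R ∧ P * (R⁻¹ * (3 * B)) < ε / 2 := by
    refine ⟨1 + 2 * (P * (3 * B)) / ε, by
      have : 0 ≤ 2 * (P * (3 * B)) / ε := by positivity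
      linarith, ?_⟩
    have : P * ((1 + 2 * (P * (3 * (B : ℝ))) / ε)⁻¹ * (3 * B)) =
        (P * (3 * B)) / (1 + 2 * (P * (3 * B)) / ε) := by rw [div_eq_mul_inv]; ring
    rw [this]
    have h0 : 0 ≤ P * (3 * (B : ℝ)) := by positivity
    generalize P * (3 * (B : ℝ)) = q at h0
    rw [div_lt_iff₀ (by positivity)]
    have : ε / 2 * (1 + 2 * q / ε) = ε / 2 + q := by field_simp
    linarith
  have hsm : ∀ᶠ r in 𝓝[Icc 0 τ \ {t}] t, P * (R ^ 2 * ‖slope a t r - a' t‖) < ε / 2 := by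
    have : Tendsto (fun r => P * (R ^ 2 * ‖slope a t r - a' t‖)) (𝓝[Icc 0 τ \ {t}] t) (𝓝 0) := by
      simpa using (hder.const_mul (R ^ 2)).const_mul P
    exact this.eventually_lt_const (half_pos hε)
  filter_upwards [hsm, self_mem_nhdsWithin] with r hr1 hr2
  rw [dist_zero_right, norm_norm, hslope_lap r hr2]
  have hR0 : 0 < R := zero_lt_one.trans_le hR1
  have h := enorm_lap_le hR1 (slope a t r - a' t)
  have h3 : ‖lap (slope a t r - a' t)‖ₑ ≤ ENNReal.ofReal P *
      (ENNReal.ofReal (R ^ 2) * ‖slope a t r - a' t‖ₑ + ENNReal.ofReal R⁻¹ * (3 * B : ℝ≥0)) := by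
    refine h.trans ?_
    gcongr
    exact (weightNorm_fourier_le_phaseNorm 3 _).trans (hslope r hr2)
  have h4 := ENNReal.toReal_mono (by finiteness) h3
  rw [toReal_enorm, ENNReal.toReal_mul, ENNReal.toReal_add (by finiteness) (by finiteness),
    ENNReal.toReal_mul, ENNReal.toReal_mul, toReal_enorm, ENNReal.toReal_ofReal hP0.le,
    ENNReal.toReal_ofReal (sq_nonneg R), ENNReal.toReal_ofReal (inv_nonneg.2 hR0.le),
    ENNReal.coe_toReal] at h4
  push_cast at h4
  linarith [mul_add P (R ^ 2 * ‖slope a t r - a' t‖) (R⁻¹ * (3 * (B : ℝ)))]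

/-! ### The free flow in time -/

/-- The free flow as a bounded operator. -/
def freeFlowCLM (t : ℝ) : L2 →L[ℂ] L2 :=
  FourierTransform.fourierInvCLM ℂ L2 ∘L
    mulCLM (freeSymbol t) (continuous_freeSymbol t) 1 (fun ξ => (norm_freeSymbol t ξ).le) ∘L
    FourierTransform.fourierCLM ℂ L2

theorem freeFlowCLM_apply (t : ℝ) (f : L2) : freeFlowCLM t f = freeFlow t f := by
  rw [freeFlow]
  change (𝓕⁻ (mulCLM (freeSymbol t) (continuous_freeSymbol t) 1
    (fun ξ => (norm_freeSymbol t ξ).le) (𝓕 f)) : L2) = _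
  congr 1

theorem freeFlow_sub (t : ℝ) (f g : L2) : freeFlow t (f - g) = freeFlow t f - freeFlow t g := by
  simp only [← freeFlowCLM_apply, map_sub]

theorem freeFlow_add (t : ℝ) (f g : L2) : freeFlow t (f + g) = freeFlow t f + freeFlow t g := by
  simp only [← freeFlowCLM_apply, map_add]

theorem freeFlow_smul (t : ℝ) (c : ℂ) (f : L2) : freeFlow t (c • f) = c • freeFlow t f := by
  simp only [← freeFlowCLM_apply, map_smul]

theorem freeFlow_real_smul (t c : ℝ) (f : L2) : freeFlow t (c • f) = c • freeFlow t f := by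
  rw [real_smul_L2, real_smul_L2, freeFlow_smul]

/-- Elements of `L²` are determined by their Fourier transforms. -/
theorem L2_eq_of_fourier_ae {f g : L2} (h : (𝓕 f : L2) =ᵐ[volume] (𝓕 g : L2)) : f = g := by
  have h1 : (𝓕 f : L2) = 𝓕 g := Lp.ext h
  have h := congrArg (fun h : L2 => (𝓕⁻ h : L2)) h1
  simpa only [FourierTransform.fourierInv_fourier_eq] using h

theorem norm_freeFlow (t : ℝ) (f : L2) : ‖freeFlow t f‖ = ‖f‖ := by
  rw [← Lp.norm_fourier_eq (freeFlow t f), ← Lp.norm_fourier_eq f, Lp.norm_def, Lp.norm_def,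
    eLpNorm_congr_ae (fourier_freeFlow_ae t f)]
  congr 1
  exact eLpNorm_congr_norm_ae (Eventually.of_forall fun x => by simp [norm_freeSymbol])

theorem freeFlow_freeFlow (s t : ℝ) (f : L2) :
    freeFlow s (freeFlow t f) = freeFlow (s + t) f := by
  refine L2_eq_of_fourier_ae ?_
  filter_upwards [fourier_freeFlow_ae s (freeFlow t f), fourier_freeFlow_ae t f,
    fourier_freeFlow_ae (s + t) f] with x h1 h2 h3
  rw [h1, h2, h3, ← mul_assoc, freeSymbol, freeSymbol, freeSymbol, ← Complex.exp_add]
  congr 2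
  push_cast
  ring

theorem freeFlow_zero (f : L2) : freeFlow 0 f = f := by
  refine L2_eq_of_fourier_ae ?_
  filter_upwards [fourier_freeFlow_ae 0 f] with x h
  rw [h]; simp [freeSymbol]

/-- Dominated convergence for Fourier multipliers. -/
theorem tendsto_eLpNorm_mul {ι : Type*} {l : Filter ι} [l.IsCountablyGenerated] {n : ℕ} {K : ℝ}
    {φ : ι → ℝ → ℂ} (hφ : ∀ i, Continuous (φ i)) (hK : ∀ᶠ i in l, ∀ ξ, ‖φ i ξ‖ ≤ K * wt n ξ)
    (hlim : ∀ ξ, Tendsto (fun i => φ i ξ) l (𝓝 0)) {F : ℝ → ℂ} (hF : StronglyMeasurable F)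
    (hFn : weightNorm n F < ∞) :
    Tendsto (fun i => eLpNorm (fun ξ => φ i ξ * F ξ) 2 volume) l (𝓝 0) := by
  have h : Tendsto (fun i => ∫⁻ ξ, ‖φ i ξ * F ξ‖ₑ ^ (2 : ℕ)) l (𝓝 (∫⁻ _ : ℝ, 0)) := by
    refine tendsto_lintegral_filter_of_dominated_convergence
      (fun ξ => ENNReal.ofReal K ^ (2 : ℕ) * (ENNReal.ofReal (wt n ξ) ^ (2 : ℕ) * ‖F ξ‖ₑ ^ (2 : ℕ)))
      ?_ ?_ ?_ ?_
    · exact Eventually.of_forall fun i =>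
        ((hφ i).measurable.mul hF.measurable).enorm.pow_const (2 : ℕ)
    · filter_upwards [hK] with i hi
      refine Eventually.of_forall fun ξ => ?_
      rw [enorm_mul, mul_pow _ ‖F ξ‖ₑ, ← mul_assoc, ← mul_pow (ENNReal.ofReal K)]
      refine mul_le_mul_left (pow_le_pow_left₀ zero_le ?_ 2) _
      rw [← ofReal_norm, ← ENNReal.ofReal_mul' (wt_pos n ξ).le]
      exact ENNReal.ofReal_le_ofReal (hi ξ)
    · rw [lintegral_const_mul' _ _ (by finiteness), ← weightNorm_sq]
      have := hFn.ne
      finiteness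
    · refine Eventually.of_forall fun ξ => ?_
      have h1 : Tendsto (fun i => ‖φ i ξ * F ξ‖ ^ 2) l (𝓝 0) := by
        simpa using (((hlim ξ).mul_const (F ξ)).norm).pow 2
      have h2 := ENNReal.tendsto_ofReal h1
      simpa only [ENNReal.ofReal_pow (norm_nonneg _), ofReal_norm, ENNReal.ofReal_zero] using h2
  have h2 := h.ennrpow_const (1 / 2 : ℝ)
  simp only [← eLpNorm_two_sq] at h2
  have e1 : ∀ X : ℝ≥0∞, (X ^ 2) ^ (1 / 2 : ℝ) = X := fun X => by
    rw [← ENNReal.rpow_natCast, ← ENNReal.rpow_mul]; norm_num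
  simp only [e1, lintegral_zero] at h2
  rwa [ENNReal.zero_rpow_of_pos (by norm_num)] at h2

/-- The difference quotients of the symbol in time are bounded by the weight of order two. -/
theorem norm_freeSymbol_sub_one_le (t ξ : ℝ) :
    ‖freeSymbol t ξ - 1‖ ≤ |t| * (2 * Real.pi) ^ 2 * wt 2 ξ := by
  rw [freeSymbol, mul_comm]
  refine (Real.norm_exp_I_mul_ofReal_sub_one_le).trans ?_
  rw [Real.norm_eq_abs, abs_neg, abs_mul, mul_pow, abs_of_nonneg (by positivity : 0 ≤ (2 * Real.pi) ^ 2 * ξ ^ 2),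
    mul_assoc]
  gcongr
  rw [wt, ← sq_abs]
  gcongr
  linarith

theorem hasDerivAt_freeSymbol_zero (ξ : ℝ) :
    HasDerivAt (fun t => freeSymbol t ξ) (-((((2 * Real.pi * ξ) ^ 2 : ℝ) : ℂ) * Complex.I)) 0 := by
  have h1 : HasDerivAt (fun t : ℝ => -(t * (2 * Real.pi * ξ) ^ 2)) (-(2 * Real.pi * ξ) ^ 2) 0 := by
    refine (((hasDerivAt_id (0 : ℝ)).mul_const ((2 * Real.pi * ξ) ^ 2)).neg).congr_deriv ?_
    simp
  have h2 := (h1.ofReal_comp.mul_const Complex.I).cexp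
  simpa [freeSymbol] using h2

/-- The free flow is generated by `i∂_x²`. -/
theorem tendsto_freeFlow_slope {b : L2} (hb : weightNorm 2 (𝓕 b : L2) < ∞) :
    Tendsto (fun r : ℝ => ‖r⁻¹ • (freeFlow r b - b) - Complex.I • lap b‖) (𝓝[≠] 0) (𝓝 0) := by
  set φ : ℝ → ℝ → ℂ := fun r ξ => (r : ℂ)⁻¹ * (freeSymbol r ξ - 1) +
    (((2 * Real.pi * ξ) ^ 2 : ℝ) : ℂ) * Complex.I with hφ
  have hlim := tendsto_eLpNorm_mul (l := 𝓝[≠] (0 : ℝ)) (n := 2) (K := 2 * (2 * Real.pi) ^ 2) (φ := φ)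
    (F := ⇑(𝓕 b : L2))
    (fun r => by have := continuous_freeSymbol r; fun_prop) ?_ ?_
    (Lp.stronglyMeasurable _) hb
  · have h2 := (ENNReal.tendsto_toReal ENNReal.zero_ne_top).comp hlim
    refine h2.congr fun r => ?_
    rw [Function.comp_apply, ← Lp.norm_fourier_eq (r⁻¹ • _ - _), Lp.norm_def]
    congr 1
    refine eLpNorm_congr_ae ?_
    rw [fourier_sub_L2, real_smul_L2, FourierTransform.fourier_smul, FourierTransform.fourier_smul,
      fourier_sub_L2]
    filter_upwards [fourier_freeFlow_ae r b, fourier_lap_ae hb,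
      Lp.coeFn_sub (((r⁻¹ : ℝ) : ℂ) • ((𝓕 (freeFlow r b) : L2) - 𝓕 b)) (Complex.I • (𝓕 (lap b) : L2)),
      Lp.coeFn_smul (((r⁻¹ : ℝ) : ℂ)) ((𝓕 (freeFlow r b) : L2) - 𝓕 b),
      Lp.coeFn_smul Complex.I (𝓕 (lap b) : L2),
      Lp.coeFn_sub (𝓕 (freeFlow r b) : L2) (𝓕 b)] with ξ h1 h2 h3 h4 h5 h6
    simp only [h3, h4, h5, h6, h1, h2, Pi.sub_apply, Pi.smul_apply, hφ, smul_eq_mul]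
    push_cast
    ring
  · filter_upwards [self_mem_nhdsWithin] with r hr ξ
    have hr0 : |r| ≠ 0 := abs_ne_zero.2 hr
    refine (norm_add_le _ _).trans ?_
    have e1 : ‖(r : ℂ)⁻¹ * (freeSymbol r ξ - 1)‖ ≤ (2 * Real.pi) ^ 2 * wt 2 ξ := by
      rw [norm_mul, norm_inv, Complex.norm_real, Real.norm_eq_abs]
      calc _ ≤ |r|⁻¹ * (|r| * (2 * Real.pi) ^ 2 * wt 2 ξ) := by
            gcongr
            exact norm_freeSymbol_sub_one_le r ξ
        _ = _ := by field_simp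
    have e2 : ‖(((2 * Real.pi * ξ) ^ 2 : ℝ) : ℂ) * Complex.I‖ ≤ (2 * Real.pi) ^ 2 * wt 2 ξ := by
      rw [norm_mul, Complex.norm_I, mul_one, Complex.norm_real, Real.norm_eq_abs, mul_pow,
        abs_of_nonneg (by positivity)]
      gcongr
      rw [wt, ← sq_abs]
      gcongr
      linarith
    linarith
  · intro ξ
    have h := (hasDerivAt_freeSymbol_zero ξ).tendsto_slope_zero
    have h2 := h.add_const ((((2 * Real.pi * ξ) ^ 2 : ℝ) : ℂ) * Complex.I)
    rw [neg_add_cancel] at h2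
    refine h2.congr fun r => ?_
    simp [hφ, freeSymbol, Complex.real_smul]

/-- The free flow is strongly continuous. -/
theorem tendsto_freeFlow_sub (g : L2) :
    Tendsto (fun r : ℝ => ‖freeFlow r g - g‖) (𝓝 0) (𝓝 0) := by
  have hlim := tendsto_eLpNorm_mul (l := 𝓝 (0 : ℝ)) (n := 0) (K := 2)
    (φ := fun r ξ => freeSymbol r ξ - 1) (F := ⇑(𝓕 g : L2))
    (fun r => by have := continuous_freeSymbol r; fun_prop) ?_ ?_
    (Lp.stronglyMeasurable _) (by rw [weightNorm_zero_eq]; finiteness)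
  · have h2 := (ENNReal.tendsto_toReal ENNReal.zero_ne_top).comp hlim
    refine h2.congr fun r => ?_
    rw [Function.comp_apply, ← Lp.norm_fourier_eq (freeFlow r g - g), Lp.norm_def]
    congr 1
    refine eLpNorm_congr_ae ?_
    rw [fourier_sub_L2]
    filter_upwards [fourier_freeFlow_ae r g, Lp.coeFn_sub (𝓕 (freeFlow r g) : L2) (𝓕 g)] with ξ h1 h2
    rw [h2, Pi.sub_apply, h1]
    ring
  · refine Eventually.of_forall fun r ξ => ?_
    refine (norm_sub_le _ _).trans ?_
    simp [norm_freeSymbol, wt]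
    norm_num
  · intro ξ
    have h := (hasDerivAt_freeSymbol_zero ξ).continuousAt.tendsto.sub_const 1
    simpa [freeSymbol] using h

/-- The derivative of a curve conjugated by the free flow (interaction picture). -/
theorem hasDerivWithinAt_freeFlow {a : ℝ → L2} {a' : L2} {s : Set ℝ} {t c : ℝ}
    (ha : HasDerivWithinAt a a' s t) (hb : weightNorm 2 (𝓕 (a t) : L2) < ∞) :
    HasDerivWithinAt (fun r => freeFlow (c - r) (a r))
      (freeFlow (c - t) (a' - Complex.I • lap (a t))) s t := by
  have hder := hasDerivWithinAt_iff_slope_sub.1 ha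
  rw [hasDerivWithinAt_iff_slope_sub]
  have hsub : Tendsto (fun r => t - r) (𝓝[s \ {t}] t) (𝓝[≠] 0) := by
    refine tendsto_nhdsWithin_iff.2 ⟨?_, ?_⟩
    · have : Tendsto (fun r => t - r) (𝓝 t) (𝓝 (t - t)) := by
        exact tendsto_const_nhds.sub tendsto_id
      rw [sub_self] at this
      exact this.mono_left nhdsWithin_le_nhds
    · filter_upwards [self_mem_nhdsWithin] with r hr
      exact sub_ne_zero.2 (Ne.symm hr.2)
  have h1 := (tendsto_freeFlow_slope hb).comp hsub
  have h2 := (tendsto_freeFlow_sub a').comp (hsub.mono_right nhdsWithin_le_nhds)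
  have hlim := (hder.add h2).add h1
  rw [add_zero, add_zero] at hlim
  refine squeeze_zero' (Eventually.of_forall fun r => norm_nonneg _) ?_ hlim
  filter_upwards [self_mem_nhdsWithin] with r hr
  have hr0 : r - t ≠ 0 := sub_ne_zero.2 hr.2
  have e : slope (fun r => freeFlow (c - r) (a r)) t r -
      freeFlow (c - t) (a' - Complex.I • lap (a t)) =
      freeFlow (c - t) (freeFlow (t - r) (slope a t r - a') + (freeFlow (t - r) a' - a') -
        ((t - r)⁻¹ • (freeFlow (t - r) (a t) - a t) - Complex.I • lap (a t))) := by
    have e0 : freeFlow (c - r) (a r) = freeFlow (c - t) (freeFlow (t - r) (a r)) := by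
      rw [freeFlow_freeFlow]; congr 1; ring
    have e1 : (t - r)⁻¹ = -(r - t)⁻¹ := by rw [← inv_neg, neg_sub]
    simp only [slope, vsub_eq_sub]
    rw [e0, ← freeFlow_sub, ← freeFlow_real_smul, ← freeFlow_sub, e1]
    congr 1
    simp only [freeFlow_sub, freeFlow_real_smul]
    module
  rw [e, norm_freeFlow]
  refine (norm_sub_le _ _).trans (add_le_add ((norm_add_le _ _).trans ?_) le_rfl)
  rw [norm_freeFlow]
  rfl

/-! ### The norms of `Σ^k` and of phase space are equivalent -/

theorem sobolevNorm_eq (k : ℕ) (f : L2) : sobolevNorm k f =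
    eLpNorm (fun ξ : ℝ => ((√(1 + (2 * Real.pi * ξ) ^ 2) ^ k : ℝ) : ℂ) * (𝓕 f : L2) ξ) 2 volume := by
  rw [sobolevNorm]
  congr 1
  ext ξ
  congr 2
  rw [Real.sqrt_eq_rpow, ← Real.rpow_natCast _ k, ← Real.rpow_mul (by positivity)]
  congr 1
  ring

/-- Monotonicity of the weighted `L²` norm in the weight. -/
theorem eLpNorm_two_le_mul {f : ℝ → ℂ} {a b : ℝ → ℝ} {c : ℝ} (hc : 0 ≤ c) (ha : ∀ x, 0 ≤ a x)
    (h : ∀ x, a x ≤ c * b x) :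
    eLpNorm (fun x => (a x : ℂ) * f x) 2 volume ≤
      ENNReal.ofReal c * eLpNorm (fun x => (b x : ℂ) * f x) 2 volume := by
  refine eLpNorm_le_mul_eLpNorm_of_ae_le_mul (Eventually.of_forall fun x => ?_) _
  rw [norm_mul, norm_mul, Complex.norm_real, Complex.norm_real, ← mul_assoc, Real.norm_eq_abs,
    Real.norm_eq_abs, abs_of_nonneg (ha x)]
  refine mul_le_mul_of_nonneg_right ((h x).trans ?_) (norm_nonneg _)
  gcongr
  exact le_abs_self _

theorem weightNorm_fourier_le_sobolevNorm (k : ℕ) (f : L2) :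
    weightNorm k (𝓕 f : L2) ≤ ENNReal.ofReal (2 ^ k) * sobolevNorm k f := by
  rw [sobolevNorm_eq]
  refine eLpNorm_two_le_mul (by positivity) (fun x => (wt_pos k x).le) fun ξ => ?_
  rw [wt, ← mul_pow]
  gcongr
  have h1 : (1 : ℝ) ≤ √(1 + (2 * Real.pi * ξ) ^ 2) := Real.one_le_sqrt.2 (by nlinarith [sq_nonneg (2 * Real.pi * ξ)])
  have h2 : |ξ| ≤ √(1 + (2 * Real.pi * ξ) ^ 2) := by
    refine Real.abs_le_sqrt ?_
    have := Real.pi_gt_three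
    have h3 : (1 : ℝ) ≤ (2 * Real.pi) ^ 2 := by nlinarith
    rw [mul_pow]
    nlinarith [sq_nonneg ξ]
  linarith

theorem sobolevNorm_le (k : ℕ) (f : L2) :
    sobolevNorm k f ≤ ENNReal.ofReal ((2 * Real.pi) ^ k) * weightNorm k (𝓕 f : L2) := by
  rw [sobolevNorm_eq]
  refine eLpNorm_two_le_mul (by have := Real.pi_pos; positivity) (fun x => by positivity) fun ξ => ?_
  rw [wt, ← mul_pow]
  have h0 := Real.pi_gt_three
  gcongr
  refine Real.sqrt_le_iff.2 ⟨by positivity, ?_⟩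
  rw [mul_pow, mul_pow, ← sq_abs ξ]
  have h3 : (1 : ℝ) ≤ (2 * Real.pi) ^ 2 := by nlinarith
  nlinarith [abs_nonneg ξ]

theorem enorm_le_sobolevNorm (k : ℕ) (f : L2) : ‖f‖ₑ ≤ sobolevNorm k f := by
  have e2 : ‖(𝓕 f : L2)‖ₑ = ‖f‖ₑ := enorm_eq_iff_norm_eq.2 (Lp.norm_fourier_eq _)
  rw [← e2, sobolevNorm_eq, ← weightNorm_zero_eq]
  have := eLpNorm_two_le_mul (f := ⇑(𝓕 f : L2)) (a := wt 0)
    (b := fun ξ => √(1 + (2 * Real.pi * ξ) ^ 2) ^ k) (c := 1) zero_le_one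
    (fun x => (wt_pos 0 x).le) fun ξ => by
      rw [wt, pow_zero, one_mul]
      exact one_le_pow₀ (Real.one_le_sqrt.2 (by nlinarith [sq_nonneg (2 * Real.pi * ξ)]))
  rwa [ENNReal.ofReal_one, one_mul] at this

theorem weightNorm_le_sigmaNorm (k : ℕ) (f : L2) :
    weightNorm k f ≤ ENNReal.ofReal (2 ^ k) * sigmaNorm k f := by
  have h1 : weightNorm k f ≤ ENNReal.ofReal (2 ^ k) *
      eLpNorm (fun x : ℝ => ((1 + |x| ^ k : ℝ) : ℂ) * f x) 2 volume := by
    refine eLpNorm_two_le_mul (by positivity) (fun x => (wt_pos k x).le) fun x => ?_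
    have h := add_pow_le (zero_le_one) (abs_nonneg x) k
    rw [one_pow] at h
    refine h.trans ?_
    gcongr
    · norm_num
    · omega
  refine h1.trans ?_
  gcongr
  have e : (fun x : ℝ => ((1 + |x| ^ k : ℝ) : ℂ) * f x) =
      (⇑f + fun x : ℝ => ((|x| ^ k : ℝ) : ℂ) * f x) := by
    ext x; simp [add_mul]
  rw [e, sigmaNorm]
  refine (eLpNorm_add_le (Lp.aestronglyMeasurable f) ?_ one_le_two).trans ?_
  · exact (by fun_prop : Continuous fun x : ℝ => ((|x| ^ k : ℝ) : ℂ)).aestronglyMeasurable.mul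
      (Lp.aestronglyMeasurable f)
  · gcongr
    rw [← Lp.enorm_def]
    exact enorm_le_sobolevNorm k f

theorem phaseNorm_le_sigmaNorm (k : ℕ) (f : L2) :
    phaseNorm k f ≤ (2 * 2 ^ k : ℝ≥0) * sigmaNorm k f := by
  have h1 : sobolevNorm k f ≤ sigmaNorm k f := le_self_add
  have h2 := (weightNorm_fourier_le_sobolevNorm k f).trans (mul_le_mul_right h1 _)
  refine (add_le_add (weightNorm_le_sigmaNorm k f) h2).trans (le_of_eq ?_)
  rw [ENNReal.ofReal_pow zero_le_two, ENNReal.ofReal_ofNat]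
  push_cast
  ring

theorem sigmaNorm_le_phaseNorm (k : ℕ) (f : L2) :
    sigmaNorm k f ≤ ENNReal.ofReal ((2 * Real.pi) ^ k) * phaseNorm k f := by
  rw [sigmaNorm, phaseNorm, mul_add, add_comm]
  gcongr
  · refine eLpNorm_two_le_mul (by have := Real.pi_pos; positivity) (fun x => by positivity)
      fun x => ?_
    rw [wt, ← mul_pow]
    have := Real.pi_gt_three
    gcongr
    nlinarith [abs_nonneg x]
  · exact sobolevNorm_le k f

/-! ### The distributional second derivative -/

theorem eq_of_toTemperedDistribution_eq {f g : L2} (h : (f : 𝓢'(ℝ, ℂ)) = (g : 𝓢'(ℝ, ℂ))) : f = g := by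
  have hk := LinearMap.ker_eq_bot.1
    (Lp.ker_toTemperedDistributionCLM_eq_bot (F := ℂ) (μ := (volume : Measure ℝ)) (p := 2))
  exact hk h

/-- On functions of Sobolev regularity two, the distributional second derivative is `lap`. -/
theorem eq_lap_of_laplacian_eq {f g : L2} (hf : weightNorm 2 (𝓕 f : L2) < ∞)
    (h : (g : 𝓢'(ℝ, ℂ)) = Δ (f : 𝓢'(ℝ, ℂ))) : g = lap f := by
  refine L2_eq_of_fourier_ae (Eq.eventuallyEq (congrArg (fun h : L2 => ⇑h) ?_))
  refine eq_of_toTemperedDistribution_eq ?_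
  rw [← Lp.fourier_toTemperedDistribution_eq, h,
    TemperedDistribution.laplacian_eq_fourierMultiplierCLM,
    TemperedDistribution.fourierMultiplierCLM_apply]
  ext φ
  rw [← Complex.coe_smul, FourierTransform.fourier_smul, FourierTransform.fourier_fourierInv_eq]
  rw [Lp.fourier_toTemperedDistribution_eq]
  change ((-(2 * Real.pi) ^ 2 : ℝ) : ℂ) • (TemperedDistribution.smulLeftCLM ℂ (fun x : ℝ => Complex.ofReal (‖x‖ ^ 2))
    ((𝓕 f : L2) : 𝓢'(ℝ, ℂ)) φ) = _
  rw [TemperedDistribution.smulLeftCLM_apply_apply, Lp.toTemperedDistribution_apply,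
    Lp.toTemperedDistribution_apply, ← integral_smul]
  refine integral_congr_ae ?_
  filter_upwards [fourier_lap_ae hf] with ξ h1
  rw [h1, SchwartzMap.smulLeftCLM_apply_apply (by fun_prop)]
  simp only [smul_eq_mul, Real.norm_eq_abs, sq_abs]
  push_cast
  ring

/-! ### Families of curves with uniform regularity -/

section Families

variable {ι : Type*} {τ : ι → ℝ} {k : ℕ}

/-- A family of curves `a i : [0, τ i] → L²` is bounded in the phase space norm of order `m`,
uniformly in time and in the index. -/
def Bdd (τ : ι → ℝ) (m : ℕ) (a : ι → ℝ → L2) : Prop :=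
  ∃ B : ℝ≥0, ∀ i, ∀ t ∈ Icc 0 (τ i), phaseNorm m (a i t) ≤ B

/-- The curves `a i` have the time derivatives `a' i` in `L²` on `[0, τ i]`. -/
def IsDer (τ : ι → ℝ) (a a' : ι → ℝ → L2) : Prop :=
  ∀ i, ∀ t ∈ Icc 0 (τ i), HasDerivWithinAt (a i) (a' i t) (Icc 0 (τ i)) t

/-- `r` time derivatives exist, each costing two orders in the scale of phase space norms, and the
last one is still bounded in the norm of order `k`. -/
def Reg (τ : ι → ℝ) (k : ℕ) : ℕ → (ι → ℝ → L2) → Prop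
  | 0, a => Bdd τ k a
  | r + 1, a => Bdd τ (k + 2 * (r + 1)) a ∧ ∃ a', IsDer τ a a' ∧ Reg τ k r a'

theorem Bdd.mono {m n : ℕ} (h : m ≤ n) {a : ι → ℝ → L2} (ha : Bdd τ n a) : Bdd τ m a := by
  obtain ⟨B, hB⟩ := ha
  exact ⟨B, fun i t ht => (phaseNorm_mono h _).trans (hB i t ht)⟩

theorem Bdd.add {m : ℕ} {a b : ι → ℝ → L2} (ha : Bdd τ m a) (hb : Bdd τ m b) :
    Bdd τ m (fun i t => a i t + b i t) := by
  obtain ⟨A, hA⟩ := ha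
  obtain ⟨B, hB⟩ := hb
  refine ⟨A + B, fun i t ht => (phaseNorm_add_le _ _ _).trans ?_⟩
  rw [ENNReal.coe_add]
  exact add_le_add (hA i t ht) (hB i t ht)

theorem Bdd.smul {m : ℕ} (c : ℂ) {a : ι → ℝ → L2} (ha : Bdd τ m a) :
    Bdd τ m (fun i t => c • a i t) := by
  obtain ⟨A, hA⟩ := ha
  refine ⟨‖c‖₊ * A, fun i t ht => ?_⟩
  rw [phaseNorm_smul, ENNReal.coe_mul]
  exact mul_le_mul_right (hA i t ht) _

theorem Bdd.mul {m : ℕ} (hm : 1 ≤ m) {a b : ι → ℝ → L2} (ha : Bdd τ m a) (hb : Bdd τ m b) :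
    Bdd τ m (fun i t => mulL2 (a i t) (b i t)) := by
  obtain ⟨A, hA⟩ := ha
  obtain ⟨B, hB⟩ := hb
  obtain ⟨C, hC⟩ := exists_phaseNorm_mulL2_le hm
  refine ⟨C * (A * B), fun i t ht => (hC _ _ ((hA i t ht).trans_lt ENNReal.coe_lt_top)
    ((hB i t ht).trans_lt ENNReal.coe_lt_top)).trans ?_⟩
  push_cast
  gcongr
  · exact hA i t ht
  · exact hB i t ht

theorem Bdd.star {m : ℕ} (hm : 1 ≤ m) {a : ι → ℝ → L2} (ha : Bdd τ m a) :
    Bdd τ m (fun i t => star (a i t)) := by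
  obtain ⟨A, hA⟩ := ha
  refine ⟨A, fun i t ht => ?_⟩
  rw [phaseNorm_star hm ((hA i t ht).trans_lt ENNReal.coe_lt_top)]
  exact hA i t ht

theorem Bdd.lap {m : ℕ} (hm : 1 ≤ m) {a : ι → ℝ → L2} (ha : Bdd τ (m + 2) a) :
    Bdd τ m (fun i t => lap (a i t)) := by
  obtain ⟨A, hA⟩ := ha
  obtain ⟨C, hC⟩ := exists_phaseNorm_lap_le hm
  refine ⟨C * A, fun i t ht => (hC _).trans ?_⟩
  rw [ENNReal.coe_mul]
  exact mul_le_mul_right (hA i t ht) _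

theorem Bdd.freeFlow {m : ℕ} (hm : 1 ≤ m) {T : ℝ} {c : ι → ℝ}
    (hc : ∀ i, ∀ t ∈ Icc 0 (τ i), |c i - t| ≤ T) {a : ι → ℝ → L2} (ha : Bdd τ m a) :
    Bdd τ m (fun i t => freeFlow (c i - t) (a i t)) := by
  obtain ⟨A, hA⟩ := ha
  obtain ⟨C, hC⟩ := exists_phaseNorm_freeFlow_le hm T
  refine ⟨C * A, fun i t ht => (hC _ (hc i t ht) _).trans ?_⟩
  rw [ENNReal.coe_mul]
  exact mul_le_mul_right (hA i t ht) _

theorem Bdd.weightNorm_lt_top {m : ℕ} (hm : 2 ≤ m) {a : ι → ℝ → L2} (ha : Bdd τ m a) (i : ι) {t : ℝ}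
    (ht : t ∈ Icc 0 (τ i)) : weightNorm 2 (𝓕 (a i t) : L2) < ∞ := by
  obtain ⟨A, hA⟩ := ha
  exact ((weightNorm_mono hm _).trans (weightNorm_fourier_le_phaseNorm m _)).trans_lt
    ((hA i t ht).trans_lt ENNReal.coe_lt_top)

theorem IsDer.add {a b a' b' : ι → ℝ → L2} (ha : IsDer τ a a') (hb : IsDer τ b b') :
    IsDer τ (fun i t => a i t + b i t) (fun i t => a' i t + b' i t) :=
  fun i t ht => (ha i t ht).add (hb i t ht)

theorem IsDer.smul (c : ℂ) {a a' : ι → ℝ → L2} (ha : IsDer τ a a') :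
    IsDer τ (fun i t => c • a i t) (fun i t => c • a' i t) :=
  fun i t ht => (ha i t ht).const_smul c

theorem IsDer.star {a a' : ι → ℝ → L2} (ha : IsDer τ a a') :
    IsDer τ (fun i t => star (a i t)) (fun i t => star (a' i t)) :=
  fun i t ht => hasDerivWithinAt_star (ha i t ht)

theorem IsDer.mul (hk : 1 ≤ k) {a b a' b' : ι → ℝ → L2} (ha : IsDer τ a a') (hb : IsDer τ b b')
    (hab : Bdd τ k a) (hbb : Bdd τ k b) (hab' : Bdd τ k a') :
    IsDer τ (fun i t => mulL2 (a i t) (b i t))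
      (fun i t => mulL2 (a' i t) (b i t) + mulL2 (a i t) (b' i t)) := by
  obtain ⟨A, hA⟩ := hab
  obtain ⟨B, hB⟩ := hbb
  obtain ⟨A', hA'⟩ := hab'
  have h1 : (A : ℝ≥0∞) ≤ (A + B + A' : ℝ≥0) := by exact_mod_cast (le_self_add.trans le_self_add)
  have h2 : (B : ℝ≥0∞) ≤ (A + B + A' : ℝ≥0) := by exact_mod_cast (le_add_self.trans le_self_add)
  have h3 : (A' : ℝ≥0∞) ≤ (A + B + A' : ℝ≥0) := by exact_mod_cast le_add_self
  exact fun i t ht => hasDerivWithinAt_mulL2 hk ht (ha i t ht) (hb i t ht) ((hA i t ht).trans h1)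
    (fun r hr => (hB i r hr).trans h2) ((hA' i t ht).trans h3)

theorem IsDer.lap {m : ℕ} (hm : 3 ≤ m) {a a' : ι → ℝ → L2} (ha : IsDer τ a a') (hb : Bdd τ m a)
    (hb' : Bdd τ m a') : IsDer τ (fun i t => lap (a i t)) (fun i t => lap (a' i t)) := by
  obtain ⟨A, hA⟩ := hb.mono hm
  obtain ⟨B, hB⟩ := hb'.mono hm
  have h1 : (A : ℝ≥0∞) ≤ (A + B : ℝ≥0) := by exact_mod_cast le_self_add
  have h2 : (B : ℝ≥0∞) ≤ (A + B : ℝ≥0) := by exact_mod_cast le_add_self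
  exact fun i t ht => hasDerivWithinAt_lap (ha i) (fun t ht => (hA i t ht).trans h1)
    (fun t ht => (hB i t ht).trans h2) ht

theorem Reg.bdd {r : ℕ} {a : ι → ℝ → L2} (h : Reg τ k r a) : Bdd τ (k + 2 * r) a := by
  cases r with
  | zero => exact h
  | succ r => exact h.1

theorem Reg.bdd_base {r : ℕ} {a : ι → ℝ → L2} (h : Reg τ k r a) : Bdd τ k a :=
  h.bdd.mono (by omega)

theorem Reg.pred {r : ℕ} {a : ι → ℝ → L2} (h : Reg τ k (r + 1) a) : Reg τ k r a := by
  induction r generalizing a with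
  | zero => exact h.bdd_base
  | succ r ih =>
    obtain ⟨h1, a', h2, h3⟩ := h
    exact ⟨h1.mono (by omega), a', h2, ih h3⟩

/-- One time derivative may be traded for two orders of the phase space norm. -/
theorem Reg.trade {r : ℕ} {a : ι → ℝ → L2} (h : Reg τ k (r + 1) a) : Reg τ (k + 2) r a := by
  induction r generalizing a with
  | zero => exact h.1
  | succ r ih =>
    obtain ⟨h1, a', h2, h3⟩ := h
    exact ⟨h1.mono (by omega), a', h2, ih h3⟩

theorem Reg.mono_base {l r : ℕ} (hkl : k ≤ l) {a : ι → ℝ → L2} (h : Reg τ l r a) : Reg τ k r a := by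
  induction r generalizing a with
  | zero => exact h.bdd_base.mono hkl
  | succ r ih =>
    obtain ⟨h1, a', h2, h3⟩ := h
    exact ⟨h1.mono (by omega), a', h2, ih h3⟩

theorem Reg.add {r : ℕ} {a b : ι → ℝ → L2} (ha : Reg τ k r a) (hb : Reg τ k r b) :
    Reg τ k r (fun i t => a i t + b i t) := by
  induction r generalizing a b with
  | zero => exact Bdd.add ha hb
  | succ r ih =>
    obtain ⟨h1, a', h2, h3⟩ := ha
    obtain ⟨h4, b', h5, h6⟩ := hb
    exact ⟨h1.add h4, _, h2.add h5, ih h3 h6⟩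

theorem Reg.smul (c : ℂ) {r : ℕ} {a : ι → ℝ → L2} (ha : Reg τ k r a) :
    Reg τ k r (fun i t => c • a i t) := by
  induction r generalizing a with
  | zero => exact Bdd.smul c ha
  | succ r ih =>
    obtain ⟨h1, a', h2, h3⟩ := ha
    exact ⟨h1.smul c, _, h2.smul c, ih h3⟩

theorem Reg.star (hk : 1 ≤ k) {r : ℕ} {a : ι → ℝ → L2} (ha : Reg τ k r a) :
    Reg τ k r (fun i t => star (a i t)) := by
  induction r generalizing a with
  | zero => exact Bdd.star hk ha
  | succ r ih =>
    obtain ⟨h1, a', h2, h3⟩ := ha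
    exact ⟨h1.star (by omega), _, h2.star, ih h3⟩

theorem Reg.mul (hk : 1 ≤ k) {r : ℕ} {a b : ι → ℝ → L2} (ha : Reg τ k r a) (hb : Reg τ k r b) :
    Reg τ k r (fun i t => mulL2 (a i t) (b i t)) := by
  induction r generalizing a b with
  | zero => exact Bdd.mul hk ha hb
  | succ r ih =>
    have ha0 := ha.pred
    have hb0 := hb.pred
    obtain ⟨h1, a', h2, h3⟩ := ha
    obtain ⟨h4, b', h5, h6⟩ := hb
    exact ⟨h1.mul (by omega) h4, _, h2.mul hk h5 ha0.bdd_base hb0.bdd_base h3.bdd_base,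
      (ih h3 hb0).add (ih ha0 h6)⟩

/-- Two orders of the norm are spent on the second derivative; the number of time derivatives is kept. -/
theorem Reg.lap (hk : 1 ≤ k) {r : ℕ} {a : ι → ℝ → L2} (ha : Reg τ (k + 2) r a) :
    Reg τ k r (fun i t => lap (a i t)) := by
  induction r generalizing a with
  | zero => exact Bdd.lap hk ha
  | succ r ih =>
    obtain ⟨h1, a', h2, h3⟩ := ha
    exact ⟨(h1.mono (by omega) : Bdd τ (k + 2 * (r + 1) + 2) a).lap (by omega), _,
      h2.lap (m := k + 2) (by omega) (h1.mono (by omega)) h3.bdd_base, ih h3⟩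

/-- In the interaction picture a time derivative is `e^{i(c - t)∂_x²}` of a curve whose regularity
index drops by one only. -/
theorem Reg.exists_isDer_freeFlow (hk : 1 ≤ k) (c : ι → ℝ) {r : ℕ} {a : ι → ℝ → L2}
    (ha : Reg τ k (r + 1) a) : ∃ b, Reg τ k r b ∧
      IsDer τ (fun i t => freeFlow (c i - t) (a i t)) (fun i t => freeFlow (c i - t) (b i t)) := by
  have hl := (ha.trade.lap hk).smul (-Complex.I)
  obtain ⟨h1, a', h2, h3⟩ := ha
  refine ⟨fun i t => a' i t + (-Complex.I) • CoupledNLS.lap (a i t), h3.add hl, fun i t ht => ?_⟩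
  have h := hasDerivWithinAt_freeFlow (c := c i) (h2 i t ht) (h1.weightNorm_lt_top (by omega) i ht)
  rwa [sub_eq_add_neg (a' i t), ← neg_smul] at h

/-- The nonlinearity `2u²v̄`. -/
def cubic (u v : L2) : L2 := (2 : ℂ) • mulL2 u (mulL2 u (star v))

theorem Reg.cubic (hk : 1 ≤ k) {r : ℕ} {u v : ι → ℝ → L2} (hu : Reg τ k r u) (hv : Reg τ k r v) :
    Reg τ k r (fun i t => cubic (u i t) (v i t)) :=
  (hu.mul hk (hu.mul hk (hv.star hk))).smul 2

/-- A solution that is bounded in the norm of order `k + 4` has two time derivatives. -/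
theorem reg_two_of_isDer (hk : 1 ≤ k) {c d : ℂ} {u v : ι → ℝ → L2} (hu : Bdd τ (k + 4) u)
    (hv : Bdd τ (k + 4) v)
    (hdu : IsDer τ u fun i t =>
      Complex.I • CoupledNLS.lap (u i t) + c • CoupledNLS.cubic (u i t) (v i t))
    (hdv : IsDer τ v fun i t =>
      Complex.I • CoupledNLS.lap (v i t) + d • CoupledNLS.cubic (v i t) (u i t)) :
    Reg τ k 2 u := by
  have hu2 : Reg τ (k + 2) 0 u := hu.mono (by omega)
  have hv2 : Reg τ (k + 2) 0 v := hv.mono (by omega)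
  have hul : Reg τ (k + 2) 0 (fun i t => CoupledNLS.lap (u i t)) := hu.lap (by omega)
  have hvl : Reg τ (k + 2) 0 (fun i t => CoupledNLS.lap (v i t)) := hv.lap (by omega)
  have hu1 : Reg τ (k + 2) 1 u :=
    ⟨hu, _, hdu, (hul.smul _).add ((hu2.cubic (by omega) hv2).smul _)⟩
  have hv1 : Reg τ (k + 2) 1 v :=
    ⟨hv, _, hdv, (hvl.smul _).add ((hv2.cubic (by omega) hu2).smul _)⟩
  exact ⟨hu, _, hdu, ((hu1.lap hk).smul _).add
    (((hu1.mono_base (by omega)).cubic hk (hv1.mono_base (by omega))).smul _)⟩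

end Families

/-! ### Absolutely convergent series and the exponential -/

theorem Lp_coeFn_sum_range (t : ℕ → L2) (N : ℕ) :
    ⇑(∑ n ∈ Finset.range N, t n) =ᵐ[volume] fun x => ∑ n ∈ Finset.range N, t n x := by
  induction N with
  | zero =>
    exact Eventually.of_forall fun x => by simp
  | succ N ih =>
    rw [Finset.sum_range_succ]
    filter_upwards [ih, Lp.coeFn_add (∑ n ∈ Finset.range N, t n) (t N)] with x h1 h2
    rw [h2, Pi.add_apply, h1, Finset.sum_range_succ]

/-- The phase space norms are countably subadditive on series that converge pointwise. -/
theorem exists_tsum_of_phaseNorm_le {k : ℕ} {t : ℕ → L2} {b : ℕ → ℝ≥0} (hb : Summable b)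
    (ht : ∀ n, phaseNorm k (t n) ≤ b n) {φ : ℝ → ℂ}
    (hφ : ∀ᵐ x, HasSum (fun n => t n x) (φ x)) :
    ∃ S : L2, S =ᵐ[volume] φ ∧ phaseNorm k S ≤ 2 * (∑' n, b n : ℝ≥0) := by
  have hbr : Summable fun n => (b n : ℝ) := NNReal.summable_coe.2 hb
  have hn : ∀ n, ‖t n‖ ≤ b n := fun n => by
    have := (enorm_le_phaseNorm k (t n)).trans (ht n)
    rwa [enorm_le_coe] at this
  have hs : Summable t := Summable.of_norm_bounded hbr hn
  refine ⟨∑' n, t n, ?_, phaseNorm_le_of_testCLM k fun i => ?_⟩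
  · obtain ⟨ns, hns, hlim⟩ :=
      (tendstoInMeasure_of_tendsto_Lp hs.hasSum.tendsto_sum_nat).exists_seq_tendsto_ae
    filter_upwards [hlim, hφ, ae_all_iff.2 (Lp_coeFn_sum_range t)] with x h1 h2 h3
    refine tendsto_nhds_unique h1 ?_
    simp only [h3]
    exact h2.tendsto_sum_nat.comp hns.tendsto_atTop
  · rw [ContinuousLinearMap.map_tsum _ hs, enorm_le_coe]
    have := tsum_of_norm_bounded hbr.hasSum fun n => norm_testCLM_le (ht n) i
    rw [← NNReal.coe_tsum] at this
    exact_mod_cast this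

/-- `w^n f` in `L²`. -/
def powMul (w f : L2) : ℕ → L2
  | 0 => f
  | n + 1 => mulL2 w (powMul w f n)

theorem coeFn_powMul {k : ℕ} (hk : 1 ≤ k) {w : L2} (hw : phaseNorm k w < ∞) (f : L2) (n : ℕ) :
    powMul w f n =ᵐ[volume] fun x => w x ^ n * f x := by
  induction n with
  | zero => exact Eventually.of_forall fun x => by simp [powMul]
  | succ n ih =>
    filter_upwards [ih, coeFn_mulL2 hk hw (powMul w f n)] with x h1 h2
    rw [powMul, h2, h1, pow_succ']
    ring

/-- The constant `C` is that of the algebra property of the phase space norm. -/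
theorem phaseNorm_powMul_le {k : ℕ} {C : ℝ≥0} (hC : ∀ f g : L2, phaseNorm k f < ∞ →
      phaseNorm k g < ∞ → phaseNorm k (mulL2 f g) ≤ C * (phaseNorm k f * phaseNorm k g))
    {w f : L2} {ω B : ℝ≥0} (hw : phaseNorm k w ≤ ω) (hf : phaseNorm k f ≤ B) (n : ℕ) :
    phaseNorm k (powMul w f n) ≤ ((C * ω) ^ n * B : ℝ≥0) := by
  induction n with
  | zero => simpa [powMul] using hf
  | succ n ih =>
    refine (hC _ _ (hw.trans_lt ENNReal.coe_lt_top) (ih.trans_lt ENNReal.coe_lt_top)).trans ?_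
    calc (C : ℝ≥0∞) * (phaseNorm k w * phaseNorm k (powMul w f n))
        ≤ C * (ω * ((C * ω) ^ n * B : ℝ≥0)) := by gcongr
      _ = _ := by push_cast; ring

theorem summable_pow_div_factorial (K : ℝ≥0) : Summable fun n : ℕ => K ^ n / (n.factorial : ℝ≥0) := by
  rw [← NNReal.summable_coe]
  push_cast
  exact Real.summable_pow_div_factorial K

/-- The remainder `(e^w - 1 - w - w²/2) f` is the series of the `w^n f / n!` with `n ≥ 3`; it is cubic in `w`,
with a constant that is uniform as long as `w` stays bounded in the phase space norm (by `K / C`). -/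
theorem exists_exp_remainder {k : ℕ} (hk : 1 ≤ k) : ∃ C : ℝ≥0, ∀ (K B ω : ℝ≥0) (w f : L2),
    phaseNorm k w ≤ ω → phaseNorm k f ≤ B → C * ω ≤ K →
    ∃ S : L2, S =ᵐ[volume] (fun x => (Complex.exp (w x) - 1 - w x - w x ^ 2 / 2) * f x) ∧
      phaseNorm k S ≤ 2 * ((C * ω) ^ 3 * B * ∑' n : ℕ, K ^ n / (n.factorial : ℝ≥0) : ℝ≥0) := by
  obtain ⟨C, hC⟩ := exists_phaseNorm_mulL2_le hk
  refine ⟨C, fun K B ω w f hw hf hK => ?_⟩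
  have hs := (summable_pow_div_factorial K).mul_left ((C * ω) ^ 3 * B)
  rw [← NNReal.tsum_mul_left]
  refine exists_tsum_of_phaseNorm_le (t := fun n => (((n + 3).factorial : ℂ)⁻¹) • powMul w f (n + 3))
    hs (fun n => ?_) ?_
  · rw [phaseNorm_smul]
    have h1 : ‖(((n + 3).factorial : ℂ)⁻¹)‖ₑ ≤ ((n.factorial : ℝ≥0)⁻¹ : ℝ≥0) := by
      rw [enorm_le_coe, ← NNReal.coe_le_coe, coe_nnnorm]
      push_cast
      rw [norm_inv, Complex.norm_natCast]
      gcongr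
      omega
    calc _ ≤ (((n.factorial : ℝ≥0)⁻¹ : ℝ≥0) : ℝ≥0∞) * ((C * ω) ^ (n + 3) * B : ℝ≥0) :=
          mul_le_mul' h1 (phaseNorm_powMul_le hC hw hf _)
      _ = ((C * ω) ^ 3 * B * ((C * ω) ^ n / (n.factorial : ℝ≥0)) : ℝ≥0) := by
          rw [← ENNReal.coe_mul]
          congr 1
          rw [div_eq_mul_inv]
          ring
      _ ≤ _ := by
          rw [ENNReal.coe_le_coe]
          gcongr
  · have hw' := hw.trans_lt ENNReal.coe_lt_top
    filter_upwards [ae_all_iff.2 fun n => coeFn_powMul hk hw' f n,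
      ae_all_iff.2 fun n : ℕ => Lp.coeFn_smul (((n + 3).factorial : ℂ)⁻¹) (powMul w f (n + 3))]
      with x h1 h2
    have h3 := NormedSpace.expSeries_div_hasSum_exp (w x)
    rw [← Complex.exp_eq_exp_ℂ, ← hasSum_nat_add_iff' 3] at h3
    have h4 := h3.mul_right (f x)
    have e1 : (fun n => (((n + 3).factorial : ℂ)⁻¹ • powMul w f (n + 3)) x) =
        fun n => w x ^ (n + 3) / ((n + 3).factorial : ℂ) * f x := by
      ext n
      rw [h2, Pi.smul_apply, h1, smul_eq_mul]
      ring
    have e2 : (Complex.exp (w x) - 1 - w x - w x ^ 2 / 2) * f x =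
        (Complex.exp (w x) - ∑ n ∈ Finset.range 3, w x ^ n / (n.factorial : ℂ)) * f x := by
      congr 1
      simp [Finset.sum_range_succ]
      ring
    rw [e1, e2]
    exact h4

/-! ### Powers of the step size -/

section Order

variable {ι : Type*} {τ : ι → ℝ} {k : ℕ}

/-- A family in `L²` is of order `τ^n` in the phase space norm of order `k`. -/
def Ord (τ : ι → ℝ) (k n : ℕ) (a : ι → L2) : Prop :=
  ∃ C : ℝ≥0, ∀ i, phaseNorm k (a i) ≤ C * ENNReal.ofReal (τ i) ^ n

/-- `Ord` for a family of functions rather than classes of functions, for pointwise algebra. -/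
def BigO (τ : ι → ℝ) (k n : ℕ) (φ : ι → ℝ → ℂ) : Prop :=
  ∃ a : ι → L2, Ord τ k n a ∧ ∀ i, a i =ᵐ[volume] φ i

theorem Ord.bigO {n : ℕ} {a : ι → L2} (h : Ord τ k n a) : BigO τ k n fun i => ⇑(a i) :=
  ⟨a, h, fun _ => ae_eq_rfl⟩

theorem BigO.congr {n : ℕ} {φ ψ : ι → ℝ → ℂ} (hφ : BigO τ k n φ) (h : ∀ i, φ i =ᵐ[volume] ψ i) :
    BigO τ k n ψ := by
  obtain ⟨a, ha, ha'⟩ := hφ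
  exact ⟨a, ha, fun i => (ha' i).trans (h i)⟩

theorem BigO.add {n : ℕ} {φ ψ : ι → ℝ → ℂ} (hφ : BigO τ k n φ) (hψ : BigO τ k n ψ) :
    BigO τ k n fun i x => φ i x + ψ i x := by
  obtain ⟨a, ⟨A, hA⟩, ha⟩ := hφ
  obtain ⟨b, ⟨B, hB⟩, hb⟩ := hψ
  refine ⟨fun i => a i + b i, ⟨A + B, fun i => (phaseNorm_add_le _ _ _).trans ?_⟩, fun i => ?_⟩
  · rw [ENNReal.coe_add, add_mul]
    exact add_le_add (hA i) (hB i)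
  · filter_upwards [ha i, hb i, Lp.coeFn_add (a i) (b i)] with x h1 h2 h3
    rw [h3, Pi.add_apply, h1, h2]

theorem BigO.const_mul (c : ℂ) {n : ℕ} {φ : ι → ℝ → ℂ} (hφ : BigO τ k n φ) :
    BigO τ k n fun i x => c * φ i x := by
  obtain ⟨a, ⟨A, hA⟩, ha⟩ := hφ
  refine ⟨fun i => c • a i, ⟨‖c‖₊ * A, fun i => ?_⟩, fun i => ?_⟩
  · rw [phaseNorm_smul, ENNReal.coe_mul, mul_assoc]
    exact mul_le_mul_right (hA i) _
  · filter_upwards [ha i, Lp.coeFn_smul c (a i)] with x h1 h2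
    rw [h2, Pi.smul_apply, h1, smul_eq_mul]

theorem BigO.sub {n : ℕ} {φ ψ : ι → ℝ → ℂ} (hφ : BigO τ k n φ) (hψ : BigO τ k n ψ) :
    BigO τ k n fun i x => φ i x - ψ i x := by
  simpa only [neg_one_mul, ← sub_eq_add_neg] using hφ.add (hψ.const_mul (-1))

theorem BigO.step_mul {n : ℕ} {φ : ι → ℝ → ℂ} (hτ : ∀ i, 0 ≤ τ i) (hφ : BigO τ k n φ) :
    BigO τ k (n + 1) fun i x => (τ i : ℂ) * φ i x := by
  obtain ⟨a, ⟨A, hA⟩, ha⟩ := hφ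
  refine ⟨fun i => (τ i : ℂ) • a i, ⟨A, fun i => ?_⟩, fun i => ?_⟩
  · rw [phaseNorm_smul, ← ofReal_norm, Complex.norm_real, Real.norm_of_nonneg (hτ i), pow_succ,
      ← mul_assoc, mul_comm]
    exact mul_le_mul_left (hA i) _
  · filter_upwards [ha i, Lp.coeFn_smul (τ i : ℂ) (a i)] with x h1 h2
    rw [h2, Pi.smul_apply, h1, smul_eq_mul]

theorem Ord.lt_top {n : ℕ} {a : ι → L2} (h : Ord τ k n a) (i : ι) : phaseNorm k (a i) < ∞ := by
  obtain ⟨C, hC⟩ := h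
  exact (hC i).trans_lt (by finiteness)

theorem BigO.mul (hk : 1 ≤ k) {n m : ℕ} {φ ψ : ι → ℝ → ℂ} (hφ : BigO τ k n φ)
    (hψ : BigO τ k m ψ) : BigO τ k (n + m) fun i x => φ i x * ψ i x := by
  obtain ⟨a, ha', ha⟩ := hφ
  obtain ⟨b, hb', hb⟩ := hψ
  have hta := ha'.lt_top
  have htb := hb'.lt_top
  obtain ⟨A, hA⟩ := ha'
  obtain ⟨B, hB⟩ := hb'
  obtain ⟨C, hC⟩ := exists_phaseNorm_mulL2_le hk
  refine ⟨fun i => mulL2 (a i) (b i), ⟨C * (A * B), fun i => (hC _ _ (hta i) (htb i)).trans ?_⟩,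
    fun i => ?_⟩
  · calc (C : ℝ≥0∞) * (phaseNorm k (a i) * phaseNorm k (b i))
        ≤ C * ((A * ENNReal.ofReal (τ i) ^ n) * (B * ENNReal.ofReal (τ i) ^ m)) := by
          gcongr
          · exact hA i
          · exact hB i
      _ = _ := by push_cast; ring
  · filter_upwards [ha i, hb i, coeFn_mulL2 hk (hta i) (b i)] with x h1 h2 h3
    rw [h3, h1, h2]

theorem BigO.conj (hk : 1 ≤ k) {n : ℕ} {φ : ι → ℝ → ℂ} (hφ : BigO τ k n φ) :
    BigO τ k n fun i x => conj (φ i x) := by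
  obtain ⟨a, ha', ha⟩ := hφ
  have hta := ha'.lt_top
  obtain ⟨A, hA⟩ := ha'
  refine ⟨fun i => star (a i), ⟨A, fun i => ?_⟩, fun i => ?_⟩
  · rw [phaseNorm_star hk (hta i)]
    exact hA i
  · filter_upwards [ha i, coeFn_star_ae (a i)] with x h1 h2
    rw [h2, h1]

/-- Taylor expansion of the exponential to second order. -/
theorem BigO.exp_remainder (hk : 1 ≤ k) {T : ℝ} (hT : ∀ i, τ i ≤ T) {w φ : ι → ℝ → ℂ}
    (hw : BigO τ k 1 w) (hφ : BigO τ k 0 φ) :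
    BigO τ k 3 fun i x => (Complex.exp (w i x) - 1 - w i x - w i x ^ 2 / 2) * φ i x := by
  obtain ⟨a, ⟨A, hA⟩, ha⟩ := hw
  obtain ⟨b, ⟨B, hB⟩, hb⟩ := hφ
  obtain ⟨C, hC⟩ := exists_exp_remainder hk
  have hA' : ∀ i, phaseNorm k (a i) ≤ (A * (τ i).toNNReal : ℝ≥0) := fun i => by
    simpa [ENNReal.ofReal] using hA i
  have hB' : ∀ i, phaseNorm k (b i) ≤ B := fun i => by simpa using hB i
  set K : ℝ≥0 := C * (A * T.toNNReal) with hK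
  choose S hS1 hS2 using fun i => hC K B _ (a i) (b i) (hA' i) (hB' i)
    (by rw [hK]; gcongr; exact hT i)
  refine ⟨S, ⟨2 * ((C * A) ^ 3 * B * ∑' n : ℕ, K ^ n / (n.factorial : ℝ≥0)), fun i =>
    (hS2 i).trans (le_of_eq ?_)⟩, fun i => ?_⟩
  · rw [ENNReal.ofReal]
    push_cast
    ring
  · filter_upwards [hS1 i, ha i, hb i] with x h1 h2 h3
    rw [h1, h2, h3]

end Order

/-! ### The local error -/

section Interaction

variable {ι : Type*} {τ : ι → ℝ} {k : ℕ}

theorem coeFn_cubic {m : ℕ} (hm : 1 ≤ m) {u : L2} (hu : phaseNorm m u < ∞) (v : L2) :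
    cubic u v =ᵐ[volume] fun x => 2 * u x ^ 2 * conj (v x) := by
  filter_upwards [Lp.coeFn_smul (2 : ℂ) (mulL2 u (mulL2 u (star v))), coeFn_mulL2 hm hu (star v),
    coeFn_mulL2 hm hu (mulL2 u (star v)), coeFn_star_ae v] with x h1 h2 h3 h4
  rw [cubic, h1, Pi.smul_apply, h3, h2, h4, smul_eq_mul]
  ring

/-- Expansion of a solution in the interaction picture: with `U(t) = e^{i(τ/2 - t)∂_x²} u(t)`, so that
`U(0) = e^{i(τ/2)∂_x²} u(0)` and `U(τ/2) = u(τ/2)`, the derivative of `U` at the midpoint is the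
nonlinearity `N` there, and midpoint rule and Taylor formula give the expansions. -/
theorem interaction_expansion (hk : 1 ≤ k) {T : ℝ} (hτ : ∀ i, 0 < τ i) (hT : ∀ i, τ i ≤ T)
    {u N : ι → ℝ → L2} (hu : Bdd τ (k + 2) u) (hN : Reg τ k 2 N)
    (hdu : IsDer τ u fun i t => Complex.I • lap (u i t) + N i t) :
    Ord τ k 0 (fun i => u i (τ i / 2)) ∧ Ord τ k 0 (fun i => freeFlow (τ i / 2) (u i 0)) ∧
    Ord τ k 1 (fun i => u i (τ i / 2) - freeFlow (τ i / 2) (u i 0)) ∧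
    Ord τ k 2 (fun i => u i (τ i / 2) - freeFlow (τ i / 2) (u i 0) - (τ i / 2) • N i (τ i / 2)) ∧
    Ord τ k 3 (fun i => freeFlow (-(τ i / 2)) (u i (τ i)) - freeFlow (τ i / 2) (u i 0) -
      τ i • N i (τ i / 2)) := by
  have hc : ∀ i, ∀ t ∈ Icc 0 (τ i), |τ i / 2 - t| ≤ T := fun i t ht => by
    rw [abs_le]
    constructor <;> linarith [hτ i, hT i, ht.1, ht.2]
  have h0 : ∀ i, (0 : ℝ) ∈ Icc 0 (τ i) := fun i => ⟨le_rfl, (hτ i).le⟩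
  have hm : ∀ i, τ i / 2 ∈ Icc 0 (τ i) := fun i => ⟨by linarith [hτ i], by linarith [hτ i]⟩
  have hd1 : IsDer τ (fun i t => freeFlow (τ i / 2 - t) (u i t))
      (fun i t => freeFlow (τ i / 2 - t) (N i t)) := fun i t ht => by
    have h := hasDerivWithinAt_freeFlow (c := τ i / 2) (hdu i t ht)
      (hu.weightNorm_lt_top (by omega) i ht)
    rwa [add_sub_cancel_left] at h
  obtain ⟨N1, hN1, hd2⟩ := hN.exists_isDer_freeFlow hk fun i => τ i / 2
  obtain ⟨N2, hN2, hd3⟩ := hN1.exists_isDer_freeFlow hk fun i => τ i / 2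
  obtain ⟨B0, hB0⟩ := (hu.mono (by omega : k ≤ k + 2)).freeFlow hk hc
  obtain ⟨B1, hB1⟩ := hN.bdd_base.freeFlow hk hc
  obtain ⟨B2, hB2⟩ := hN1.bdd_base.freeFlow hk hc
  obtain ⟨B3, hB3⟩ := hN2.bdd_base.freeFlow hk hc
  have e1 : ∀ i, freeFlow (τ i / 2 - τ i / 2) (u i (τ i / 2)) = u i (τ i / 2) := fun i => by
    rw [sub_self, freeFlow_zero]
  have e2 : ∀ i, freeFlow (τ i / 2 - τ i / 2) (N i (τ i / 2)) = N i (τ i / 2) := fun i => by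
    rw [sub_self, freeFlow_zero]
  have e3 : ∀ i, freeFlow (τ i / 2 - 0) (u i 0) = freeFlow (τ i / 2) (u i 0) := fun i => by
    rw [sub_zero]
  have hpow : ∀ (B : ℝ≥0) (i) (n : ℕ), ENNReal.ofReal (2 * (B * τ i ^ n)) =
      (2 * B : ℝ≥0) * ENNReal.ofReal (τ i) ^ n := fun B i n => by
    rw [ENNReal.ofReal_mul zero_le_two, ENNReal.ofReal_mul B.coe_nonneg, ENNReal.ofReal_coe_nnreal,
      ENNReal.ofReal_pow (hτ i).le, ENNReal.ofReal_ofNat, ENNReal.coe_mul, mul_assoc]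
    rfl
  refine ⟨⟨B0, fun i => ?_⟩, ⟨B0, fun i => ?_⟩, ⟨2 * B1, fun i => ?_⟩, ⟨2 * B2, fun i => ?_⟩,
    ⟨2 * B3, fun i => ?_⟩⟩
  · have h := hB0 i _ (hm i)
    simp only [e1] at h
    rwa [pow_zero, mul_one]
  · have h := hB0 i _ (h0 i)
    simp only [e3] at h
    rwa [pow_zero, mul_one]
  · have h := phaseNorm_sub_le_of_deriv (hd1 i) (hB1 i) (hm i) (h0 i)
    simp only [e1, e3] at h
    refine h.trans ?_
    rw [← hpow, pow_one]
    refine ENNReal.ofReal_le_ofReal ?_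
    gcongr
    rw [sub_zero, abs_of_pos (half_pos (hτ i))]
    exact (hm i).2
  · have h := phaseNorm_taylor_one_le (hd1 i) (hd2 i) (hB2 i) (hm i) (h0 i)
    simp only [e1, e2, e3] at h
    rw [hpow] at h
    refine le_of_eq_of_le ?_ h
    rw [← phaseNorm_neg]
    congr 1
    module
  · have h := phaseNorm_midpoint_le (hτ i).le (hd1 i) (hd2 i) (hd3 i) (hB3 i)
    simp only [e2, e3] at h
    rw [hpow] at h
    have e4 : τ i / 2 - τ i = -(τ i / 2) := by ring
    rwa [e4] at h

end Interaction

/-- `(u, v)` solves the system on `[0, τ]`, with the phase space norm of order `m` bounded by `M`. -/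
structure IsRegularSolution (m : ℕ) (M : ℝ≥0) (τ : ℝ) (u v : ℝ → L2) : Prop where
  bdd_fst : ∀ t ∈ Icc 0 τ, phaseNorm m (u t) ≤ M
  bdd_snd : ∀ t ∈ Icc 0 τ, phaseNorm m (v t) ≤ M
  deriv_fst : ∀ t ∈ Icc 0 τ,
    HasDerivWithinAt u (Complex.I • lap (u t) + cubic (u t) (v t)) (Icc 0 τ) t
  deriv_snd : ∀ t ∈ Icc 0 τ,
    HasDerivWithinAt v (Complex.I • lap (v t) + (-1 : ℂ) • cubic (v t) (u t)) (Icc 0 τ) t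

theorem IsSolutionOn.isRegularSolution {m : ℕ} (hm : 2 ≤ m) {M : ℝ≥0} {τ : ℝ} {u v : ℝ → L2}
    (h : IsSolutionOn τ u v) (hu : ∀ t ∈ Icc 0 τ, phaseNorm m (u t) ≤ M)
    (hv : ∀ t ∈ Icc 0 τ, phaseNorm m (v t) ≤ M) : IsRegularSolution m M τ u v := by
  have hfin : ∀ {f : L2}, phaseNorm m f ≤ M → weightNorm 2 (𝓕 f : L2) < ∞ := fun h =>
    ((weightNorm_mono hm _).trans (weightNorm_fourier_le_phaseNorm m _)).trans_lt
      (h.trans_lt ENNReal.coe_lt_top)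
  refine ⟨hu, hv, fun t ht => ?_, fun t ht => ?_⟩
  · obtain ⟨du, dv, uxx, vxx, h1, h2, h3, h4, h5, h6⟩ := h t ht
    rw [eq_lap_of_laplacian_eq (hfin (hu t ht)) h3] at h5
    convert h1 using 1
    refine Lp.ext ?_
    filter_upwards [h5, coeFn_cubic (by omega) ((hu t ht).trans_lt ENNReal.coe_lt_top) (v t),
      Lp.coeFn_add (Complex.I • lap (u t)) (cubic (u t) (v t)),
      Lp.coeFn_smul Complex.I (lap (u t))] with x g1 g2 g3 g4
    rw [g1, g3, Pi.add_apply, g4, g2, Pi.smul_apply, smul_eq_mul]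
  · obtain ⟨du, dv, uxx, vxx, h1, h2, h3, h4, h5, h6⟩ := h t ht
    rw [eq_lap_of_laplacian_eq (hfin (hv t ht)) h4] at h6
    convert h2 using 1
    refine Lp.ext ?_
    filter_upwards [h6, coeFn_cubic (by omega) ((hv t ht).trans_lt ENNReal.coe_lt_top) (u t),
      Lp.coeFn_add (Complex.I • lap (v t)) ((-1 : ℂ) • cubic (v t) (u t)),
      Lp.coeFn_smul Complex.I (lap (v t)), Lp.coeFn_smul (-1 : ℂ) (cubic (v t) (u t))]
      with x g1 g2 g3 g4 g5
    rw [g1, g3, Pi.add_apply, g4, g5, Pi.smul_apply, Pi.smul_apply, g2, smul_eq_mul, smul_eq_mul]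
    ring

/-- The system is invariant under `(u, v) ↦ (v, -u)`. -/
theorem IsRegularSolution.swap {m : ℕ} (hm : 2 ≤ m) {M : ℝ≥0} {τ : ℝ} {u v : ℝ → L2}
    (h : IsRegularSolution m M τ u v) : IsRegularSolution m M τ v (-u) := by
  have hb : ∀ t ∈ Icc 0 τ, phaseNorm m ((-u) t) ≤ M := fun t ht => by
    rw [Pi.neg_apply, phaseNorm_neg]
    exact h.bdd_fst t ht
  have hu := fun t ht => (h.bdd_fst t ht).trans_lt ENNReal.coe_lt_top
  have hu' := fun t ht => (hb t ht).trans_lt ENNReal.coe_lt_top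
  have hv := fun t ht => (h.bdd_snd t ht).trans_lt ENNReal.coe_lt_top
  refine ⟨h.bdd_snd, hb, fun t ht => ?_, fun t ht => ?_⟩
  · convert h.deriv_snd t ht using 2
    refine Lp.ext ?_
    filter_upwards [coeFn_cubic (by omega) (hv t ht) (u t), coeFn_cubic (by omega) (hv t ht) ((-u) t),
      Lp.coeFn_smul (-1 : ℂ) (cubic (v t) (u t)), Lp.coeFn_neg (u t)] with x g1 g2 g3 g4
    rw [g3, Pi.smul_apply, g1, g2, Pi.neg_apply, g4, Pi.neg_apply, map_neg, smul_eq_mul]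
    ring
  · refine (h.deriv_fst t ht).neg.congr_deriv ?_
    have e1 : lap ((-u) t) = -lap (u t) := by
      have h1 := lap_smul (((weightNorm_mono hm _).trans (weightNorm_fourier_le_phaseNorm m _)).trans_lt
        (hu t ht)) (-1)
      simpa using h1
    have e2 : cubic ((-u) t) (v t) = cubic (u t) (v t) := by
      refine Lp.ext ?_
      filter_upwards [coeFn_cubic (by omega) (hu t ht) (v t),
        coeFn_cubic (by omega) (hu' t ht) (v t), Lp.coeFn_neg (u t)] with x g1 g2 g4
      rw [g1, g2, Pi.neg_apply, g4, Pi.neg_apply]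
      ring
    rw [e1, e2]
    module

/-- The pointwise algebra behind third order: the second order Taylor polynomial of the nonlinear flow
with data `(F, G)` agrees with the midpoint rule, up to terms of order three. -/
theorem BigO.strang_algebra {ι : Type*} {τ : ι → ℝ} {k : ℕ} (hk : 1 ≤ k) {T : ℝ}
    (hτ : ∀ i, 0 ≤ τ i) (hT : ∀ i, τ i ≤ T) {P Q F G U : ι → ℝ → ℂ}
    (hP : BigO τ k 0 P) (hQ : BigO τ k 0 Q) (hF : BigO τ k 0 F) (hG : BigO τ k 0 G)
    (hu1 : BigO τ k 1 fun i x => P i x - F i x) (hv1 : BigO τ k 1 fun i x => Q i x - G i x)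
    (hu2 : BigO τ k 2 fun i x => P i x - F i x - τ i * (P i x ^ 2 * conj (Q i x)))
    (hv2 : BigO τ k 2 fun i x => Q i x - G i x + τ i * (Q i x ^ 2 * conj (P i x)))
    (hu3 : BigO τ k 3 fun i x => U i x - F i x - 2 * (τ i * (P i x ^ 2 * conj (Q i x)))) :
    BigO τ k 3 fun i x =>
      Complex.exp (2 * (τ i : ℂ) * F i x * conj (G i x)) * F i x - U i x := by
  have hG' := hG.conj hk
  have hQ' := hQ.conj hk
  have hF' := hF.conj hk
  have he : BigO τ k 1 fun i x => conj (Q i x) - conj (G i x) := by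
    simpa only [map_sub] using hv1.conj hk
  have he2 := hv2.conj hk
  -- the cubic terms at the midpoint differ from those of the data by one order
  have hA : BigO τ k 1 fun i x => P i x ^ 2 * conj (Q i x) - F i x ^ 2 * conj (G i x) := by
    have := ((hu1.mul hk ((hP.add hF).mul hk hQ')).add (he.mul hk (hF.mul hk hF)))
    refine (congrArg (BigO τ k 1) ?_).mp this
    funext i x
    ring
  have hA' : BigO τ k 1 fun i x =>
      conj (Q i x) ^ 2 * P i x - conj (G i x) ^ 2 * F i x := by
    have := ((he.mul hk ((hQ'.add hG').mul hk hP)).add (hu1.mul hk (hG'.mul hk hG')))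
    refine (congrArg (BigO τ k 1) ?_).mp this
    funext i x
    ring
  have hd : BigO τ k 2 fun i x => P i x - F i x - τ i * (F i x ^ 2 * conj (G i x)) := by
    refine (congrArg (BigO τ k 2) ?_).mp (hu2.add (hA.step_mul hτ))
    funext i x
    ring
  have he3 : BigO τ k 2 fun i x =>
      conj (Q i x) - conj (G i x) + τ i * (conj (G i x) ^ 2 * F i x) := by
    refine (congrArg (BigO τ k 2) ?_).mp (he2.sub (hA'.step_mul hτ))
    funext i x
    simp only [map_sub, map_add, map_mul, map_pow, Complex.conj_conj, Complex.conj_ofReal]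
    ring
  have hX : BigO τ k 2 fun i x => P i x ^ 2 * conj (Q i x) - F i x ^ 2 * conj (G i x) -
      τ i * (F i x ^ 3 * conj (G i x) ^ 2) := by
    have h1 := (he3.mul hk (hF.mul hk hF)).add ((hd.mul hk (hF.mul hk hG')).const_mul 2)
    have h2 := ((hu1.mul hk (he.mul hk hF)).const_mul 2).add (hu1.mul hk (hu1.mul hk hQ'))
    refine (congrArg (BigO τ k 2) ?_).mp (h1.add h2)
    funext i x
    ring
  have hw : BigO τ k 1 fun i x => 2 * (τ i : ℂ) * F i x * conj (G i x) := by
    refine (congrArg (BigO τ k 1) ?_).mp (((hF.mul hk hG').step_mul hτ).const_mul 2)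
    funext i x
    ring
  refine (congrArg (BigO τ k 3) ?_).mp
    (((hw.exp_remainder hk hT hF).sub hu3).sub ((hX.step_mul hτ).const_mul 2))
  funext i x
  ring

/-- The local error estimate for the first component, in phase space norms. -/
theorem exists_phaseNorm_strang_fst_le {k : ℕ} (hk : 1 ≤ k) (T : ℝ) (M : ℝ≥0) :
    ∃ C : ℝ≥0, ∀ τ : ℝ, 0 < τ → τ ≤ T → ∀ u v : ℝ → L2, IsRegularSolution (k + 4) M τ u v →
      MemLp (nonlinFst τ (freeFlow (τ / 2) (u 0)) (freeFlow (τ / 2) (v 0))) 2 ∧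
      phaseNorm k (freeFlow (τ / 2)
        (toL2 (nonlinFst τ (freeFlow (τ / 2) (u 0)) (freeFlow (τ / 2) (v 0)))) - u τ) ≤
        C * ENNReal.ofReal τ ^ 3 := by
  -- the index set of all solutions satisfying the bounds makes the constants uniform
  let ι : Type := {s : ℝ × (ℝ → L2) × (ℝ → L2) //
    0 < s.1 ∧ s.1 ≤ T ∧ IsRegularSolution (k + 4) M s.1 s.2.1 s.2.2}
  let τ : ι → ℝ := fun i => i.1.1
  let u : ι → ℝ → L2 := fun i => i.1.2.1
  let v : ι → ℝ → L2 := fun i => i.1.2.2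
  have hτ : ∀ i, 0 < τ i := fun i => i.2.1
  have hT : ∀ i, τ i ≤ T := fun i => i.2.2.1
  have hsol : ∀ i, IsRegularSolution (k + 4) M (τ i) (u i) (v i) := fun i => i.2.2.2
  have hu : Bdd τ (k + 4) u := ⟨M, fun i => (hsol i).bdd_fst⟩
  have hv : Bdd τ (k + 4) v := ⟨M, fun i => (hsol i).bdd_snd⟩
  have hdu : IsDer τ u fun i t => Complex.I • lap (u i t) + cubic (u i t) (v i t) :=
    fun i => (hsol i).deriv_fst
  have hdv : IsDer τ v fun i t => Complex.I • lap (v i t) + (-1 : ℂ) • cubic (v i t) (u i t) :=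
    fun i => (hsol i).deriv_snd
  have hRu : Reg τ k 2 u := reg_two_of_isDer hk (c := 1) hu hv (by simpa only [one_smul] using hdu) hdv
  have hRv : Reg τ k 2 v := reg_two_of_isDer hk (d := 1) hv hu hdv (by simpa only [one_smul] using hdu)
  obtain ⟨p0, f0, p1, p2, p3⟩ :=
    interaction_expansion hk hτ hT (hu.mono (by omega)) (hRu.cubic hk hRv) hdu
  obtain ⟨q0, g0, q1, q2, -⟩ :=
    interaction_expansion hk hτ hT (hv.mono (by omega)) ((hRv.cubic hk hRu).smul (-1)) hdv
  set p : ι → L2 := fun i => u i (τ i / 2)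
  set q : ι → L2 := fun i => v i (τ i / 2)
  set f : ι → L2 := fun i => freeFlow (τ i / 2) (u i 0) with hf
  set g : ι → L2 := fun i => freeFlow (τ i / 2) (v i 0) with hg
  set U : ι → L2 := fun i => freeFlow (-(τ i / 2)) (u i (τ i)) with hU
  have hNu : ∀ i, cubic (p i) (q i) =ᵐ[volume] fun x => 2 * p i x ^ 2 * conj (q i x) := fun i =>
    coeFn_cubic hk (p0.lt_top i) (q i)
  have hNv : ∀ i, cubic (q i) (p i) =ᵐ[volume] fun x => 2 * q i x ^ 2 * conj (p i x) := fun i =>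
    coeFn_cubic hk (q0.lt_top i) (p i)
  obtain ⟨S, ⟨A, hA⟩, hS⟩ := BigO.strang_algebra (U := fun i => ⇑(U i)) hk (fun i => (hτ i).le) hT
    p0.bigO q0.bigO f0.bigO g0.bigO
    (p1.bigO.congr fun i => Lp.coeFn_sub (p i) (f i)) (q1.bigO.congr fun i => Lp.coeFn_sub (q i) (g i))
    (p2.bigO.congr fun i => by
      filter_upwards [Lp.coeFn_sub (p i - f i) ((τ i / 2) • cubic (p i) (q i)),
        Lp.coeFn_sub (p i) (f i), Lp.coeFn_smul (τ i / 2) (cubic (p i) (q i)), hNu i]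
        with x h1 h2 h3 h4
      rw [h1, Pi.sub_apply, h2, h3, Pi.sub_apply, Pi.smul_apply, h4, Complex.real_smul]
      push_cast
      ring)
    (q2.bigO.congr fun i => by
      filter_upwards [Lp.coeFn_sub (q i - g i) ((τ i / 2) • ((-1 : ℂ) • cubic (q i) (p i))),
        Lp.coeFn_sub (q i) (g i), Lp.coeFn_smul (τ i / 2) ((-1 : ℂ) • cubic (q i) (p i)),
        Lp.coeFn_smul (-1 : ℂ) (cubic (q i) (p i)), hNv i] with x h1 h2 h3 h4 h5
      rw [h1, Pi.sub_apply, h2, h3, Pi.sub_apply, Pi.smul_apply, h4, Pi.smul_apply, h5,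
        Complex.real_smul, smul_eq_mul]
      push_cast
      ring)
    (p3.bigO.congr fun i => by
      filter_upwards [Lp.coeFn_sub (U i - f i) (τ i • cubic (p i) (q i)),
        Lp.coeFn_sub (U i) (f i), Lp.coeFn_smul (τ i) (cubic (p i) (q i)), hNu i] with x h1 h2 h3 h4
      rw [h1, Pi.sub_apply, h2, h3, Pi.sub_apply, Pi.smul_apply, h4, Complex.real_smul]
      ring)
  -- `S` represents the error before the last linear half step
  obtain ⟨C, hC⟩ := exists_phaseNorm_freeFlow_le hk T
  have hnl : ∀ i, ⇑(S i + U i) =ᵐ[volume] nonlinFst (τ i) (f i) (g i) := fun i => by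
    filter_upwards [hS i, Lp.coeFn_add (S i) (U i)] with x h1 h2
    rw [h2, Pi.add_apply, h1, nonlinFst]
    ring
  refine ⟨C * A, fun τ₀ h0 h1 u₀ v₀ hs => ?_⟩
  let i : ι := ⟨(τ₀, u₀, v₀), h0, h1, hs⟩
  have hmem : MemLp (nonlinFst (τ i) (f i) (g i)) 2 := (memLp_congr_ae (hnl i)).1 (Lp.memLp _)
  refine ⟨hmem, ?_⟩
  have e1 : toL2 (nonlinFst (τ i) (f i) (g i)) = S i + U i :=
    Lp.ext ((coeFn_toL2 hmem).trans (hnl i).symm)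
  have e2 : freeFlow (τ i / 2) (toL2 (nonlinFst (τ i) (f i) (g i))) - u i (τ i) =
      freeFlow (τ i / 2) (S i) := by
    rw [e1, freeFlow_add, hU, freeFlow_freeFlow, add_neg_cancel, freeFlow_zero, add_sub_cancel_right]
  change phaseNorm k (freeFlow (τ i / 2) (toL2 (nonlinFst (τ i) (f i) (g i))) - u i (τ i)) ≤
    _ * ENNReal.ofReal (τ i) ^ 3
  rw [e2, ENNReal.coe_mul, mul_assoc]
  refine (hC _ ?_ _).trans (mul_le_mul_right (hA i) _)
  rw [abs_of_pos (half_pos (hτ i))]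
  linarith [hτ i, hT i]

end

end CoupledNLS

theorem mainTheorem9 (k : ℕ) (hk : (1 / 2 : ℝ) < (k : ℝ)) (T : ℝ) (hT : 0 < T) (M : NNReal) :
    ∃ C : ℝ, 0 < C ∧ ∀ τ : ℝ, 0 < τ → τ ≤ T →
      ∀ u v : ℝ → CoupledNLS.L2, CoupledNLS.IsSolutionOn τ u v →
        (⨆ t ∈ Set.Icc (0 : ℝ) τ, CoupledNLS.sigmaNormPair (k + 4) (u t, v t)) ≤ (M : ENNReal) →
        CoupledNLS.NonlinStepInL2 τ (CoupledNLS.halfStep τ (u 0, v 0)) ∧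
        CoupledNLS.sigmaNormPair k (CoupledNLS.strang τ (u 0, v 0) - (u τ, v τ)) ≤
          ENNReal.ofReal (C * τ ^ 3) := by
  open CoupledNLS MeasureTheory in
  have hk1 : 1 ≤ k := by
    by_contra h
    have h0 : k = 0 := by omega
    norm_num [h0] at hk
  set M' : NNReal := 2 * 2 ^ (k + 4) * M with hM'
  obtain ⟨C, hC⟩ := exists_phaseNorm_strang_fst_le hk1 T M'
  have hpi := Real.pi_pos
  refine ⟨2 * ((2 * Real.pi) ^ k * C) + 1, by positivity, fun τ hτ hτT u v hsol hsup => ?_⟩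
  have hle : ∀ t ∈ Set.Icc 0 τ, sigmaNorm (k + 4) (u t) + sigmaNorm (k + 4) (v t) ≤ M :=
    fun t ht => (le_iSup₂ (f := fun t (_ : t ∈ Set.Icc (0 : ℝ) τ) =>
      sigmaNormPair (k + 4) (u t, v t)) t ht).trans hsup
  have hph : ∀ f : L2, sigmaNorm (k + 4) f ≤ M → phaseNorm (k + 4) f ≤ M' := fun f hf => by
    refine (phaseNorm_le_sigmaNorm (k + 4) f).trans ?_
    rw [hM', ENNReal.coe_mul]
    exact mul_le_mul_right hf _
  have hreg : IsRegularSolution (k + 4) M' τ u v := hsol.isRegularSolution (by omega)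
    (fun t ht => hph _ (le_self_add.trans (hle t ht)))
    (fun t ht => hph _ (le_add_self.trans (hle t ht)))
  obtain ⟨h1, h2⟩ := hC τ hτ hτT u v hreg
  obtain ⟨h3, h4⟩ := hC τ hτ hτT v (-u) (hreg.swap (by omega))
  -- the second component of the scheme for `(u, v)` is the first one for `(v, -u)`
  have hsnd : nonlinFst τ (freeFlow (τ / 2) (v 0)) (freeFlow (τ / 2) ((-u) 0)) =ᵐ[volume]
      nonlinSnd τ (freeFlow (τ / 2) (u 0)) (freeFlow (τ / 2) (v 0)) := by
    have e : freeFlow (τ / 2) ((-u) 0) = -freeFlow (τ / 2) (u 0) := by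
      simpa using freeFlow_smul (τ / 2) (-1) (u 0)
    rw [e]
    filter_upwards [Lp.coeFn_neg (freeFlow (τ / 2) (u 0))] with x hx
    rw [nonlinFst, nonlinSnd, hx, Pi.neg_apply, map_neg]
    congr 2
    ring
  have h5 := (memLp_congr_ae hsnd).1 h3
  refine ⟨⟨h1, h5⟩, ?_⟩
  have e6 : toL2 (nonlinFst τ (freeFlow (τ / 2) (v 0)) (freeFlow (τ / 2) ((-u) 0))) =
      toL2 (nonlinSnd τ (freeFlow (τ / 2) (u 0)) (freeFlow (τ / 2) (v 0))) :=
    Lp.ext ((coeFn_toL2 h3).trans (hsnd.trans (coeFn_toL2 h5).symm))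
  rw [e6] at h4
  have hfin : ∀ f : L2, phaseNorm k f ≤ C * ENNReal.ofReal τ ^ 3 →
      sigmaNorm k f ≤ ENNReal.ofReal ((2 * Real.pi) ^ k * C * τ ^ 3) := fun f hf => by
    refine (sigmaNorm_le_phaseNorm k f).trans ?_
    rw [mul_assoc, ENNReal.ofReal_mul (by positivity), ENNReal.ofReal_mul C.coe_nonneg,
      ENNReal.ofReal_coe_nnreal, ENNReal.ofReal_pow hτ.le]
    exact mul_le_mul_right hf _
  refine (add_le_add (hfin _ h2) (hfin _ h4)).trans ?_
  rw [← ENNReal.ofReal_add (by positivity) (by positivity)]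
  refine ENNReal.ofReal_le_ofReal ?_
  have := pow_pos hτ 3
  linarith
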